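/- **Setting.** Let $L$ be an even positive definite lattice of rank $r\ge 1$ with form $(\cdot,\cdot)$ and dual $L^\vee$; let $\widetilde{\mathrm O}(L)$ be the kernel of $\mathrm O(L)\to\mathrm O(L^\vee/L)$ and let $W$ be a group with $\widetilde{\mathrm O}(L)\le W\le \mathrm O(L)$. Put $M=\mathrm{II}_{1,1}\oplus \mathrm{II}_{1,1}\oplus L(-1)$, let $\mathcal A$ be one of the two connected components of $\{\mathcal Z\in M\otimes\mathbb C: (\mathcal Z,\mathcal Z)=0,\ (\mathcal Z,\overline{\mathcal Z})>0\}$, let $\mathrm O^+(M)\le \mathrm O(M)$ be the subgroup preserving $\mathcal A$, and let $\widetilde{\mathrm O}^+(M)$ be the kernel of $\mathrm O^+(M)\to \mathrm O(M^\vee/M)$. Let $\Gamma$ be the group generated by $\widetilde{\mathrm O}^+(M)$ and $W$ (acting trivially on the hyperbolic planes). A modular form of weight $k$ for $\Gamma$ is a holomorphic function $F$ on $\mathcal A$ with $F(t\mathcal Z)=t^{-k}F(\mathcal Z)$ for $t\in\mathbb C^*$ and $F(g\mathcal Z)=F(\mathcal Z)$ for $g\in\Gamma$; they form the space $M_k(\Gamma)$.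 Such an $F$ is viewed as a function on the tube domain $$\mathcal H(L)=\{(\tau,\mathfrak z,\omega)\in\mathbb H\times(L\otimes\mathbb C)\times\mathbb H:\ 2\operatorname{Im}\tau\operatorname{Im}\omega-(\operatorname{Im}\mathfrak z,\operatorname{Im}\mathfrak z)>0\}$$ through the embedding $(\tau,\mathfrak z,\omega)\mapsto \big((-\tau\omega+\tfrac12(\mathfrak z,\mathfrak z),\,1),\,(\omega,\tau),\,\mathfrak z\big)\in\mathcal A$ ($\mathcal A$ being the component that contains the image). Its Fourier–Jacobi expansion is $F=\sum_{m\ge 0}\psi_m(\tau,\mathfrak z)\,\xi^m$ with $\xi=e^{2\pi i\omega}$. A $W$-invariant weak Jacobi form of weight $k\in\mathbb Z$ and index $t\in\mathbb Z_{\ge 0}$ is a holomorphic $\varphi:\mathbb H\times(L\otimes\mathbb C)\to\mathbb C$ with $\varphi(\tau,\sigma\mathfrak z)=\varphi(\tau,\mathfrak z)$ for $\sigma\in W$, with $$\varphi(\tau,\mathfrak z+x\tau+y)=e^{-t\pi i((x,x)\tau+2(x,\mathfrak z))}\varphi(\tau,\mathfrak z)\quad (x,y\in L),$$ $$\varphi\Big(\tfrac{a\tau+b}{c\tau+d},\tfrac{\mathfrak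 z}{c\tau+d}\Big)=(c\tau+d)^k e^{t\pi i\frac{c(\mathfrak z,\mathfrak z)}{c\tau+d}}\varphi(\tau,\mathfrak z)\quad \big(\begin{smallmatrix}a&b\\c&d\end{smallmatrix}\big)\in\mathrm{SL}_2(\mathbb Z),$$ and with a Fourier expansion $\varphi=\sum_{n\ge 0}\sum_{\ell\in L^\vee}f(n,\ell)e^{2\pi i(n\tau+(\ell,\mathfrak z))}$. It is a holomorphic Jacobi form if moreover $f(n,\ell)=0$ whenever $2nt-(\ell,\ell)<0$. A formal Fourier–Jacobi expansion of weight $k$ is a sequence $(\psi_m)_{m\ge0}$, written $\sum_m\psi_m\xi^m$, in which $\psi_m$ is a $W$-invariant holomorphic Jacobi form of weight $k$ and index $m$, and whose Fourier coefficients satisfy $f_m(n,\ell)=f_n(m,\ell)$ for all $m,n\ge 0$, $\ell\in L^\vee$. They form the space $FM_k(\Gamma)$. **Assumption.** There are $W$-invariant weak Jacobi forms $\phi_1,\dots,\phi_{r+1}$, with $\phi_i$ of weight $-k_i$ and index $m_i$, that freely generate the bigraded ring of $W$-invariant weak Jacobi forms as an algebra over the graded ring of modular forms for $\mathrm{SL}_2(\mathbb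 Z)$. There are $\widetilde E_4\in M_4(\Gamma)$ and $\widetilde E_6\in M_6(\Gamma)$ whose zeroth Fourier–Jacobi coefficients are the Eisenstein series $E_4$ and $E_6$, and for each $i$ there is $\Phi_i\in M_{-k_i+12m_i}(\Gamma)$ with $\Phi_i=(\Delta^{m_i}\phi_i)\,\xi^{m_i}+O(\xi^{m_i+1})$, where $\Delta$ is the normalized cusp form of weight $12$. **Statement.** Under the Assumption, for every integer $k\ge 0$, the Fourier–Jacobi expansion is a linear isomorphism $M_k(\Gamma)\to FM_k(\Gamma)$, that is, $FM_k(\Gamma)=M_k(\Gamma)$. In particular, every formal Fourier–Jacobi expansion $\sum_m\psi_m\xi^m$ of weight $k$ converges (absolutely and locally uniformly) on $\mathcal H(L)$, and its sum is a modular form of weight $k$ for $\Gamma$. -/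

import Mathlib

open scoped UpperHalfPlane MatrixGroups Matrix

namespace OrthogonalModular

noncomputable section

/-! ## Lattices given by Gram matrices

A lattice is `ℤ^ι` with the bilinear form of an integral Gram matrix `S`. -/

section Lattices

variable {ι : Type*} [Fintype ι] [DecidableEq ι]

/-- The `R`-bilinear extension `(x, y) = xᵀ S y` of the form with Gram matrix `S`. -/
def form {R : Type*} [CommRing R] (S : Matrix ι ι ℤ) (x y : ι → R) : R :=
  x ⬝ᵥ ((S.map (Int.cast : ℤ → R)) *ᵥ y)

/-- The lattice `ℤ^ι` with Gram matrix `S` is even and positive definite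
(the latter includes that `S` is symmetric). -/
structure IsEvenPosDef (S : Matrix ι ι ℤ) : Prop where
  posDef : (S.map (Int.cast : ℤ → ℝ)).PosDef
  even : ∀ x : ι → ℤ, Even (form S x x)

/-- The action of an integral invertible matrix on `R^ι`. -/
def act {R : Type*} [CommRing R] (g : GL ι ℤ) (x : ι → R) : ι → R :=
  (g.1.map (Int.cast : ℤ → R)) *ᵥ x

theorem act_one {R : Type*} [CommRing R] (x : ι → R) : act (1 : GL ι ℤ) x = x := by
  simp [act, Matrix.map_one]

theorem act_mul {R : Type*} [CommRing R] (g h : GL ι ℤ) (x : ι → R) :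
    act (g * h) x = act g (act h x) := by
  have : (g * h).1.map (Int.cast : ℤ → R)
      = g.1.map (Int.cast : ℤ → R) * h.1.map (Int.cast : ℤ → R) :=
    Matrix.map_mul (f := Int.castRingHom R)
  simp only [act, this, Matrix.mulVec_mulVec]

theorem act_inv_act {R : Type*} [CommRing R] (g : GL ι ℤ) (x : ι → R) :
    act g⁻¹ (act g x) = x := by
  rw [← act_mul, inv_mul_cancel, act_one]

theorem act_act_inv {R : Type*} [CommRing R] (g : GL ι ℤ) (x : ι → R) :
    act g (act g⁻¹ x) = x := by
  rw [← act_mul, mul_inv_cancel, act_one]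

theorem act_add {R : Type*} [CommRing R] (g : GL ι ℤ) (x y : ι → R) :
    act g (x + y) = act g x + act g y := by
  simp [act, Matrix.mulVec_add]

/-- The image of an integral vector in `R^ι`. -/
def castVec (R : Type*) [CommRing R] (x : ι → ℤ) : ι → R := fun i => (x i : R)

theorem act_castVec {R : Type*} [CommRing R] (g : GL ι ℤ) (x : ι → ℤ) :
    act g (castVec R x) = castVec R (act g x) := by
  funext i
  simp [act, castVec, Matrix.mulVec, dotProduct]

/-- The orthogonal group of the lattice with Gram matrix `S`. -/
def orthogonalGroup (S : Matrix ι ι ℤ) : Subgroup (GL ι ℤ) where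
  carrier := {g | g.1.transpose * S * g.1 = S}
  one_mem' := by simp
  mul_mem' := by
    intro g h hg hh
    simp only [Set.mem_ofPred_eq] at hg hh ⊢
    calc (g * h).1.transpose * S * (g * h).1
        = h.1.transpose * (g.1.transpose * S * g.1) * h.1 := by
          simp [Matrix.transpose_mul, Matrix.mul_assoc]
      _ = S := by rw [hg, hh]
  inv_mem' := by
    intro g hg
    simp only [Set.mem_ofPred_eq] at hg ⊢
    have h1 : g.1 * (g⁻¹).1 = 1 := by
      rw [← Units.val_mul, mul_inv_cancel, Units.val_one]
    have h2 : (g⁻¹).1.transpose * g.1.transpose = 1 := by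
      rw [← Matrix.transpose_mul, h1, Matrix.transpose_one]
    calc (g⁻¹).1.transpose * S * (g⁻¹).1
        = (g⁻¹).1.transpose * (g.1.transpose * S * g.1) * (g⁻¹).1 := by rw [hg]
      _ = ((g⁻¹).1.transpose * g.1.transpose) * S * (g.1 * (g⁻¹).1) := by
          simp only [Matrix.mul_assoc]
      _ = S := by rw [h1, h2, Matrix.one_mul, Matrix.mul_one]

/-- The dual lattice `{ℓ ∈ ℚ^ι : (ℓ, x) ∈ ℤ for all x ∈ ℤ^ι}`. -/
def dualLattice (S : Matrix ι ι ℤ) : Set (ι → ℚ) :=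
  {l | ∀ x : ι → ℤ, ∃ n : ℤ, form S l (castVec ℚ x) = n}

/-- The discriminant kernel: the kernel of the action of the orthogonal group on the quotient
of the dual lattice by the lattice. -/
def discriminantKernel (S : Matrix ι ι ℤ) : Subgroup (GL ι ℤ) where
  carrier := {g | g ∈ orthogonalGroup S ∧
    ∀ l ∈ dualLattice S, ∃ y : ι → ℤ, act g l = l + castVec ℚ y}
  one_mem' := ⟨one_mem _, fun l _ => ⟨0, by simp [act_one, castVec, funext_iff]⟩⟩
  mul_mem' := by
    rintro g h ⟨hg, hg'⟩ ⟨hh, hh'⟩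
    refine ⟨mul_mem hg hh, fun l hl => ?_⟩
    obtain ⟨y, hy⟩ := hh' l hl
    obtain ⟨z, hz⟩ := hg' l hl
    refine ⟨z + act g y, ?_⟩
    rw [act_mul, hy, act_add, hz, act_castVec]
    funext i
    simp [castVec, add_assoc]
  inv_mem' := by
    rintro g ⟨hg, hg'⟩
    refine ⟨inv_mem hg, fun l hl => ?_⟩
    obtain ⟨y, hy⟩ := hg' l hl
    refine ⟨-(act g⁻¹ y), ?_⟩
    have h := congrArg (act g⁻¹) hy
    rw [act_inv_act, act_add, act_castVec] at h
    have h2 : castVec ℚ (-(act g⁻¹ y)) = -castVec ℚ (act g⁻¹ y) := by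
      funext i
      simp [castVec]
    rw [h2, ← sub_eq_add_neg, eq_sub_iff_add_eq, ← h]

end Lattices

/-! ## The lattice `M = II₁,₁ ⊕ II₁,₁ ⊕ L(-1)`, its affine cone and the tube domain -/

variable {r : ℕ}

/-- Coordinates of `M`: two hyperbolic planes and `L`. -/
abbrev MIndex (r : ℕ) : Type := Fin 2 ⊕ (Fin 2 ⊕ Fin r)

/-- The Gram matrix of the even unimodular hyperbolic plane `II₁,₁`. -/
def hyperbolicPlane : Matrix (Fin 2) (Fin 2) ℤ := !![0, 1; 1, 0]

/-- The Gram matrix of `M = II₁,₁ ⊕ II₁,₁ ⊕ L(-1)`, where `L` has Gram matrix `S`. -/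
def gramM (S : Matrix (Fin r) (Fin r) ℤ) : Matrix (MIndex r) (MIndex r) ℤ :=
  Matrix.fromBlocks hyperbolicPlane 0 0 (Matrix.fromBlocks hyperbolicPlane 0 0 (-S))

/-- The affine cone over the symmetric domain of type IV. The vectors `Z` with `(Z, Z) = 0` and
`(Z, conj Z) > 0` form two connected components that are swapped by complex conjugation (the
number `(Z, conj Z)` is real). The quotient of the second coordinate of the second
hyperbolic plane by the second coordinate of the first one is defined and not real on both;
the sign of its imaginary part selects a component. -/
def affineCone (S : Matrix (Fin r) (Fin r) ℤ) : Set (MIndex r → ℂ) :=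
  {Z | form (gramM S) Z Z = 0 ∧ 0 < (form (gramM S) Z (fun i => (starRingEnd ℂ) (Z i))).re ∧
    0 < (Z (Sum.inr (Sum.inl 1)) / Z (Sum.inl 1)).im}

/-- The subgroup of the orthogonal group of `M` that preserves the chosen component. -/
def orthogonalGroupPlus (S : Matrix (Fin r) (Fin r) ℤ) : Subgroup (GL (MIndex r) ℤ) where
  carrier := {g | g ∈ orthogonalGroup (gramM S) ∧
    ∀ Z : MIndex r → ℂ, act g Z ∈ affineCone S ↔ Z ∈ affineCone S}
  one_mem' := ⟨one_mem _, fun Z => by rw [act_one]⟩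
  mul_mem' := by
    rintro g h ⟨hg, hg'⟩ ⟨hh, hh'⟩
    exact ⟨mul_mem hg hh, fun Z => by rw [act_mul, hg', hh']⟩
  inv_mem' := by
    rintro g ⟨hg, hg'⟩
    exact ⟨inv_mem hg, fun Z => by rw [← hg' (act g⁻¹ Z), act_act_inv]⟩

/-- The embedding of the automorphisms of `L` into those of `M`, acting trivially on the two
hyperbolic planes. -/
def embedL : GL (Fin r) ℤ →* GL (MIndex r) ℤ :=
  Units.map
    { toFun := fun A => Matrix.fromBlocks 1 0 0 (Matrix.fromBlocks 1 0 0 A)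
      map_one' := by simp
      map_mul' := fun A B => by simp [Matrix.fromBlocks_multiply] }

/-- The group `Γ` generated by the discriminant kernel of the group `O⁺(M)` and by `W`. -/
def Gam (S : Matrix (Fin r) (Fin r) ℤ) (W : Subgroup (GL (Fin r) ℤ)) :
    Subgroup (GL (MIndex r) ℤ) :=
  (discriminantKernel (gramM S) ⊓ orthogonalGroupPlus S) ⊔ W.map embedL

/-- Modular forms of weight `k` for `Γ`: holomorphic functions on the affine cone, homogeneous of
degree `-k` and `Γ`-invariant. The cone is a complex submanifold of `M ⊗ ℂ`, and a function on it
is holomorphic if and only if it is complex differentiable within the cone at each point. -/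
def modularForms (S : Matrix (Fin r) (Fin r) ℤ) (Γ : Subgroup (GL (MIndex r) ℤ)) (k : ℤ) :
    Submodule ℂ (affineCone S → ℂ) where
  carrier := {F |
    (∃ G : (MIndex r → ℂ) → ℂ, DifferentiableOn ℂ G (affineCone S) ∧
      ∀ Z : affineCone S, F Z = G Z) ∧
    (∀ (t : ℂ) (Z Z' : affineCone S), t ≠ 0 → (Z' : MIndex r → ℂ) = t • (Z : MIndex r → ℂ) →
      F Z' = t ^ (-k) * F Z) ∧
    (∀ g ∈ Γ, ∀ Z Z' : affineCone S, (Z' : MIndex r → ℂ) = act g (Z : MIndex r → ℂ) →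
      F Z' = F Z)}
  zero_mem' := ⟨⟨0, differentiableOn_const 0, fun _ => rfl⟩, by simp, by simp⟩
  add_mem' := by
    rintro F F' ⟨⟨G, hG, hG'⟩, h1, h2⟩ ⟨⟨H, hH, hH'⟩, h3, h4⟩
    refine ⟨⟨G + H, hG.add hH, fun Z => by simp [hG', hH']⟩, fun t Z Z' ht h => ?_,
      fun g hg Z Z' h => ?_⟩
    · simp only [Pi.add_apply]
      rw [h1 t Z Z' ht h, h3 t Z Z' ht h, mul_add]
    · simp only [Pi.add_apply]
      rw [h2 g hg Z Z' h, h4 g hg Z Z' h]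
  smul_mem' := by
    rintro c F ⟨⟨G, hG, hG'⟩, h1, h2⟩
    refine ⟨⟨c • G, hG.const_smul c, fun Z => by simp [hG']⟩, fun t Z Z' ht h => ?_,
      fun g hg Z Z' h => ?_⟩
    · simp only [Pi.smul_apply, smul_eq_mul]
      rw [h1 t Z Z' ht h]
      ring
    · simp only [Pi.smul_apply]
      rw [h2 g hg Z Z' h]

/-- The tube domain `H(L)` of the points `(τ, z, ω)` with
`2 Im τ Im ω - (Im z, Im z) > 0`. -/
def tubeDomain (S : Matrix (Fin r) (Fin r) ℤ) : Set (ℍ × (Fin r → ℂ) × ℍ) :=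
  {Z | 0 < 2 * Z.1.im * Z.2.2.im - form S (fun i => (Z.2.1 i).im) (fun i => (Z.2.1 i).im)}

/-- The vector of the affine cone over a point `Z = (τ, z, ω)` of the tube domain: its coordinates
are `(-(Z, Z) / 2, 1)` in the first plane, with `(Z, Z) = 2 τ ω - (z, z)`, then `(ω, τ)` in the
second plane, and `z`. -/
def tubeVector (S : Matrix (Fin r) (Fin r) ℤ) (Z : ℍ × (Fin r → ℂ) × ℍ) : MIndex r → ℂ :=
  Sum.elim ![-((Z.1 : ℂ) * Z.2.2 - form S Z.2.1 Z.2.1 / 2), 1]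
    (Sum.elim ![(Z.2.2 : ℂ), (Z.1 : ℂ)] Z.2.1)

theorem form_gramM {R : Type*} [CommRing R] (S : Matrix (Fin r) (Fin r) ℤ) (a b c d : R)
    (a' b' c' d' : R) (v v' : Fin r → R) :
    form (gramM S) (Sum.elim ![a, b] (Sum.elim ![c, d] v))
      (Sum.elim ![a', b'] (Sum.elim ![c', d'] v'))
      = a * b' + b * a' + (c * d' + d * c') - form S v v' := by
  simp only [form, dotProduct, Matrix.mulVec, Matrix.map_apply, gramM, hyperbolicPlane,
    Fintype.sum_sum_type, Sum.elim_inl, Sum.elim_inr, Matrix.fromBlocks_apply₁₁,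
    Matrix.fromBlocks_apply₁₂, Matrix.fromBlocks_apply₂₁, Matrix.fromBlocks_apply₂₂,
    Fin.sum_univ_two, Matrix.zero_apply, Matrix.neg_apply]
  simp
  ring

theorem re_form_conj (S : Matrix (Fin r) (Fin r) ℤ) (z : Fin r → ℂ) :
    (form S z (fun i => (starRingEnd ℂ) (z i))).re - (form S z z).re
      = 2 * form S (fun i => (z i).im) (fun i => (z i).im) := by
  simp only [form, dotProduct, Matrix.mulVec, Matrix.map_apply, Complex.re_sum, Finset.mul_sum,
    ← Finset.sum_sub_distrib]
  refine Finset.sum_congr rfl fun i _ => Finset.sum_congr rfl fun j _ => ?_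
  simp
  ring

theorem tubeVector_mem (S : Matrix (Fin r) (Fin r) ℤ) (Z : ℍ × (Fin r → ℂ) × ℍ)
    (hZ : Z ∈ tubeDomain S) : tubeVector S Z ∈ affineCone S := by
  obtain ⟨τ, z, ω⟩ := Z
  simp only [tubeDomain, Set.mem_ofPred_eq] at hZ
  refine ⟨?_, ?_, ?_⟩
  · simp only [tubeVector, form_gramM]
    ring
  · have h : (fun i => (starRingEnd ℂ) (tubeVector S (τ, z, ω) i))
        = Sum.elim ![(starRingEnd ℂ) (-((τ : ℂ) * ω - form S z z / 2)), 1]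
          (Sum.elim ![(starRingEnd ℂ) (ω : ℂ), (starRingEnd ℂ) (τ : ℂ)]
            (fun i => (starRingEnd ℂ) (z i))) := by
      funext i
      rcases i with i | i | i
      · fin_cases i <;> simp [tubeVector]
      · fin_cases i <;> simp [tubeVector]
      · simp [tubeVector]
    rw [h]
    simp only [tubeVector, form_gramM]
    have h2 := re_form_conj S z
    have h3 : ((form S z z) / 2).re = (form S z z).re / 2 := by simp
    simp only [Complex.sub_re, Complex.add_re, Complex.mul_re, Complex.conj_re, Complex.conj_im,
      Complex.neg_re, Complex.neg_im, Complex.one_re, Complex.one_im, h3,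
      UpperHalfPlane.coe_re, UpperHalfPlane.coe_im]
    nlinarith [h2, hZ]
  · simp only [tubeVector, Sum.elim_inr, Sum.elim_inl]
    simpa using τ.im_pos

/-- The map from the tube domain to the affine cone. -/
def tubePoint (S : Matrix (Fin r) (Fin r) ℤ) (Z : tubeDomain S) : affineCone S :=
  ⟨tubeVector S Z, tubeVector_mem S Z Z.2⟩

/-! ## Jacobi forms -/

/-- Functions of `(τ, z)`. -/
abbrev JFun (r : ℕ) : Type := ℍ → (Fin r → ℂ) → ℂ

/-- `φ(τ, z) = ∑ f(n, ℓ) exp(2πi(nτ + (ℓ, z)))`, the sum over `n ∈ ℕ` and `ℓ` in the dual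
lattice. -/
def HasFourierExpansion (S : Matrix (Fin r) (Fin r) ℤ) (φ : JFun r)
    (f : ℕ → dualLattice S → ℂ) : Prop :=
  ∀ (τ : ℍ) (z : Fin r → ℂ), HasSum
    (fun p : ℕ × dualLattice S => f p.1 p.2 *
      Complex.exp (2 * Real.pi * Complex.I *
        (p.1 * (τ : ℂ) + form S (fun i => ((p.2 : Fin r → ℚ) i : ℂ)) z)))
    (φ τ z)

/-- `W`-invariant weak Jacobi forms of weight `k` and index `t` for the lattice with Gram
matrix `S`. -/
structure IsWeakJacobiForm (S : Matrix (Fin r) (Fin r) ℤ) (W : Subgroup (GL (Fin r) ℤ))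
    (k : ℤ) (t : ℕ) (φ : JFun r) : Prop where
  holomorphic : DifferentiableOn ℂ
    (fun p : ℂ × (Fin r → ℂ) => φ (UpperHalfPlane.ofComplex p.1) p.2) {p | 0 < p.1.im}
  invariant : ∀ σ ∈ W, ∀ τ z, φ τ (act σ z) = φ τ z
  elliptic : ∀ (x y : Fin r → ℤ) (τ : ℍ) (z : Fin r → ℂ),
    φ τ (z + (τ : ℂ) • castVec ℂ x + castVec ℂ y)
      = Complex.exp (-(t * Real.pi * Complex.I *
          (form S (castVec ℂ x) (castVec ℂ x) * (τ : ℂ) + 2 * form S (castVec ℂ x) z))) * φ τ z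
  modular : ∀ (γ : SL(2, ℤ)) (τ : ℍ) (z : Fin r → ℂ),
    φ (γ • τ) ((((γ 1 0 : ℤ) : ℂ) * τ + ((γ 1 1 : ℤ) : ℂ))⁻¹ • z)
      = (((γ 1 0 : ℤ) : ℂ) * τ + ((γ 1 1 : ℤ) : ℂ)) ^ k *
        Complex.exp (t * Real.pi * Complex.I *
          (((γ 1 0 : ℤ) : ℂ) * form S z z / (((γ 1 0 : ℤ) : ℂ) * τ + ((γ 1 1 : ℤ) : ℂ)))) *
        φ τ z
  fourier : ∃ f, HasFourierExpansion S φ f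

/-- `W`-invariant holomorphic Jacobi forms: weak Jacobi forms whose Fourier coefficients `f(n, ℓ)`
vanish whenever `2nt - (ℓ, ℓ) < 0`. -/
def IsHolomorphicJacobiForm (S : Matrix (Fin r) (Fin r) ℤ) (W : Subgroup (GL (Fin r) ℤ))
    (k : ℤ) (t : ℕ) (φ : JFun r) : Prop :=
  IsWeakJacobiForm S W k t φ ∧ ∃ f, HasFourierExpansion S φ f ∧
    ∀ (n : ℕ) (l : dualLattice S), 2 * (n : ℚ) * t - form S (l : Fin r → ℚ) l < 0 → f n l = 0

/-- The functions `φ₁, …, φ_{r+1}`, with `φᵢ` a `W`-invariant weak Jacobi form of weight `-κᵢ` and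
index `mᵢ`, freely generate the bigraded ring of `W`-invariant weak Jacobi forms over the graded
ring of modular forms for `SL(2, ℤ)`: each form of weight `k` and index `t` is equal, in a unique
way, to a polynomial `∑ₐ cₐ φ₁^{a₁} ⋯ φ_{r+1}^{a_{r+1}}` of bidegree `(k, t)`, that is, with
modular forms `cₐ` of weight `k + ∑ aᵢ κᵢ` and with `∑ aᵢ mᵢ = t` for all monomials that occur. -/
structure FreelyGenerate (S : Matrix (Fin r) (Fin r) ℤ) (W : Subgroup (GL (Fin r) ℤ))
    (κ : Fin (r + 1) → ℤ) (m : Fin (r + 1) → ℕ) (φ : Fin (r + 1) → JFun r) : Prop where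
  isWeak : ∀ i, IsWeakJacobiForm S W (-κ i) (m i) (φ i)
  existsUnique : ∀ (k : ℤ) (t : ℕ) (ψ : JFun r), IsWeakJacobiForm S W k t ψ →
    ∃! c : (Fin (r + 1) → ℕ) →₀ (ℍ → ℂ),
      (∀ a, ∃ g : ModularForm 𝒮ℒ (k + ∑ i, (a i : ℤ) * κ i), c a = g) ∧
      (∀ a ∈ c.support, ∑ i, a i * m i = t) ∧
      ∀ τ z, ψ τ z = ∑ a ∈ c.support, c a τ * ∏ i, φ i τ z ^ a i

/-! ## Fourier-Jacobi expansions -/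

/-- The `j`-th term `ψⱼ(τ, z) exp(2πijω)` of a Fourier-Jacobi series. -/
def fjTerm (ψ : ℕ → JFun r) (j : ℕ) (Z : ℍ × (Fin r → ℂ) × ℍ) : ℂ :=
  ψ j Z.1 Z.2.1 * Complex.exp (2 * Real.pi * Complex.I * (j * (Z.2.2 : ℂ)))

/-- `F = ∑ⱼ ψⱼ ξʲ` on the tube domain, `ξ = exp(2πiω)`. Such `ψⱼ` are unique: for fixed `(τ, z)`
the series is a power series in `ξ` on a punctured disc. -/
def IsFourierJacobiExpansion (S : Matrix (Fin r) (Fin r) ℤ) (F : affineCone S → ℂ)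
    (ψ : ℕ → JFun r) : Prop :=
  ∀ Z : tubeDomain S, HasSum (fun j => fjTerm ψ j Z) (F (tubePoint S Z))

/-- Formal Fourier-Jacobi expansions of weight `k`: sequences of `W`-invariant holomorphic Jacobi
forms `ψⱼ` of weight `k` and index `j` whose Fourier coefficients satisfy
`fⱼ(n, ℓ) = fₙ(j, ℓ)`. -/
def formalExpansions (S : Matrix (Fin r) (Fin r) ℤ) (W : Subgroup (GL (Fin r) ℤ)) (k : ℤ) :
    Submodule ℂ (ℕ → JFun r) where
  carrier := {ψ | (∀ j, IsHolomorphicJacobiForm S W k j (ψ j)) ∧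
    ∃ f : ℕ → ℕ → dualLattice S → ℂ, (∀ j, HasFourierExpansion S (ψ j) (f j)) ∧
      ∀ j n l, f j n l = f n j l}
  zero_mem' := by
    have h0 : HasFourierExpansion S (0 : JFun r) 0 := fun τ z => by
      simp
    refine ⟨fun j => ⟨⟨?_, ?_, ?_, ?_, 0, h0⟩, 0, h0, fun _ _ _ => rfl⟩, 0, fun _ => h0,
      fun _ _ _ => rfl⟩
    · exact differentiableOn_const 0
    all_goals intros; simp
  add_mem' := by
    have hadd : ∀ {φ φ' : JFun r} {f f' : ℕ → dualLattice S → ℂ},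
        HasFourierExpansion S φ f → HasFourierExpansion S φ' f' →
        HasFourierExpansion S (φ + φ') (f + f') := fun h h' τ z => by
      simpa [add_mul] using (h τ z).add (h' τ z)
    rintro ψ ψ' ⟨h, f, hf, hs⟩ ⟨h', f', hf', hs'⟩
    refine ⟨fun j => ⟨⟨(h j).1.holomorphic.add (h' j).1.holomorphic, ?_, ?_, ?_,
      f j + f' j, hadd (hf j) (hf' j)⟩, ?_⟩, f + f', fun j => hadd (hf j) (hf' j),
      fun j n l => by simp [hs j n l, hs' j n l]⟩
    · intro σ hσ τ z
      simp [(h j).1.invariant σ hσ, (h' j).1.invariant σ hσ]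
    · intro x y τ z
      simp only [Pi.add_apply, (h j).1.elliptic, (h' j).1.elliptic, mul_add]
    · intro γ τ z
      simp only [Pi.add_apply, (h j).1.modular, (h' j).1.modular, mul_add]
    · obtain ⟨g, hg, hg0⟩ := (h j).2
      obtain ⟨g', hg', hg0'⟩ := (h' j).2
      exact ⟨g + g', hadd hg hg', fun n l hl => by simp [hg0 n l hl, hg0' n l hl]⟩
  smul_mem' := by
    have hsm : ∀ (c : ℂ) {φ : JFun r} {f : ℕ → dualLattice S → ℂ},
        HasFourierExpansion S φ f → HasFourierExpansion S (c • φ) (c • f) := fun c _ _ h τ z => by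
      simpa [mul_assoc] using (h τ z).mul_left c
    rintro c ψ ⟨h, f, hf, hs⟩
    refine ⟨fun j => ⟨⟨(h j).1.holomorphic.const_smul c, ?_, ?_, ?_,
      c • f j, hsm c (hf j)⟩, ?_⟩, c • f, fun j => hsm c (hf j),
      fun j n l => by simp [hs j n l]⟩
    · intro σ hσ τ z
      simp [(h j).1.invariant σ hσ]
    · intro x y τ z
      simp only [Pi.smul_apply, smul_eq_mul, (h j).1.elliptic]
      ring
    · intro γ τ z
      simp only [Pi.smul_apply, smul_eq_mul, (h j).1.modular]
      ring
    · obtain ⟨g, hg, hg0⟩ := (h j).2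
      exact ⟨c • g, hsm c hg, fun n l hl => by simp [hg0 n l hl]⟩

/-- There are modular forms for `Γ` of weights `4` and `6` whose zeroth Fourier-Jacobi
coefficients are the Eisenstein series `E₄` and `E₆`, and modular forms `Φᵢ` of weights
`-κᵢ + 12 mᵢ` with `Φᵢ = Δ^{mᵢ} φᵢ ξ^{mᵢ} + O(ξ^{mᵢ + 1})`. -/
structure LiftsExist (S : Matrix (Fin r) (Fin r) ℤ) (W : Subgroup (GL (Fin r) ℤ))
    (κ : Fin (r + 1) → ℤ) (m : Fin (r + 1) → ℕ) (φ : Fin (r + 1) → JFun r) : Prop where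
  weightFour : ∃ F ∈ modularForms S (Gam S W) 4, ∃ ψ, IsFourierJacobiExpansion S F ψ ∧
    ∀ τ z, ψ 0 τ z = ModularForm.E₄ τ
  weightSix : ∃ F ∈ modularForms S (Gam S W) 6, ∃ ψ, IsFourierJacobiExpansion S F ψ ∧
    ∀ τ z, ψ 0 τ z = ModularForm.E₆ τ
  generators : ∀ i, ∃ F ∈ modularForms S (Gam S W) (-κ i + 12 * m i),
    ∃ ψ, IsFourierJacobiExpansion S F ψ ∧ (∀ j < m i, ψ j = 0) ∧
      ∀ τ z, ψ (m i) τ z = ModularForm.discriminant τ ^ m i * φ i τ z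

end

end OrthogonalModular

/-! The proof removes leading terms. Let `ψ` be a formal expansion of weight k with ψ_j = 0 for j <
t. By the symmetry f_t(n, ℓ) = f_n(t, ℓ), all coefficients of ψ_t with n < t vanish, so ψ_t is
divisible by Δ^t and ψ_t / Δ^t is a weak Jacobi form of weight k - 12t and index t
(`isWeakJacobiForm_div_discriminant`). The generators give ψ_t / Δ^t = ∑ c_a ∏ φ_i^{a_i} with ∑ a_i
m_i = t, hence ψ_t = ∑ c_a ∏ (Δ^{m_i} φ_i)^{a_i}. Each c_a is a polynomial in E₄ and E₆, so ψ_t is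
the leading coefficient of a modular form of weight k, a polynomial in the lifts of E₄ and E₆ and in
the Φ_i (`hasLift_leading`). Subtracting the expansion of that form increases t.

This stops after finitely many steps. The weights -κ_i + 12 m_i of the Φ_i are positive
(`weight_pos`), and a nonzero c_a has nonnegative weight k - ∑ a_i (-κ_i + 12 m_i). Hence ∑ a_i ≤ k
and t = ∑ a_i m_i ≤ k ∑ m_i. A formal expansion that starts beyond this bound is zero, so every
formal expansion is the expansion of a modular form, and convergence is inherited from that form.

For the subtraction, the expansion of a modular form must itself be a formal expansion
(`exists_isFourierJacobiExpansion`). A modular form is a periodic holomorphic function on a tube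
over a convex cone and so has an absolutely convergent Fourier series
(`exists_fourierExp_expansion`). Explicit elements of Γ give the rest: exchanging τ and ω gives the
symmetry, Eichler transvections give the elliptic law, an embedded SL(2, ℤ) the modular law.
Koecher's principle (`coeff_eq_zero_of_isotropic`) also comes from transvections: they move an
exponent that is negative on an isotropic vector to ever larger exponential terms with the same
coefficient.

Positivity of the weights rests on `IsHolomorphicJacobiForm.eq_zero`: a holomorphic Jacobi form of
positive index and weight at most 0 vanishes. Such a form is bounded for real z, so by Bessel's
inequality near Im τ = 0 its coefficients are square summable; but they are constant on infinite
orbits of the lattice. -/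

namespace OrthogonalModular

noncomputable section

open MeasureTheory Complex Topology Filter

/-! ### Fourier series on the torus: uniqueness, Bessel's inequality, decay. -/

section ExponentialSeries

-- The circle carries Haar measure of total mass one, for which the characters of the torus are
-- orthonormal.
local instance : MeasureSpace UnitAddCircle := ⟨AddCircle.haarAddCircle⟩

local instance : Measure.IsAddHaarMeasure (volume : Measure UnitAddCircle) :=
  inferInstanceAs (Measure.IsAddHaarMeasure AddCircle.haarAddCircle)

local instance : IsProbabilityMeasure (volume : Measure UnitAddCircle) :=
  inferInstanceAs (IsProbabilityMeasure AddCircle.haarAddCircle)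

variable {ι : Type*} [Fintype ι] {P : Type*}

/-- The exponential `exp(2πi ∑ⱼ Nⱼ Zⱼ)`. -/
def fourierExp (N : ι → ℤ) (Z : ι → ℂ) : ℂ :=
  Complex.exp (2 * Real.pi * Complex.I * ∑ j, (N j : ℂ) * Z j)

theorem fourierExp_ne_zero (N : ι → ℤ) (Z : ι → ℂ) : fourierExp N Z ≠ 0 :=
  Complex.exp_ne_zero _

theorem fourierExp_add (N : ι → ℤ) (Z Z' : ι → ℂ) :
    fourierExp N (Z + Z') = fourierExp N Z * fourierExp N Z' := by
  simp only [fourierExp, ← Complex.exp_add, Pi.add_apply, mul_add, Finset.sum_add_distrib]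

theorem fourierExp_add_left (N N' : ι → ℤ) (Z : ι → ℂ) :
    fourierExp (N + N') Z = fourierExp N Z * fourierExp N' Z := by
  simp only [fourierExp, ← Complex.exp_add, Pi.add_apply, Int.cast_add, add_mul,
    Finset.sum_add_distrib, mul_add]

theorem fourierExp_zero_left (Z : ι → ℂ) : fourierExp (0 : ι → ℤ) Z = 1 := by
  simp [fourierExp]

theorem fourierExp_neg_left (N : ι → ℤ) (Z : ι → ℂ) :
    fourierExp (-N) Z = (fourierExp N Z)⁻¹ := by
  refine eq_inv_of_mul_eq_one_left ?_
  rw [← fourierExp_add_left, neg_add_cancel, fourierExp_zero_left]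

theorem fourierExp_intCast (N M : ι → ℤ) : fourierExp N (fun j => (M j : ℂ)) = 1 := by
  have : (2 * Real.pi * Complex.I * ∑ j, (N j : ℂ) * (M j : ℂ))
      = ((∑ j, N j * M j : ℤ) : ℂ) * (2 * Real.pi * Complex.I) := by
    push_cast; ring
  rw [fourierExp, this, Complex.exp_int_mul_two_pi_mul_I]

theorem norm_fourierExp (N : ι → ℤ) (Z : ι → ℂ) :
    ‖fourierExp N Z‖ = Real.exp (-(2 * Real.pi * ∑ j, (N j : ℝ) * (Z j).im)) := by
  rw [fourierExp, Complex.norm_exp]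
  congr 1
  have : (2 * Real.pi * Complex.I * ∑ j, (N j : ℂ) * Z j)
      = ((2 * Real.pi : ℝ) : ℂ) * (Complex.I * ∑ j, (N j : ℂ) * Z j) := by push_cast; ring
  rw [this, Complex.re_ofReal_mul, Complex.I_mul_re, Complex.im_sum]
  simp [Complex.mul_im]

theorem mFourier_coe_eq_fourierExp (N : ι → ℤ) (X : ι → ℝ) :
    UnitAddTorus.mFourier N (fun j => (X j : UnitAddCircle)) = fourierExp N (fun j => (X j : ℂ)) := by
  simp only [UnitAddTorus.mFourier, ContinuousMap.coe_mk, fourierExp, Finset.mul_sum,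
    Complex.exp_sum]
  refine Finset.prod_congr rfl fun j _ => ?_
  rw [fourier_coe_apply]
  congr 1
  push_cast
  ring

theorem differentiable_fourierExp (N : ι → ℤ) : Differentiable ℂ (fourierExp N) := by
  unfold fourierExp
  fun_prop

/-- A summable trigonometric series on the torus has its coefficients as inner products. -/
theorem exists_hasSum_mFourier {A : (ι → ℤ) → ℂ} (hA : Summable A) :
    ∃ g : C(UnitAddTorus ι, ℂ), (∀ x, HasSum (fun N => A N * UnitAddTorus.mFourier N x) (g x)) ∧
      ∀ M, inner ℂ (UnitAddTorus.mFourierLp 2 M) (ContinuousMap.toLp 2 volume ℂ g) = A M := by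
  have hs : Summable fun N => A N • UnitAddTorus.mFourier (d := ι) N := by
    refine Summable.of_norm ?_
    simpa only [norm_smul, UnitAddTorus.mFourier_norm, mul_one] using hA.norm
  obtain ⟨g, hg⟩ := hs
  refine ⟨g, fun x => ?_, fun M => ?_⟩
  · have := (ContinuousMap.evalCLM ℂ x).hasSum hg
    simpa using this
  · have h1 := (ContinuousMap.toLp 2 (volume : Measure (UnitAddTorus ι)) ℂ).hasSum hg
    have h2 := (innerSL ℂ (UnitAddTorus.mFourierLp (d := ι) 2 M)).hasSum h1
    have h3 : ∀ N, innerSL ℂ (UnitAddTorus.mFourierLp (d := ι) 2 M)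
        ((ContinuousMap.toLp 2 (volume : Measure (UnitAddTorus ι)) ℂ)
          (A N • UnitAddTorus.mFourier N)) = if N = M then A M else 0 := by
      intro N
      classical
      rw [map_smul, innerSL_apply_apply, inner_smul_right,
        orthonormal_iff_ite.mp UnitAddTorus.orthonormal_mFourier M N]
      by_cases h : N = M
      · simp [h]
      · simp [h, Ne.symm h]
    refine h2.unique ?_
    rw [funext (fun N => h3 N : ∀ N, _ = _)]
    exact hasSum_ite_eq M (A M)

/-- The point `X + iY`. -/
def realAdd {ι : Type*} (X : ι → ℝ) (Z : ι → ℂ) : ι → ℂ := (fun j => (X j : ℂ)) + Z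

theorem realAdd_zero {ι : Type*} (Z : ι → ℂ) : realAdd 0 Z = Z := by
  funext j
  simp [realAdd]

theorem coe_surjective_torus {ι : Type*} (x : UnitAddTorus ι) :
    ∃ X : ι → ℝ, (fun j => (X j : UnitAddCircle)) = x := by
  choose X hX using fun j => QuotientAddGroup.mk_surjective (x j)
  exact ⟨X, funext hX⟩

/-- Fourier coefficients on a real slice are unique. -/
theorem fourierExp_coeff_unique {a b : (ι → ℤ) → ℂ} {f : (ι → ℂ) → ℂ} (Z : ι → ℂ)
    (ha : ∀ X : ι → ℝ, HasSum (fun N => a N * fourierExp N (realAdd X Z)) (f (realAdd X Z)))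
    (hb : ∀ X : ι → ℝ, HasSum (fun N => b N * fourierExp N (realAdd X Z)) (f (realAdd X Z))) :
    a = b := by
  have hd : ∀ X : ι → ℝ,
      HasSum (fun N => (a N - b N) * fourierExp N (realAdd X Z)) 0 := fun X => by
    simpa [sub_mul] using (ha X).sub (hb X)
  -- At X = 0 this is the summability of the coefficients of a trigonometric series in X, to which
  -- the torus theory applies.
  have hs : Summable fun N => (a N - b N) * fourierExp N Z := by
    simpa only [realAdd_zero] using (hd 0).summable
  obtain ⟨g, hg, hg'⟩ := exists_hasSum_mFourier hs
  have h0 : g = 0 := by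
    ext x
    obtain ⟨X, rfl⟩ := coe_surjective_torus x
    refine (hg _).unique ?_
    rw [ContinuousMap.zero_apply]
    convert hd X using 2 with N
    rw [mFourier_coe_eq_fourierExp, realAdd, fourierExp_add]
    ring
  funext M
  have := hg' M
  rw [h0, map_zero, inner_zero_right] at this
  have h := (mul_eq_zero.mp this.symm).resolve_right (fourierExp_ne_zero _ _)
  exact sub_eq_zero.mp h

/-- Bessel's inequality on a real slice. -/
theorem sum_norm_coeff_sq_le {a : (ι → ℤ) → ℂ} {f : (ι → ℂ) → ℂ} (Z : ι → ℂ) {C : ℝ}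
    (ha : ∀ X : ι → ℝ, HasSum (fun N => a N * fourierExp N (realAdd X Z)) (f (realAdd X Z)))
    (hC : ∀ X : ι → ℝ, ‖f (realAdd X Z)‖ ≤ C) (T : Finset (ι → ℤ)) :
    ∑ N ∈ T, ‖a N * fourierExp N Z‖ ^ 2 ≤ C ^ 2 := by
  have hs : Summable fun N => a N * fourierExp N Z := by
    simpa only [realAdd_zero] using (ha 0).summable
  obtain ⟨g, hg, hg'⟩ := exists_hasSum_mFourier hs
  have hC0 : 0 ≤ C := (norm_nonneg _).trans (hC 0)
  have hgC : ‖g‖ ≤ C := by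
    rw [ContinuousMap.norm_le _ hC0]
    intro x
    obtain ⟨X, rfl⟩ := coe_surjective_torus x
    refine le_of_eq_of_le (congrArg norm ((hg _).unique ?_)) (hC X)
    convert ha X using 2 with N
    rw [mFourier_coe_eq_fourierExp, realAdd, fourierExp_add]
    ring
  have h1 := (UnitAddTorus.orthonormal_mFourier (d := ι)).sum_inner_products_le
    (ContinuousMap.toLp 2 volume ℂ g) (s := T)
  simp only [hg'] at h1
  refine h1.trans ?_
  gcongr
  refine (ContinuousLinearMap.le_opNorm _ _).trans ?_
  have h2 := ContinuousMap.toLp_norm_le (p := 2) (μ := (volume : Measure (UnitAddTorus ι)))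
    (E := ℂ) (𝕜 := ℂ)
  -- Since the measure has mass one, the L² norm is at most the supremum norm.
  have h3 : measureUnivNNReal (volume : Measure (UnitAddTorus ι)) = 1 := by
    simp [measureUnivNNReal]
  rw [h3] at h2
  rw [NNReal.coe_one, Real.one_rpow] at h2
  calc _ ≤ 1 * ‖g‖ := by gcongr
    _ ≤ C := by rw [one_mul]; exact hgC

/-- Sums over an injective family of exponents are sums over all exponents. -/
theorem hasSum_extend_fourierExp {ν : P → ι → ℤ} (hν : Function.Injective ν) {a : P → ℂ}
    {Z : ι → ℂ} {s : ℂ} :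
    HasSum (fun N => Function.extend ν a 0 N * fourierExp N Z) s ↔
      HasSum (fun p => a p * fourierExp (ν p) Z) s := by
  rw [← hν.hasSum_iff]
  · simp [Function.comp_def, hν.extend_apply]
  · intro N hN
    rw [Function.extend_apply' _ _ _ (by simpa using hN)]
    simp

/-- A finite set of exponents lies in a box, and over a box the sum factors into one-dimensional
geometric sums. -/
theorem summable_exp_neg_sum_abs {c : ℝ} (hc : 0 < c) :
    Summable fun N : ι → ℤ => Real.exp (-(c * ∑ j, |(N j : ℝ)|)) := by
  classical
  have h1 : Summable fun n : ℤ => Real.exp (-(c * |(n : ℝ)|)) := by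
    refine Summable.of_nat_of_neg ?_ ?_ <;>
    · have := Real.summable_exp_nat_mul_iff.mpr (neg_lt_zero.mpr hc)
      refine this.congr fun n => ?_
      simp [mul_comm]
  refine summable_of_sum_le (c := (∑' n : ℤ, Real.exp (-(c * |(n : ℝ)|))) ^ Fintype.card ι)
    (fun N => (Real.exp_pos _).le) fun s => ?_
  set T : ι → Finset ℤ := fun j => s.image fun N => N j
  have hsub : s ⊆ Fintype.piFinset T := fun N hN => by
    simp only [Fintype.mem_piFinset, T]
    exact fun j => Finset.mem_image_of_mem _ hN
  calc ∑ N ∈ s, Real.exp (-(c * ∑ j, |(N j : ℝ)|))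
      ≤ ∑ N ∈ Fintype.piFinset T, Real.exp (-(c * ∑ j, |(N j : ℝ)|)) :=
        Finset.sum_le_sum_of_subset_of_nonneg hsub fun _ _ _ => (Real.exp_pos _).le
    _ = ∑ N ∈ Fintype.piFinset T, ∏ j, Real.exp (-(c * |(N j : ℝ)|)) := by
        refine Finset.sum_congr rfl fun N _ => ?_
        rw [← Real.exp_sum, Finset.mul_sum, Finset.sum_neg_distrib]
    _ = ∏ j, ∑ n ∈ T j, Real.exp (-(c * |(n : ℝ)|)) :=
        (Finset.prod_univ_sum T fun _ n => Real.exp (-(c * |(n : ℝ)|))).symm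
    _ ≤ ∏ _j : ι, ∑' n : ℤ, Real.exp (-(c * |(n : ℝ)|)) := by
        refine Finset.prod_le_prod (fun j _ => Finset.sum_nonneg fun _ _ => (Real.exp_pos _).le)
          fun j _ => h1.sum_le_tsum _ fun _ _ => (Real.exp_pos _).le
    _ = _ := by simp

/-- Sign vectors. -/
def signVec (s : ι → Bool) (j : ι) : ℝ := if s j then 1 else -1

/-- Moving the imaginary part by δ times this vector, opposite to the signs of N, enlarges the
exponential by exp(2πδ ∑ |N_j|). As there are only finitely many sign vectors, estimates at finitely
many shifted points yield exponential decay for all N at once. -/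
theorem exists_signVec (N : ι → ℤ) :
    ∃ s : ι → Bool, ∑ j, (N j : ℝ) * signVec s j = -∑ j, |(N j : ℝ)| := by
  refine ⟨fun j => decide (N j < 0), ?_⟩
  rw [← Finset.sum_neg_distrib]
  refine Finset.sum_congr rfl fun j _ => ?_
  by_cases h : N j < 0
  · have : (N j : ℝ) < 0 := by exact_mod_cast h
    simp [signVec, h, abs_of_neg this]
  · have : (0 : ℝ) ≤ N j := by exact_mod_cast not_lt.mp h
    simp [signVec, h, abs_of_nonneg this]

theorem norm_fourierExp_add_signVec (N : ι → ℤ) (Z : ι → ℂ) (δ : ℝ) (s : ι → Bool) :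
    ‖fourierExp N (Z + fun j => ((δ * signVec s j : ℝ) : ℂ) * I)‖
      = ‖fourierExp N Z‖ * Real.exp (-(2 * Real.pi * δ * ∑ j, (N j : ℝ) * signVec s j)) := by
  have h : ∑ j, (N j : ℝ) * (((δ * signVec s j : ℝ) : ℂ) * I).im
      = δ * ∑ j, (N j : ℝ) * signVec s j := by
    rw [Finset.mul_sum]
    refine Finset.sum_congr rfl fun j _ => ?_
    rw [Complex.im_ofReal_mul, Complex.I_im]
    ring
  rw [fourierExp_add, norm_mul, norm_fourierExp N (fun j => ((δ * signVec s j : ℝ) : ℂ) * I), h,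
    mul_assoc (2 * Real.pi)]

theorem exists_signVec_mem {D : Set (ι → ℂ)} (hD : IsOpen D) {Z : ι → ℂ} (hZ : Z ∈ D) :
    ∃ δ : ℝ, 0 < δ ∧ ∀ s : ι → Bool, (Z + fun j => ((δ * signVec s j : ℝ) : ℂ) * I) ∈ D := by
  obtain ⟨ε, hε, hball⟩ := Metric.isOpen_iff.mp hD Z hZ
  refine ⟨ε / 2, by positivity, fun s => hball ?_⟩
  rw [Metric.mem_ball, dist_eq_norm, add_sub_cancel_left]
  refine lt_of_le_of_lt ((pi_norm_le_iff_of_nonneg (by positivity : 0 ≤ ε / 2)).mpr fun j => ?_)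
    (half_lt_self hε)
  rw [norm_mul, Complex.norm_I, mul_one, Complex.norm_real, norm_mul, Real.norm_eq_abs,
    abs_of_pos (half_pos hε)]
  have : ‖signVec s j‖ = 1 := by unfold signVec; split_ifs <;> simp
  rw [this, mul_one]

/-- An exponential series that converges on an open set has exponentially decaying terms. -/
theorem exists_summable_decay {D : Set (ι → ℂ)} (hD : IsOpen D) {a : P → ℂ} {ν : P → ι → ℤ}
    (h : ∀ Z ∈ D, Summable fun p => a p * fourierExp (ν p) Z) {Z : ι → ℂ} (hZ : Z ∈ D) :
    ∃ δ : ℝ, 0 < δ ∧ Summable fun p =>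
      ‖a p * fourierExp (ν p) Z‖ * Real.exp (δ * ∑ j, |(ν p j : ℝ)|) := by
  classical
  obtain ⟨δ, hδ, hmem⟩ := exists_signVec_mem hD hZ
  -- Each exponent profits from one of the sign vectors; summing over all of them dominates every
  -- case.
  have hsum : Summable fun p => ∑ s : ι → Bool,
      ‖a p * fourierExp (ν p) (Z + fun j => ((δ * signVec s j : ℝ) : ℂ) * I)‖ :=
    summable_sum fun s _ => (h _ (hmem s)).norm
  refine ⟨2 * Real.pi * δ, by positivity, hsum.of_nonneg_of_le (fun p => by positivity) fun p => ?_⟩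
  obtain ⟨s, hs⟩ := exists_signVec (ν p)
  refine le_trans (le_of_eq ?_) (Finset.single_le_sum (f := fun s : ι → Bool =>
    ‖a p * fourierExp (ν p) (Z + fun j => ((δ * signVec s j : ℝ) : ℂ) * I)‖)
    (fun _ _ => norm_nonneg _) (Finset.mem_univ s))
  simp only [norm_mul, norm_fourierExp_add_signVec, hs]
  rw [mul_assoc]
  congr 3
  ring

end ExponentialSeries

end

end OrthogonalModular

namespace OrthogonalModular

noncomputable section

open MeasureTheory Complex Topology Filter

/-! ### Locally uniform convergence and holomorphy of exponential series. -/

section ExponentialSeries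

variable {ι : Type*} [Fintype ι] {P : Type*}

theorem norm_fourierExp_le_of_norm_sub_le (N : ι → ℤ) {Z Z' : ι → ℂ} {ε : ℝ}
    (h : ‖Z' - Z‖ ≤ ε) :
    ‖fourierExp N Z'‖ ≤ ‖fourierExp N Z‖ * Real.exp (2 * Real.pi * ε * ∑ j, |(N j : ℝ)|) := by
  have : Z' = Z + (Z' - Z) := by abel
  rw [this, fourierExp_add, norm_mul]
  gcongr
  rw [norm_fourierExp]
  refine Real.exp_le_exp.mpr ?_
  rw [mul_assoc (2 * Real.pi), ← mul_neg, Finset.mul_sum, ← Finset.sum_neg_distrib]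
  refine mul_le_mul_of_nonneg_left (Finset.sum_le_sum fun j _ => ?_)
    (by positivity : (0 : ℝ) ≤ 2 * Real.pi)
  refine (neg_le_abs _).trans ?_
  rw [abs_mul, mul_comm]
  gcongr
  exact (Complex.abs_im_le_norm _).trans ((norm_le_pi_norm _ j).trans h)

/-- A convergent exponential series has a locally uniform summable majorant, even after
multiplication with the size of the exponents. -/
theorem exists_summable_majorant {D : Set (ι → ℂ)} (hD : IsOpen D) {a : P → ℂ} {ν : P → ι → ℤ}
    (h : ∀ Z ∈ D, Summable fun p => a p * fourierExp (ν p) Z) {Z : ι → ℂ} (hZ : Z ∈ D) :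
    ∃ u : P → ℝ, Summable u ∧ ∃ ε : ℝ, 0 < ε ∧ ∀ p, ∀ Z' ∈ Metric.ball Z ε,
      ‖a p * fourierExp (ν p) Z'‖ * (1 + ∑ j, |(ν p j : ℝ)|) ≤ u p := by
  obtain ⟨δ, hδ, hs⟩ := exists_summable_decay hD h hZ
  -- Half of the decay rate δ' pays for the move from `Z` to `Z'`, the other half for the factor 1 +
  -- s. The cap at 1 ensures 2 / δ' ≥ 1.
  set δ' := min δ 1
  have hδ' : 0 < δ' := lt_min hδ one_pos
  refine ⟨_, hs.mul_left (2 / δ'), δ' / 2 / (2 * Real.pi), by positivity, fun p Z' hZ' => ?_⟩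
  set s := ∑ j, |(ν p j : ℝ)|
  have hs0 : 0 ≤ s := Finset.sum_nonneg fun _ _ => abs_nonneg _
  have h1 := norm_fourierExp_le_of_norm_sub_le (ν p) (mem_ball_iff_norm.mp hZ').le
  have h2 : 2 * Real.pi * (δ' / 2 / (2 * Real.pi)) = δ' / 2 := by field_simp
  rw [h2] at h1
  have h3 : 1 + s ≤ 2 / δ' * Real.exp (δ' / 2 * s) := by
    have := Real.add_one_le_exp (δ' / 2 * s)
    calc 1 + s ≤ 2 / δ' * (δ' / 2 * s + 1) := by
          have : 1 ≤ 2 / δ' := by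
            rw [le_div_iff₀ hδ', one_mul]; exact (min_le_right _ _).trans (by norm_num)
          have h4 : 2 / δ' * (δ' / 2 * s + 1) = s + 2 / δ' := by field_simp
          linarith
      _ ≤ _ := by gcongr
  calc ‖a p * fourierExp (ν p) Z'‖ * (1 + s)
      ≤ (‖a p‖ * (‖fourierExp (ν p) Z‖ * Real.exp (δ' / 2 * s)))
          * (2 / δ' * Real.exp (δ' / 2 * s)) := by
        rw [norm_mul]; gcongr
    _ = 2 / δ' * (‖a p * fourierExp (ν p) Z‖ * Real.exp (δ' * s)) := by
        rw [show δ' * s = δ' / 2 * s + δ' / 2 * s by ring, Real.exp_add, norm_mul]; ring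
    _ ≤ _ := by gcongr; exact min_le_left _ _

/-- The linear form `Z ↦ 2πi ∑ⱼ Nⱼ Zⱼ`. -/
def exponentForm (N : ι → ℤ) : (ι → ℂ) →L[ℂ] ℂ :=
  (2 * Real.pi * Complex.I) • ∑ j, (N j : ℂ) • ContinuousLinearMap.proj (R := ℂ) (φ := fun _ => ℂ) j

theorem exponentForm_apply (N : ι → ℤ) (Z : ι → ℂ) :
    exponentForm N Z = 2 * Real.pi * Complex.I * ∑ j, (N j : ℂ) * Z j := by
  simp [exponentForm]

theorem norm_exponentForm_le (N : ι → ℤ) :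
    ‖exponentForm N‖ ≤ 2 * Real.pi * ∑ j, |(N j : ℝ)| := by
  refine ContinuousLinearMap.opNorm_le_bound _
    (mul_nonneg (by positivity) (Finset.sum_nonneg fun _ _ => abs_nonneg _)) fun Z => ?_
  rw [exponentForm_apply, norm_mul]
  have : ‖(2 * Real.pi * Complex.I : ℂ)‖ = 2 * Real.pi := by
    simp [abs_of_pos Real.pi_pos]
  rw [this, mul_assoc (2 * Real.pi), Finset.sum_mul]
  gcongr
  refine (norm_sum_le _ _).trans (Finset.sum_le_sum fun j _ => ?_)
  rw [norm_mul, Complex.norm_intCast]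
  gcongr
  exact norm_le_pi_norm _ j

theorem hasFDerivAt_fourierExp (N : ι → ℤ) (Z : ι → ℂ) :
    HasFDerivAt (fourierExp N) (fourierExp N Z • exponentForm N) Z := by
  have h1 : fourierExp N = fun Z => Complex.exp (exponentForm N Z) := by
    funext Z
    rw [exponentForm_apply, fourierExp]
  rw [h1]
  exact (exponentForm N).hasFDerivAt.cexp

/-- Termwise differentiation costs a factor of at most 2π ∑ |N_j|, which the weight 1 + ∑ |N_j| in
`exists_summable_majorant` absorbs. -/
theorem differentiableOn_tsum_fourierExp {D : Set (ι → ℂ)} (hD : IsOpen D) {a : P → ℂ}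
    {ν : P → ι → ℤ} (h : ∀ Z ∈ D, Summable fun p => a p * fourierExp (ν p) Z) :
    DifferentiableOn ℂ (fun Z => ∑' p, a p * fourierExp (ν p) Z) D := by
  intro Z hZ
  obtain ⟨u, hu, ε, hε, hb⟩ := exists_summable_majorant hD h hZ
  refine (HasFDerivAt.differentiableAt (hasFDerivAt_tsum_of_isPreconnected
    (hu.mul_left (2 * Real.pi)) Metric.isOpen_ball
    (convex_ball Z ε).isPreconnected (fun p Z' _ => (hasFDerivAt_fourierExp (ν p) Z').const_mul (a p))
    (fun p Z' hZ' => ?_) (Metric.mem_ball_self hε) (h Z hZ)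
    (Metric.mem_ball_self hε))).differentiableWithinAt
  rw [smul_smul, norm_smul]
  calc ‖a p * fourierExp (ν p) Z'‖ * ‖exponentForm (ν p)‖
      ≤ ‖a p * fourierExp (ν p) Z'‖ * (2 * Real.pi * (1 + ∑ j, |(ν p j : ℝ)|)) := by
        gcongr
        refine (norm_exponentForm_le _).trans ?_
        gcongr
        linarith
    _ ≤ 2 * Real.pi * u p := by
        have := hb p Z' hZ'
        nlinarith [Real.pi_pos]

end ExponentialSeries

end

end OrthogonalModular

namespace OrthogonalModular

noncomputable section

open MeasureTheory Complex Topology Filter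

/-! ### Fourier expansion of periodic holomorphic functions on tubes. -/

section PeriodicFunctions

set_option linter.unusedSectionVars false

local instance : MeasureSpace UnitAddCircle := ⟨AddCircle.haarAddCircle⟩

local instance : Measure.IsAddHaarMeasure (volume : Measure UnitAddCircle) :=
  inferInstanceAs (Measure.IsAddHaarMeasure AddCircle.haarAddCircle)

local instance : IsProbabilityMeasure (volume : Measure UnitAddCircle) :=
  inferInstanceAs (IsProbabilityMeasure AddCircle.haarAddCircle)

variable {ι : Type*} [Fintype ι]

/-- A set of representatives of the torus in the unit cube. -/
def torusRep {ι : Type*} (x : UnitAddTorus ι) (j : ι) : ℝ := (AddCircle.equivIco 1 0 (x j)).1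

theorem coe_torusRep {ι : Type*} (x : UnitAddTorus ι) :
    (fun j => (torusRep x j : UnitAddCircle)) = x := by
  funext j
  exact AddCircle.coe_equivIco

theorem torusRep_mem {ι : Type*} (x : UnitAddTorus ι) (j : ι) : torusRep x j ∈ Set.Icc (0 : ℝ) 1 := by
  have := (AddCircle.equivIco 1 0 (x j)).2
  simp only [zero_add] at this
  exact ⟨this.1, this.2.le⟩

/-- The tube over `C`. -/
def tubeOver {ι : Type*} (C : Set (ι → ℝ)) : Set (ι → ℂ) := {Z | (fun j => (Z j).im) ∈ C}

theorem realAdd_mem_tubeOver {ι : Type*} {C : Set (ι → ℝ)} (X : ι → ℝ) {Z : ι → ℂ} :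
    realAdd X Z ∈ tubeOver C ↔ Z ∈ tubeOver C := by
  simp [realAdd, tubeOver]

theorem isOpen_tubeOver {ι : Type*} {C : Set (ι → ℝ)} (hC : IsOpen C) : IsOpen (tubeOver C) :=
  hC.preimage (by fun_prop)

theorem realAdd_eq_of_coe_eq {ι : Type*} {f : (ι → ℂ) → ℂ} {C : Set (ι → ℝ)}
    (hper : ∀ Z ∈ tubeOver C, ∀ M : ι → ℤ, f (Z + fun j => (M j : ℂ)) = f Z) {Z : ι → ℂ}
    (hZ : Z ∈ tubeOver C) {X X' : ι → ℝ}
    (h : (fun j => (X j : UnitAddCircle)) = fun j => (X' j : UnitAddCircle)) :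
    f (realAdd X Z) = f (realAdd X' Z) := by
  have h1 : ∀ j, ∃ n : ℤ, X j = X' j + n := fun j => by
    have h2 : ((X j - X' j : ℝ) : UnitAddCircle) = 0 := by
      rw [AddCircle.coe_sub, sub_eq_zero]
      exact congrFun h j
    obtain ⟨n, hn⟩ := AddCircle.coe_eq_zero_iff 1 |>.mp h2
    exact ⟨n, by simp at hn; linarith⟩
  choose M hM using h1
  rw [← hper _ ((realAdd_mem_tubeOver X').mpr hZ) M]
  congr 1
  funext j
  simp only [realAdd, Pi.add_apply, hM j]
  push_cast
  ring

/-- The function on the torus that is induced by the values of a periodic function on a real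
slice. -/
def torusLift {ι : Type*} (f : (ι → ℂ) → ℂ) (Z : ι → ℂ) (x : UnitAddTorus ι) : ℂ :=
  f (realAdd (torusRep x) Z)

section

variable {f : (ι → ℂ) → ℂ} {C : Set (ι → ℝ)}

theorem torusLift_coe (hper : ∀ Z ∈ tubeOver C, ∀ M : ι → ℤ, f (Z + fun j => (M j : ℂ)) = f Z)
    {Z : ι → ℂ} (hZ : Z ∈ tubeOver C) (X : ι → ℝ) :
    torusLift f Z (fun j => (X j : UnitAddCircle)) = f (realAdd X Z) :=
  realAdd_eq_of_coe_eq hper hZ (coe_torusRep _)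

/-- The representative `torusRep` is discontinuous, but real space maps to the torus by an open
quotient map, and pulled back along it the lift is `f` on the slice. -/
theorem continuous_torusLift (hf : DifferentiableOn ℂ f (tubeOver C))
    (hper : ∀ Z ∈ tubeOver C, ∀ M : ι → ℤ, f (Z + fun j => (M j : ℂ)) = f Z)
    {Z : ι → ℂ} (hZ : Z ∈ tubeOver C) : Continuous (torusLift f Z) := by
  have hq : IsOpenQuotientMap (Pi.map fun (_ : ι) (x : ℝ) => (x : UnitAddCircle)) :=
    IsOpenQuotientMap.piMap fun _ => QuotientAddGroup.isOpenQuotientMap_mk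
  refine hq.isQuotientMap.continuous_iff.mpr ?_
  have : torusLift f Z ∘ (Pi.map fun (_ : ι) (x : ℝ) => (x : UnitAddCircle))
      = fun X => f (realAdd X Z) := by
    funext X
    exact torusLift_coe hper hZ X
  rw [this]
  refine hf.continuousOn.comp_continuous ?_ fun X => (realAdd_mem_tubeOver X).mpr hZ
  unfold realAdd
  fun_prop

/-- Translating the slice by a real vector translates the torus, and Haar measure is invariant. -/
theorem integral_torusLift_realAdd
    (hper : ∀ Z ∈ tubeOver C, ∀ M : ι → ℤ, f (Z + fun j => (M j : ℂ)) = f Z)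
    {Z : ι → ℂ} (hZ : Z ∈ tubeOver C) (X : ι → ℝ) :
    ∫ x, torusLift f (realAdd X Z) x = ∫ x, torusLift f Z x := by
  rw [← integral_add_right_eq_self (torusLift f Z) (fun j => (X j : UnitAddCircle))]
  congr 1
  funext x
  have h1 : x + (fun j => (X j : UnitAddCircle))
      = fun j => ((torusRep x j + X j : ℝ) : UnitAddCircle) := by
    conv_lhs => rw [← coe_torusRep x]
    rfl
  rw [h1, torusLift_coe hper hZ, torusLift]
  congr 1
  funext j
  simp [realAdd, add_assoc]

/-- The points of a complex line that meets the tube. -/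
def lineMap {ι : Type*} (Y Y' : ι → ℝ) (s : ℂ) (j : ι) : ℂ := I * Y j + s * (Y' j - Y j)

theorem lineMap_im {ι : Type*} (Y Y' : ι → ℝ) (s : ℂ) (j : ι) :
    (lineMap Y Y' s j).im = Y j + s.im * (Y' j - Y j) := by
  simp [lineMap]

theorem continuous_lineMap {ι : Type*} (Y Y' : ι → ℝ) : Continuous (lineMap Y Y') := by
  unfold lineMap
  fun_prop

theorem differentiable_lineMap (Y Y' : ι → ℝ) (X : ι → ℝ) :
    Differentiable ℂ fun s => realAdd X (lineMap Y Y' s) := by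
  unfold lineMap realAdd
  rw [differentiable_pi]
  intro j
  simp only [Pi.add_apply]
  fun_prop

/-- Differentiation under the integral. The representatives stay in the unit cube, so `f` is bounded
by one M on all slices near `s`, and Cauchy's estimate on discs of radius R bounds the derivative by
M / R. -/
theorem hasDerivAt_integral_torusLift (hC : IsOpen C) (hf : DifferentiableOn ℂ f (tubeOver C))
    (hper : ∀ Z ∈ tubeOver C, ∀ M : ι → ℤ, f (Z + fun j => (M j : ℂ)) = f Z)
    (Y Y' : ι → ℝ) {s : ℂ} (hs : lineMap Y Y' s ∈ tubeOver C) :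
    ∃ d, HasDerivAt (fun s => ∫ x, torusLift f (lineMap Y Y' s) x) d s := by
  have hopen : IsOpen (lineMap Y Y' ⁻¹' tubeOver C) :=
    (isOpen_tubeOver hC).preimage (continuous_lineMap Y Y')
  obtain ⟨ε, hε, hball⟩ := Metric.isOpen_iff.mp hopen s hs
  set R := ε / 3
  have hR : 0 < R := by positivity
  have hsub : Metric.closedBall s (2 * R) ⊆ lineMap Y Y' ⁻¹' tubeOver C :=
    (Metric.closedBall_subset_ball (by simp only [R]; linarith)).trans hball
  have hdiff : ∀ x : UnitAddTorus ι, DifferentiableOn ℂ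
      (fun s => torusLift f (lineMap Y Y' s) x) (lineMap Y Y' ⁻¹' tubeOver C) := fun x =>
    hf.comp (differentiable_lineMap Y Y' (torusRep x)).differentiableOn fun s hs =>
      (realAdd_mem_tubeOver _).mpr hs
  obtain ⟨M, hM⟩ : ∃ M, ∀ x : UnitAddTorus ι, ∀ s' ∈ Metric.closedBall s (2 * R),
      ‖torusLift f (lineMap Y Y' s') x‖ ≤ M := by
    have hcomp : IsCompact ((fun p : (ι → ℝ) × ℂ => realAdd p.1 (lineMap Y Y' p.2)) ''
        ((Set.univ.pi fun _ => Set.Icc (0 : ℝ) 1) ×ˢ Metric.closedBall s (2 * R))) := by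
      refine ((isCompact_univ_pi fun _ => isCompact_Icc).prod
        (isCompact_closedBall _ _)).image ?_
      have := continuous_lineMap Y Y'
      unfold realAdd
      fun_prop
    obtain ⟨M, hM⟩ := hcomp.exists_bound_of_continuousOn (f := f) (hf.continuousOn.mono (by
      rintro _ ⟨p, hp, rfl⟩
      exact (realAdd_mem_tubeOver _).mpr (hsub hp.2)))
    exact ⟨M, fun x s' hs' => hM _ ⟨(torusRep x, s'), ⟨fun j _ => torusRep_mem x j, hs'⟩, rfl⟩⟩
  have hcont : ∀ s' ∈ Metric.closedBall s (2 * R),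
      Continuous (torusLift f (lineMap Y Y' s')) := fun s' hs' =>
    continuous_torusLift hf hper (hsub hs')
  have hself : s ∈ Metric.closedBall s (2 * R) := Metric.mem_closedBall_self (by positivity)
  refine ⟨_, (hasDerivAt_integral_of_dominated_loc_of_deriv_le (μ := volume)
    (F := fun s' x => torusLift f (lineMap Y Y' s') x)
    (F' := fun s' x => deriv (fun s' => torusLift f (lineMap Y Y' s') x) s')
    (bound := fun _ => M / R) (s := Metric.ball s R) (Metric.ball_mem_nhds s hR) ?_ ?_ ?_ ?_ ?_
    ?_).2⟩
  · filter_upwards [Metric.closedBall_mem_nhds s (by positivity : 0 < 2 * R)] with s' hs'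
    exact (hcont s' hs').aestronglyMeasurable
  · exact (hcont s hself).integrable_of_hasCompactSupport (HasCompactSupport.of_compactSpace _)
  -- The derivative is measurable on the torus because it is the pointwise limit of the continuous
  -- difference quotients with steps R / (n + 1).
  · have hn : ∀ n : ℕ, s + ((R / (n + 1) : ℝ) : ℂ) ∈ Metric.closedBall s (2 * R) := fun n => by
      rw [Metric.mem_closedBall, dist_eq_norm, add_sub_cancel_left, Complex.norm_real,
        Real.norm_eq_abs, abs_of_pos (by positivity)]
      calc R / (n + 1) ≤ R := div_le_self hR.le (by linarith [Nat.cast_nonneg (α := ℝ) n])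
        _ ≤ 2 * R := by linarith
    have htend : Tendsto (fun n : ℕ => ((R / (n + 1) : ℝ) : ℂ)) atTop (𝓝[≠] 0) := by
      refine tendsto_nhdsWithin_iff.mpr ⟨?_, Eventually.of_forall fun n => ?_⟩
      · have : Tendsto (fun n : ℕ => R / ((n : ℝ) + 1)) atTop (𝓝 0) :=
          tendsto_const_nhds.div_atTop
            (tendsto_natCast_atTop_atTop.atTop_add tendsto_const_nhds)
        have h := (Complex.continuous_ofReal.tendsto 0).comp this
        rwa [Complex.ofReal_zero] at h
      · have : R / ((n : ℝ) + 1) ≠ 0 := by positivity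
        exact Complex.ofReal_ne_zero.mpr this
    refine aestronglyMeasurable_of_tendsto_ae (u := atTop)
      (f := fun (n : ℕ) x => ((R / (n + 1) : ℝ) : ℂ)⁻¹ •
        (torusLift f (lineMap Y Y' (s + ((R / (n + 1) : ℝ) : ℂ))) x
          - torusLift f (lineMap Y Y' s) x)) (fun n => ?_) (Eventually.of_forall fun x => ?_)
    · exact (((hcont _ (hn n)).sub (hcont s hself)).const_smul
        (((R / (n + 1) : ℝ) : ℂ)⁻¹)).aestronglyMeasurable
    · have hd := ((hdiff x).differentiableAt (hopen.mem_nhds hs)).hasDerivAt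
      exact hd.tendsto_slope_zero.comp htend
  · refine Eventually.of_forall fun x s' hs' => ?_
    have hsub' : Metric.closedBall s' R ⊆ Metric.closedBall s (2 * R) := by
      refine Metric.closedBall_subset_closedBall' ?_
      have := (Metric.mem_ball.mp hs').le
      linarith
    refine Complex.norm_deriv_le_of_forall_mem_sphere_norm_le hR ?_ fun w hw =>
      hM x w (hsub' (Metric.sphere_subset_closedBall hw))
    exact ((hdiff x).mono (hsub'.trans hsub)).diffContOnCl_ball subset_rfl
  · exact integrable_const _
  · refine Eventually.of_forall fun x s' hs' => ?_
    refine ((hdiff x).differentiableAt (hopen.mem_nhds (hsub ?_))).hasDerivAt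
    exact Metric.ball_subset_closedBall (Metric.ball_subset_ball (by linarith) hs')

/-- On the complex line with value iY at s = 0 and iY' at s = i, a real change of `s` is a real
translation. The mean over the torus is thus holomorphic in `s` and independent of Re s, so its
derivative vanishes. The set of admissible `s` is convex, which connects 0 and i. -/
theorem integral_torusLift_eq (hC : IsOpen C) (hconv : Convex ℝ C)
    (hf : DifferentiableOn ℂ f (tubeOver C))
    (hper : ∀ Z ∈ tubeOver C, ∀ M : ι → ℤ, f (Z + fun j => (M j : ℂ)) = f Z)
    {Y Y' : ι → ℝ} (hY : Y ∈ C) (hY' : Y' ∈ C) :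
    ∫ x, torusLift f (fun j => I * Y j) x = ∫ x, torusLift f (fun j => I * Y' j) x := by
  set H : ℂ → ℂ := fun s => ∫ x, torusLift f (lineMap Y Y' s) x
  have hopen : IsOpen (lineMap Y Y' ⁻¹' tubeOver C) :=
    (isOpen_tubeOver hC).preimage (continuous_lineMap Y Y')
  have hmem : ∀ s, s ∈ lineMap Y Y' ⁻¹' tubeOver C ↔
      (fun j => Y j + s.im * (Y' j - Y j)) ∈ C := fun s => by
    simp only [Set.mem_preimage, tubeOver, Set.mem_ofPred_eq, lineMap_im]
  have hU : Convex ℝ (lineMap Y Y' ⁻¹' tubeOver C) := by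
    intro s hs t ht a b ha hb hab
    rw [hmem] at hs ht ⊢
    convert hconv hs ht ha hb hab using 1
    funext j
    simp only [Complex.add_im, Complex.smul_im, Pi.add_apply, Pi.smul_apply, smul_eq_mul]
    linear_combination (-Y j) * hab
  have hderiv : ∀ s ∈ lineMap Y Y' ⁻¹' tubeOver C, HasDerivAt H 0 s := fun s hs => by
    obtain ⟨d, hd⟩ := hasDerivAt_integral_torusLift hC hf hper Y Y' hs
    have hconst : ∀ t : ℝ, H (s + t) = H s := fun t => by
      have : lineMap Y Y' (s + t) = realAdd (fun j => t * (Y' j - Y j)) (lineMap Y Y' s) := by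
        funext j
        simp only [lineMap, realAdd, Pi.add_apply]
        push_cast
        ring
      simp only [H, this]
      exact integral_torusLift_realAdd hper hs _
    have hd' : HasDerivAt (fun t : ℝ => H (s + t)) d 0 := by
      have h1 : HasDerivAt (fun t : ℂ => H (s + t)) d ((0 : ℝ) : ℂ) := by
        refine HasDerivAt.comp_const_add s _ ?_
        simpa using hd
      exact h1.comp_ofReal
    have : d = 0 := hd'.unique (by simpa only [hconst] using! hasDerivAt_const (0 : ℝ) (H s))
    rwa [this] at hd
  have key : H 0 = H I := hopen.is_const_of_deriv_eq_zero hU.isPreconnected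
    (fun s hs => (hderiv s hs).differentiableAt.differentiableWithinAt)
    (fun s hs => (hderiv s hs).deriv) ((hmem 0).mpr (by simpa using hY))
    ((hmem I).mpr (by simpa using hY'))
  have h0 : lineMap Y Y' 0 = fun j => I * Y j := by funext j; simp [lineMap]
  have h1 : lineMap Y Y' I = fun j => I * Y' j := by funext j; simp only [lineMap]; ring
  simpa only [H, h0, h1] using key

/-- A periodic holomorphic function on a tube over an open convex set has an absolutely convergent
Fourier expansion. -/
theorem exists_fourierExp_expansion (hC : IsOpen C) (hconv : Convex ℝ C)
    (hf : DifferentiableOn ℂ f (tubeOver C))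
    (hper : ∀ Z ∈ tubeOver C, ∀ M : ι → ℤ, f (Z + fun j => (M j : ℂ)) = f Z) :
    ∃ c : (ι → ℤ) → ℂ, ∀ Z ∈ tubeOver C, HasSum (fun N => c N * fourierExp N Z) (f Z) := by
  classical
  rcases C.eq_empty_or_nonempty with rfl | ⟨Y₀, hY₀⟩
  · exact ⟨0, fun Z hZ => hZ.elim⟩
  set F : (ι → ℤ) → (ι → ℂ) → ℂ := fun N Z => f Z * fourierExp (-N) Z
  have hFd : ∀ N, DifferentiableOn ℂ (F N) (tubeOver C) := fun N =>
    hf.mul (differentiable_fourierExp _).differentiableOn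
  have hFper : ∀ N, ∀ Z ∈ tubeOver C, ∀ M : ι → ℤ,
      F N (Z + fun j => (M j : ℂ)) = F N Z := fun N Z hZ M => by
    simp only [F, hper Z hZ M, fourierExp_add, fourierExp_intCast, mul_one]
  have hI : ∀ {Y : ι → ℝ}, Y ∈ C → (fun j => I * (Y j : ℂ)) ∈ tubeOver C := fun {Y} hY => by
    simpa [tubeOver] using hY
  set c : (ι → ℤ) → ℂ := fun N => ∫ x, torusLift (F N) (fun j => I * Y₀ j) x
  -- The coefficient is the mean of f(Z) exp(-2πi N·Z), which does not depend on the height;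
  -- returning to the character of the torus costs the exponential at height Y.
  have hcoeff : ∀ Y ∈ C, ∀ N, UnitAddTorus.mFourierCoeff (torusLift f (fun j => I * Y j)) N
      = c N * fourierExp N (fun j => I * Y j) := fun Y hY N => by
    simp only [c]
    rw [integral_torusLift_eq hC hconv (hFd N) (hFper N) hY₀ hY, ← integral_mul_const]
    refine integral_congr_ae (Eventually.of_forall fun x => ?_)
    have h1 : UnitAddTorus.mFourier (-N) x = fourierExp (-N) (fun j => (torusRep x j : ℂ)) := by
      rw [← mFourier_coe_eq_fourierExp, coe_torusRep]
    simp only [h1, torusLift, F, smul_eq_mul]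
    conv_rhs => rw [realAdd, fourierExp_add, fourierExp_neg_left N (fun j => I * (Y j : ℂ))]
    have := fourierExp_ne_zero N (fun j => I * (Y j : ℂ))
    rw [realAdd]
    field_simp
  have hbound : ∀ Y ∈ C, ∃ B : ℝ, ∀ N, ‖c N * fourierExp N (fun j => I * Y j)‖ ≤ B :=
    fun Y hY => by
    have hcont := continuous_torusLift hf hper (hI hY)
    refine ⟨‖(⟨_, hcont⟩ : C(UnitAddTorus ι, ℂ))‖, fun N => ?_⟩
    rw [← hcoeff Y hY N, UnitAddTorus.mFourierCoeff]
    refine (norm_integral_le_of_norm_le_const (C := ‖(⟨_, hcont⟩ : C(UnitAddTorus ι, ℂ))‖)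
      (Eventually.of_forall fun x => ?_)).trans (by simp)
    rw [norm_smul]
    have h1 : ‖UnitAddTorus.mFourier (-N) x‖ ≤ 1 :=
      (ContinuousMap.norm_coe_le_norm _ x).trans UnitAddTorus.mFourier_norm.le
    have h2 := ContinuousMap.norm_coe_le_norm (⟨_, hcont⟩ : C(UnitAddTorus ι, ℂ)) x
    calc _ ≤ 1 * ‖(⟨_, hcont⟩ : C(UnitAddTorus ι, ℂ))‖ := by
          gcongr
          exact h2
      _ = _ := one_mul _
  -- Boundedness at the finitely many heights Y + δs, with s a sign vector, gives exponential decay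
  -- of the terms at Y.
  have hsum : ∀ Y ∈ C, Summable fun N => c N * fourierExp N (fun j => I * Y j) := fun Y hY => by
    obtain ⟨δ, hδ, hmem⟩ := exists_signVec_mem (isOpen_tubeOver hC) (hI hY)
    have hform : ∀ s : ι → Bool, ((fun j => I * (Y j : ℂ)) + fun j => ((δ * signVec s j : ℝ) : ℂ) * I)
        = fun j => I * ((Y j + δ * signVec s j : ℝ) : ℂ) := fun s => by
      funext j
      simp only [Pi.add_apply]
      push_cast
      ring
    have hYs : ∀ s : ι → Bool, (fun j => Y j + δ * signVec s j) ∈ C := fun s => by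
      have := hmem s
      rw [hform s] at this
      simpa [tubeOver] using this
    choose B hB using fun s => hbound _ (hYs s)
    refine Summable.of_norm_bounded (g := fun N => (∑ s, |B s|) *
      Real.exp (-(2 * Real.pi * δ * ∑ j, |(N j : ℝ)|)))
      ((summable_exp_neg_sum_abs (by positivity)).mul_left _) fun N => ?_
    obtain ⟨s, hs⟩ := exists_signVec N
    have h1 := hB s N
    rw [← hform s, norm_mul, norm_fourierExp_add_signVec, hs, ← mul_assoc, ← norm_mul, mul_neg,
      neg_neg] at h1
    rw [Real.exp_neg, ← div_eq_mul_inv, le_div_iff₀ (Real.exp_pos _)]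
    refine h1.trans ((le_abs_self _).trans ?_)
    exact Finset.single_le_sum (f := fun s => |B s|) (fun _ _ => abs_nonneg _) (Finset.mem_univ s)
  refine ⟨c, fun Z hZ => ?_⟩
  set Y : ι → ℝ := fun j => (Z j).im
  have hY : Y ∈ C := hZ
  have hZeq : Z = realAdd (fun j => (Z j).re) (fun j => I * (Y j : ℂ)) := by
    funext j
    simp only [realAdd, Pi.add_apply, Y]
    rw [mul_comm I, Complex.re_add_im]
  have hcont := continuous_torusLift hf hper (hI hY)
  have h1 := UnitAddTorus.hasSum_mFourier_series_apply_of_summable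
    (f := (⟨_, hcont⟩ : C(UnitAddTorus ι, ℂ))) (by
      refine (hsum Y hY).congr fun N => ?_
      exact (hcoeff Y hY N).symm) (fun j => ((Z j).re : UnitAddCircle))
  have h2 : (⟨_, hcont⟩ : C(UnitAddTorus ι, ℂ)) (fun j => ((Z j).re : UnitAddCircle)) = f Z := by
    rw [ContinuousMap.coe_mk, torusLift_coe hper (hI hY), ← hZeq]
  rw [h2] at h1
  convert h1 using 2 with N
  rw [ContinuousMap.coe_mk, hcoeff Y hY N, mFourier_coe_eq_fourierExp, smul_eq_mul]
  conv_lhs => rw [hZeq, realAdd, fourierExp_add]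
  ring

end

end PeriodicFunctions

end

end OrthogonalModular

namespace OrthogonalModular

noncomputable section

/-! ### Bilinear forms and Eichler transvections. -/

section BilinearForms

variable {ι : Type*} [Fintype ι] {R : Type*} [CommRing R] (S : Matrix ι ι ℤ)

theorem form_add_left (x y z : ι → R) : form S (x + y) z = form S x z + form S y z := by
  simp [form, add_dotProduct]

theorem form_add_right (x y z : ι → R) : form S x (y + z) = form S x y + form S x z := by
  simp [form, Matrix.mulVec_add]

theorem form_smul_left (c : R) (x y : ι → R) : form S (c • x) y = c * form S x y := by
  simp [form]

theorem form_smul_right (c : R) (x y : ι → R) : form S x (c • y) = c * form S x y := by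
  simp [form, Matrix.mulVec_smul]

theorem form_neg_left (x y : ι → R) : form S (-x) y = -form S x y := by
  simp [form]

theorem form_neg_right (x y : ι → R) : form S x (-y) = -form S x y := by
  simp [form, Matrix.mulVec_neg]

theorem form_sub_left (x y z : ι → R) : form S (x - y) z = form S x z - form S y z := by
  rw [sub_eq_add_neg, form_add_left, form_neg_left, sub_eq_add_neg]

theorem form_sub_right (x y z : ι → R) : form S x (y - z) = form S x y - form S x z := by
  rw [sub_eq_add_neg, form_add_right, form_neg_right, sub_eq_add_neg]

theorem form_zero_left (x : ι → R) : form S 0 x = 0 := by simp [form]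

theorem form_zero_right (x : ι → R) : form S x 0 = 0 := by simp [form]

theorem form_eq_sum (x y : ι → R) : form S x y = ∑ i, ∑ j, x i * ((S i j : R) * y j) := by
  simp only [form, dotProduct, Matrix.mulVec, Matrix.map_apply, Finset.mul_sum]

variable {S}

theorem form_comm (hS : S.IsSymm) (x y : ι → R) : form S x y = form S y x := by
  rw [form_eq_sum, form_eq_sum, Finset.sum_comm]
  refine Finset.sum_congr rfl fun i _ => Finset.sum_congr rfl fun j _ => ?_
  rw [hS.apply]
  ring

theorem form_map {R' : Type*} [CommRing R'] (f : R →+* R') (x y : ι → R) :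
    form S (fun i => f (x i)) (fun i => f (y i)) = f (form S x y) := by
  simp only [form_eq_sum, map_sum, map_mul, map_intCast]

theorem form_castVec (x y : ι → ℤ) : form S (castVec R x) (castVec R y) = (form S x y : ℤ) :=
  form_map (Int.castRingHom R) x y

variable [DecidableEq ι]

theorem act_smul (g : GL ι ℤ) (c : R) (x : ι → R) : act g (c • x) = c • act g x := by
  simp [act, Matrix.mulVec_smul]

theorem act_map {R' : Type*} [CommRing R'] (f : R →+* R') (g : GL ι ℤ) (x : ι → R) :
    act g (fun i => f (x i)) = fun i => f (act g x i) := by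
  funext i
  simp only [act, Matrix.mulVec, dotProduct, map_sum, map_mul, Matrix.map_apply, map_intCast]

theorem form_act {g : GL ι ℤ} (hg : g ∈ orthogonalGroup S) (x y : ι → R) :
    form S (act g x) (act g y) = form S x y := by
  have h : g.1.transpose * S * g.1 = S := hg
  have h2 : (g.1.map (Int.cast : ℤ → R)).transpose * S.map (Int.cast : ℤ → R)
      * g.1.map (Int.cast : ℤ → R) = S.map (Int.cast : ℤ → R) := by
    have := congrArg (fun M : Matrix ι ι ℤ => M.map (Int.castRingHom R)) h
    simpa only [Matrix.map_mul, Matrix.transpose_map] using! this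
  rw [form, act, act, Matrix.dotProduct_mulVec, ← Matrix.vecMul_transpose, Matrix.vecMul_vecMul,
    ← Matrix.dotProduct_mulVec, Matrix.mulVec_mulVec, h2, form]

omit [Fintype ι] [DecidableEq ι] in
theorem map_intCast_int (M : Matrix ι ι ℤ) : M.map (Int.cast : ℤ → ℤ) = M := by
  ext i j
  simp

theorem mem_orthogonalGroup_of_form {g : GL ι ℤ}
    (h : ∀ x y : ι → ℤ, form S (act g x) (act g y) = form S x y) : g ∈ orthogonalGroup S := by
  have h2 : ∀ x y : ι → ℤ, x ⬝ᵥ (g.1.transpose * S * g.1) *ᵥ y = x ⬝ᵥ S *ᵥ y := fun x y => by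
    have := h x y
    simp only [form, act, map_intCast_int] at this
    rw [← this, ← Matrix.mulVec_mulVec, ← Matrix.mulVec_mulVec, Matrix.dotProduct_mulVec x,
      Matrix.vecMul_transpose]
  change g.1.transpose * S * g.1 = S
  ext i j
  simpa using h2 (Pi.single i 1) (Pi.single j 1)

/-- The matrix of the Eichler transvection `x ↦ x + (e, x) a - (a, x) e - q (e, x) e`. -/
def eichlerMatrix (S : Matrix ι ι ℤ) (e a : ι → ℤ) (q : ℤ) : Matrix ι ι ℤ :=
  1 + Matrix.vecMulVec a (e ᵥ* S) - Matrix.vecMulVec e (a ᵥ* S)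
    - q • Matrix.vecMulVec e (e ᵥ* S)

theorem eichlerMatrix_mulVec (e a : ι → ℤ) (q : ℤ) (x : ι → R) :
    (eichlerMatrix S e a q).map (Int.cast : ℤ → R) *ᵥ x
      = x + form S (castVec R e) x • castVec R a - form S (castVec R a) x • castVec R e
        - ((q : R) * form S (castVec R e) x) • castVec R e := by
  have h : ∀ v w : ι → ℤ, (Matrix.vecMulVec v (w ᵥ* S)).map (Int.cast : ℤ → R) *ᵥ x
      = form S (castVec R w) x • castVec R v := fun v w => by
    have h1 : (Matrix.vecMulVec v (w ᵥ* S)).map (Int.cast : ℤ → R)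
        = Matrix.vecMulVec (castVec R v) (castVec R w ᵥ* S.map (Int.cast : ℤ → R)) := by
      ext i j
      simp [Matrix.vecMulVec_apply, Matrix.vecMul, dotProduct, castVec]
    rw [h1, Matrix.vecMulVec_mulVec, ← Matrix.dotProduct_mulVec, form]
    simp
  have h2 : (eichlerMatrix S e a q).map (Int.cast : ℤ → R)
      = 1 + (Matrix.vecMulVec a (e ᵥ* S)).map (Int.cast : ℤ → R)
        - (Matrix.vecMulVec e (a ᵥ* S)).map (Int.cast : ℤ → R)
        - (q : R) • (Matrix.vecMulVec e (e ᵥ* S)).map (Int.cast : ℤ → R) := by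
    ext i j
    simp [eichlerMatrix, Matrix.one_apply, apply_ite (Int.cast : ℤ → R), -zsmul_eq_mul]
  rw [h2, Matrix.sub_mulVec, Matrix.sub_mulVec, Matrix.add_mulVec, Matrix.smul_mulVec,
    Matrix.one_mulVec, h, h, h, smul_smul]

/-- The Eichler transvection over a commutative ring. -/
def eichlerMap (S : Matrix ι ι ℤ) (e a : ι → R) (q : R) (x : ι → R) : ι → R :=
  x + form S e x • a - form S a x • e - (q * form S e x) • e

omit [DecidableEq ι] in
theorem form_eichlerMap (hS : S.IsSymm) {e a : ι → R} {q : R} (he : form S e e = 0)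
    (hea : form S e a = 0) (ha : form S a a = 2 * q) (x y : ι → R) :
    form S (eichlerMap S e a q x) (eichlerMap S e a q y) = form S x y := by
  have hae : form S a e = 0 := by rw [form_comm hS, hea]
  simp only [eichlerMap, form_add_left, form_add_right, form_sub_left, form_sub_right,
    form_smul_left, form_smul_right, he, hea, hae, ha, form_comm hS x e, form_comm hS x a]
  ring

omit [DecidableEq ι] in
theorem eichlerMap_neg (hS : S.IsSymm) {e a : ι → R} {q : R} (he : form S e e = 0)
    (hea : form S e a = 0) (ha : form S a a = 2 * q) (x : ι → R) :
    eichlerMap S e a q (eichlerMap S e (-a) q x) = x := by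
  have hae : form S a e = 0 := by rw [form_comm hS, hea]
  have h1 : form S e (eichlerMap S e (-a) q x) = form S e x := by
    simp only [eichlerMap, form_add_right, form_sub_right, form_smul_right, form_neg_right,
      he, hea]
    ring
  have h2 : form S a (eichlerMap S e (-a) q x) = form S a x - 2 * q * form S e x := by
    simp only [eichlerMap, form_add_right, form_sub_right, form_smul_right, form_neg_right,
      ha, hae]
    ring
  rw [eichlerMap, h1, h2]
  funext i
  simp only [eichlerMap, form_neg_left, Pi.add_apply, Pi.sub_apply, Pi.smul_apply, Pi.neg_apply,
    smul_eq_mul]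
  ring

theorem eichlerMatrix_mul (hS : S.IsSymm) {e a : ι → ℤ} {q : ℤ} (he : form S e e = 0)
    (hea : form S e a = 0) (ha : form S a a = 2 * q) :
    eichlerMatrix S e a q * eichlerMatrix S e (-a) q = 1 := by
  refine Matrix.ext_iff_mulVec.mpr fun x => ?_
  have h : ∀ (b x : ι → ℤ), eichlerMatrix S e b q *ᵥ x = eichlerMap S e b q x := fun b x => by
    have := eichlerMatrix_mulVec (S := S) e b q x
    simpa [castVec] using! this
  rw [← Matrix.mulVec_mulVec, h, h, eichlerMap_neg hS he hea ha, Matrix.one_mulVec]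

/-- The Eichler transvection as an element of the general linear group. -/
def eichler (hS : S.IsSymm) {e a : ι → ℤ} {q : ℤ} (he : form S e e = 0)
    (hea : form S e a = 0) (ha : form S a a = 2 * q) : GL ι ℤ where
  val := eichlerMatrix S e a q
  inv := eichlerMatrix S e (-a) q
  val_inv := eichlerMatrix_mul hS he hea ha
  inv_val := by
    have := eichlerMatrix_mul (a := -a) (q := q) hS he (by rw [form_neg_right, hea, neg_zero])
      (by rw [form_neg_right, form_neg_left, neg_neg, ha])
    rwa [neg_neg] at this

theorem act_eichler (hS : S.IsSymm) {e a : ι → ℤ} {q : ℤ} (he : form S e e = 0)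
    (hea : form S e a = 0) (ha : form S a a = 2 * q) (x : ι → R) :
    act (eichler hS he hea ha) x = eichlerMap S (castVec R e) (castVec R a) q x :=
  eichlerMatrix_mulVec e a q x

/-- A dual vector pairs integrally with `e` and `a`, so the transvection moves it by an integral
combination of `a` and `e`. -/
theorem eichler_mem_discriminantKernel (hS : S.IsSymm) {e a : ι → ℤ} {q : ℤ} (he : form S e e = 0)
    (hea : form S e a = 0) (ha : form S a a = 2 * q) :
    eichler hS he hea ha ∈ discriminantKernel S := by
  refine ⟨mem_orthogonalGroup_of_form fun x y => ?_, fun l hl => ?_⟩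
  · rw [act_eichler, act_eichler]
    refine form_eichlerMap hS ?_ ?_ ?_ x y
    · simpa using! he
    · simpa using! hea
    · simpa using! ha
  · obtain ⟨n, hn⟩ := hl e
    obtain ⟨n', hn'⟩ := hl a
    refine ⟨n • a - n' • e - (q * n) • e, ?_⟩
    rw [act_eichler, eichlerMap, form_comm hS, hn, form_comm hS, hn']
    funext i
    simp [castVec]
    ring

end BilinearForms

end

end OrthogonalModular

namespace OrthogonalModular

noncomputable section

open Complex

/-! ### The positive cone, the tube domain and the affine cone. -/

section Cone

variable {r : ℕ} {R : Type*} [CommRing R]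

/-- Coordinates of `II₁,₁ ⊕ L(-1)`. -/
abbrev KIndex (r : ℕ) : Type := Fin 2 ⊕ Fin r

/-- The Gram matrix of `II₁,₁ ⊕ L(-1)`. -/
def gramK (S : Matrix (Fin r) (Fin r) ℤ) : Matrix (KIndex r) (KIndex r) ℤ :=
  Matrix.fromBlocks hyperbolicPlane 0 0 (-S)

variable (S : Matrix (Fin r) (Fin r) ℤ)

theorem form_gramK (x y : KIndex r → R) :
    form (gramK S) x y = x (Sum.inl 0) * y (Sum.inl 1) + x (Sum.inl 1) * y (Sum.inl 0)
      - form S (fun i => x (Sum.inr i)) (fun i => y (Sum.inr i)) := by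
  simp only [form, dotProduct, Matrix.mulVec, Matrix.map_apply, gramK, hyperbolicPlane,
    Fintype.sum_sum_type, Matrix.fromBlocks_apply₁₁,
    Matrix.fromBlocks_apply₁₂, Matrix.fromBlocks_apply₂₁, Matrix.fromBlocks_apply₂₂,
    Fin.sum_univ_two, Matrix.zero_apply, Matrix.neg_apply]
  simp
  ring

theorem form_gramM_eq (x y : MIndex r → R) :
    form (gramM S) x y = x (Sum.inl 0) * y (Sum.inl 1) + x (Sum.inl 1) * y (Sum.inl 0)
      + form (gramK S) (fun i => x (Sum.inr i)) (fun i => y (Sum.inr i)) := by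
  have h : ∀ w : MIndex r → R, w = Sum.elim ![w (Sum.inl 0), w (Sum.inl 1)]
      (Sum.elim ![w (Sum.inr (Sum.inl 0)), w (Sum.inr (Sum.inl 1))]
        fun i => w (Sum.inr (Sum.inr i))) := fun w => by
    funext i
    rcases i with i | i | i
    · fin_cases i <;> rfl
    · fin_cases i <;> rfl
    · rfl
  conv_lhs => rw [h x, h y]
  rw [form_gramM, form_gramK]
  ring

variable {S}

theorem IsEvenPosDef.isSymm (hS : IsEvenPosDef S) : S.IsSymm := by
  have h := hS.posDef.isHermitian
  ext i j
  have := congrFun (congrFun h i) j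
  simpa using this

theorem isSymm_hyperbolicPlane : hyperbolicPlane.IsSymm := by
  ext i j
  fin_cases i <;> fin_cases j <;> rfl

theorem gramK_isSymm (hS : IsEvenPosDef S) : (gramK S).IsSymm :=
  Matrix.IsSymm.fromBlocks isSymm_hyperbolicPlane (by simp) (by
    rw [Matrix.IsSymm, Matrix.transpose_neg, hS.isSymm])

theorem gramM_isSymm (hS : IsEvenPosDef S) : (gramM S).IsSymm :=
  Matrix.IsSymm.fromBlocks isSymm_hyperbolicPlane (by simp) (gramK_isSymm hS)

theorem IsEvenPosDef.form_nonneg (hS : IsEvenPosDef S) (y : Fin r → ℝ) : 0 ≤ form S y y := by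
  simpa [form] using hS.posDef.posSemidef.dotProduct_mulVec_nonneg y

theorem IsEvenPosDef.form_pos (hS : IsEvenPosDef S) {y : Fin r → ℝ} (hy : y ≠ 0) :
    0 < form S y y := by
  simpa [form] using hS.posDef.dotProduct_mulVec_pos hy

/-- The positive cone of `(II₁,₁ ⊕ L(-1)) ⊗ ℝ`. -/
def coneK (S : Matrix (Fin r) (Fin r) ℤ) : Set (KIndex r → ℝ) :=
  {Y | 0 < Y (Sum.inl 1) ∧ 0 < form (gramK S) Y Y}

/-- Reverse Cauchy–Schwarz inequality. With d, d' the second coordinates of Y, Y' and y, y' their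
parts in L, positivity of L on d'y - dy' gives 2dd'(Y, Y') ≥ d'²(Y, Y) + d²(Y', Y'). -/
theorem form_gramK_pos (hS : IsEvenPosDef S) {Y Y' : KIndex r → ℝ} (h1 : 0 < Y (Sum.inl 1))
    (h2 : 0 < form (gramK S) Y Y) (h1' : 0 < Y' (Sum.inl 1)) (h2' : 0 ≤ form (gramK S) Y' Y') :
    0 < form (gramK S) Y Y' := by
  have h := hS.form_nonneg (Y' (Sum.inl 1) • (fun i => Y (Sum.inr i))
    - Y (Sum.inl 1) • (fun i => Y' (Sum.inr i)))
  simp only [form_sub_left, form_sub_right, form_smul_left, form_smul_right] at h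
  rw [form_comm hS.isSymm (fun i => Y' (Sum.inr i)) (fun i => Y (Sum.inr i))] at h
  rw [form_gramK] at h2 h2' ⊢
  set d := Y (Sum.inl 1)
  set d' := Y' (Sum.inl 1)
  have h3 : 0 < 2 * d * d' * (Y (Sum.inl 0) * d' + d * Y' (Sum.inl 0)
      - form S (fun i => Y (Sum.inr i)) (fun i => Y' (Sum.inr i))) := by
    have e1 := mul_pos (mul_pos h1' h1') h2
    have e2 := mul_nonneg (mul_pos h1 h1).le h2'
    nlinarith
  exact (pos_iff_pos_of_mul_pos h3).mp (by positivity)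

/-- This separates the two halves of the cone of positive vectors: along a path of such vectors the
coordinate keeps its sign. -/
theorem inl_one_ne_zero (hS : IsEvenPosDef S) {Y : KIndex r → ℝ} (h : 0 < form (gramK S) Y Y) :
    Y (Sum.inl 1) ≠ 0 := fun h0 => by
  rw [form_gramK, h0] at h
  have := hS.form_nonneg fun i => Y (Sum.inr i)
  linarith

theorem coneK_inl_zero_pos (hS : IsEvenPosDef S) {Y : KIndex r → ℝ} (h : Y ∈ coneK S) :
    0 < Y (Sum.inl 0) := by
  obtain ⟨h1, h2⟩ := h
  rw [form_gramK] at h2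
  have := hS.form_nonneg fun i => Y (Sum.inr i)
  have h3 : 0 < Y (Sum.inl 0) * Y (Sum.inl 1) := by linarith
  exact (pos_iff_pos_of_mul_pos h3).mpr h1

theorem continuous_form {ι : Type*} [Fintype ι] (G : Matrix ι ι ℤ) {X : Type*} [TopologicalSpace X]
    {𝕜 : Type*} [NormedField 𝕜] {f g : X → ι → 𝕜} (hf : Continuous f) (hg : Continuous g) :
    Continuous fun x => form G (f x) (g x) := by
  simp only [form_eq_sum]
  fun_prop

theorem isOpen_coneK : IsOpen (coneK S) :=
  (isOpen_lt continuous_const (continuous_apply _)).inter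
    (isOpen_lt continuous_const (continuous_form _ continuous_id continuous_id))

theorem convex_coneK (hS : IsEvenPosDef S) : Convex ℝ (coneK S) := by
  rintro Y ⟨h1, h2⟩ Y' ⟨h1', h2'⟩ a b ha hb hab
  have h3 := form_gramK_pos hS h1 h2 h1' h2'.le
  have h4 : 0 < a ∨ 0 < b := by
    by_contra! h
    linarith [h.1, h.2]
  refine ⟨?_, ?_⟩
  · simp only [Pi.add_apply, Pi.smul_apply, smul_eq_mul]
    rcases h4 with h | h <;> positivity
  · simp only [form_add_left, form_add_right, form_smul_left, form_smul_right]
    rw [form_comm (gramK_isSymm hS) Y' Y]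
    rcases h4 with h | h <;> positivity

/-- The tube domain in coordinates `(ω, τ, z)`. -/
def tubeK (S : Matrix (Fin r) (Fin r) ℤ) : Set (KIndex r → ℂ) := tubeOver (coneK S)

theorem mem_tubeK {Z : KIndex r → ℂ} : Z ∈ tubeK S ↔ 0 < (Z (Sum.inl 1)).im ∧
    0 < form (gramK S) (fun j => (Z j).im) (fun j => (Z j).im) := Iff.rfl

theorem isOpen_tubeK : IsOpen (tubeK S) := isOpen_tubeOver isOpen_coneK

/-- The vector of the affine cone over a point of the tube domain. -/
def coneVec (S : Matrix (Fin r) (Fin r) ℤ) (Z : KIndex r → ℂ) : MIndex r → ℂ :=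
  Sum.elim ![-(form (gramK S) Z Z / 2), 1] Z

theorem re_form_conj_add {ι : Type*} [Fintype ι] (G : Matrix ι ι ℤ) (z : ι → ℂ) :
    (form G z (fun i => (starRingEnd ℂ) (z i))).re - (form G z z).re
      = 2 * form G (fun i => (z i).im) (fun i => (z i).im) := by
  simp only [form_eq_sum, Complex.re_sum, Finset.mul_sum, ← Finset.sum_sub_distrib]
  refine Finset.sum_congr rfl fun i _ => Finset.sum_congr rfl fun j _ => ?_
  simp
  ring

theorem form_coneVec (Z : KIndex r → ℂ) : form (gramM S) (coneVec S Z) (coneVec S Z) = 0 := by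
  rw [form_gramM_eq]
  simp [coneVec]
  ring

/-- For a null vector, the real part of its pairing with the conjugate is twice the norm of its
imaginary part. The first plane contributes nothing to that norm, as its second coordinate 1 is
real. -/
theorem coneVec_mem {Z : KIndex r → ℂ} : coneVec S Z ∈ affineCone S ↔ Z ∈ tubeK S := by
  have h : (form (gramM S) (coneVec S Z) (fun i => (starRingEnd ℂ) (coneVec S Z i))).re
      = 2 * form (gramK S) (fun j => (Z j).im) (fun j => (Z j).im) := by
    have := re_form_conj_add (gramM S) (coneVec S Z)
    rw [form_coneVec, Complex.zero_re, sub_zero] at this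
    rw [this, form_gramM_eq]
    simp [coneVec]
  rw [affineCone, Set.mem_ofPred_eq, h, form_coneVec, mem_tubeK]
  simp only [coneVec, Sum.elim_inl, Sum.elim_inr, Matrix.cons_val_one, Matrix.cons_val_fin_one,
    div_one, true_and]
  constructor
  · rintro ⟨h1, h2⟩
    exact ⟨h2, by linarith⟩
  · rintro ⟨h1, h2⟩
    exact ⟨by linarith, h1⟩

/-- The equation (Z, Z) = 0 is linear in the first coordinate, which is therefore determined by the
others. Group actions can so be computed without following that coordinate. -/
theorem eq_smul_coneVec {Z : MIndex r → ℂ} (hZ : form (gramM S) Z Z = 0) {t : ℂ} (ht : t ≠ 0)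
    (h1 : Z (Sum.inl 1) = t) {W : KIndex r → ℂ} (hW : ∀ i, Z (Sum.inr i) = t * W i) :
    Z = t • coneVec S W := by
  have h2 : (fun i => Z (Sum.inr i)) = t • W := funext hW
  rw [form_gramM_eq, h1, h2, form_smul_left, form_smul_right] at hZ
  funext i
  rcases i with i | i
  · fin_cases i
    · have h3 : t * (Z (Sum.inl 0) + t * (form (gramK S) W W / 2)) = 0 := by
        linear_combination hZ / 2
      have := (mul_eq_zero.mp h3).resolve_left ht
      simp only [coneVec, Pi.smul_apply, smul_eq_mul]
      simp
      linear_combination this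
    · simp [coneVec, h1]
  · simp [coneVec, hW i]

theorem smul_mem_affineCone {Z : MIndex r → ℂ} {t : ℂ} (ht : t ≠ 0) (hZ : Z ∈ affineCone S) :
    t • Z ∈ affineCone S := by
  obtain ⟨h1, h2, h3⟩ := hZ
  refine ⟨?_, ?_, ?_⟩
  · rw [form_smul_left, form_smul_right, h1]; simp
  · have : (fun i => (starRingEnd ℂ) ((t • Z) i)) = (starRingEnd ℂ) t • fun i => (starRingEnd ℂ) (Z i) := by
      funext i
      simp
    rw [this, form_smul_left, form_smul_right, ← mul_assoc, Complex.mul_conj,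
      Complex.re_ofReal_mul]
    have := Complex.normSq_pos.mpr ht
    positivity
  · simp only [Pi.smul_apply, smul_eq_mul]
    rwa [mul_div_mul_left _ _ ht]

theorem exists_eq_smul_coneVec {Z : MIndex r → ℂ} (hZ : Z ∈ affineCone S) :
    ∃ t : ℂ, t ≠ 0 ∧ ∃ W ∈ tubeK S, Z = t • coneVec S W := by
  -- With the convention x / 0 = 0, a vanishing denominator would make the imaginary part of the
  -- quotient zero rather than positive.
  have ht : Z (Sum.inl 1) ≠ 0 := fun h => by
    have := hZ.2.2
    rw [h, div_zero] at this
    simp at this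
  have h := eq_smul_coneVec hZ.1 ht rfl (W := (Z (Sum.inl 1))⁻¹ • fun i => Z (Sum.inr i))
    fun i => by simp [ht]
  refine ⟨_, ht, _, ?_, h⟩
  rw [← coneVec_mem]
  have := smul_mem_affineCone (inv_ne_zero ht) hZ
  rw [h, smul_smul] at this
  simpa [coneVec, ht] using this

/-- Every vector of the affine cone is a multiple of some `coneVec`, so it suffices to follow these
under `g` and its inverse. -/
theorem mem_orthogonalGroupPlus_of {g : GL (MIndex r) ℤ} (hg : g ∈ orthogonalGroup (gramM S))
    (h : ∀ Z ∈ tubeK S, ∃ t : ℂ, t ≠ 0 ∧ ∃ W ∈ tubeK S, act g (coneVec S Z) = t • coneVec S W)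
    (h' : ∀ Z ∈ tubeK S, ∃ t : ℂ, t ≠ 0 ∧ ∃ W ∈ tubeK S, act g⁻¹ (coneVec S Z) = t • coneVec S W) :
    g ∈ orthogonalGroupPlus S := by
  have key : ∀ g : GL (MIndex r) ℤ, (∀ Z ∈ tubeK S, ∃ t : ℂ, t ≠ 0 ∧ ∃ W ∈ tubeK S,
      act g (coneVec S Z) = t • coneVec S W) → ∀ Z ∈ affineCone S, act g Z ∈ affineCone S := by
    intro g h Z hZ
    obtain ⟨t, ht, W, hW, rfl⟩ := exists_eq_smul_coneVec hZ
    obtain ⟨t', ht', W', hW', h2⟩ := h W hW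
    rw [act_smul, h2, smul_smul]
    exact smul_mem_affineCone (mul_ne_zero ht ht') (coneVec_mem.mpr hW')
  refine ⟨hg, fun Z => ⟨fun hZ => ?_, key g h Z⟩⟩
  have := key _ h' _ hZ
  rwa [act_inv_act] at this

end Cone

end

end OrthogonalModular

namespace OrthogonalModular

noncomputable section

open Complex

/-! ### Unipotent elements of Γ and the exchange of τ and ω. -/

section GroupElements

variable {r : ℕ} {R : Type*} [CommRing R] {S : Matrix (Fin r) (Fin r) ℤ}

/-! ### Translations -/

/-- The isotropic vector whose pairing is the second coordinate of the first plane. -/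
def cuspVec (r : ℕ) : MIndex r → ℤ := Sum.elim ![1, 0] 0

/-- The embedding of `II₁,₁ ⊕ L(-1)` into `M`. -/
def inclK (x : KIndex r → ℤ) : MIndex r → ℤ := Sum.elim 0 x

theorem form_cuspVec (x : MIndex r → R) :
    form (gramM S) (castVec R (cuspVec r)) x = x (Sum.inl 1) := by
  rw [form_gramM_eq]
  have : (fun i : KIndex r => castVec R (cuspVec r) (Sum.inr i)) = 0 := by
    funext i; simp [castVec, cuspVec]
  rw [this, form_zero_left]
  simp [castVec, cuspVec]

theorem form_inclK (a : KIndex r → ℤ) (x : MIndex r → R) :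
    form (gramM S) (castVec R (inclK a)) x
      = form (gramK S) (castVec R a) (fun i => x (Sum.inr i)) := by
  rw [form_gramM_eq]
  have : (fun i : KIndex r => castVec R (inclK a) (Sum.inr i)) = castVec R a := by
    funext i; simp [castVec, inclK]
  rw [this]
  simp [castVec, inclK]

theorem castVec_int {ι : Type*} (x : ι → ℤ) : castVec ℤ x = x := by
  funext i; simp [castVec]

theorem form_inclK_inclK (a b : KIndex r → ℤ) :
    form (gramM S) (inclK a) (inclK b) = form (gramK S) a b := by
  have := form_inclK (S := S) a (inclK b)
  rw [castVec_int, castVec_int] at this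
  exact this

theorem form_cuspVec_int (x : MIndex r → ℤ) : form (gramM S) (cuspVec r) x = x (Sum.inl 1) := by
  have := form_cuspVec (S := S) x
  rwa [castVec_int] at this

theorem even_form_gramK (hS : IsEvenPosDef S) (a : KIndex r → ℤ) :
    ∃ q, form (gramK S) a a = 2 * q := by
  obtain ⟨n, hn⟩ := hS.even fun i => a (Sum.inr i)
  refine ⟨a (Sum.inl 0) * a (Sum.inl 1) - n, ?_⟩
  rw [form_gramK, hn]
  ring

/-- The transvection along `cuspVec`: this vector pairs to 1 with every `coneVec`, so the
transvection adds `a` to Z. Evenness of the lattice provides the integer q = (a, a) / 2. -/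
theorem exists_translation (hS : IsEvenPosDef S) (a : KIndex r → ℤ) :
    ∃ g ∈ discriminantKernel (gramM S) ⊓ orthogonalGroupPlus S,
      ∀ Z ∈ tubeK S, act g (coneVec S Z) = coneVec S (Z + castVec ℂ a) := by
  obtain ⟨q, hq⟩ := even_form_gramK hS a
  have hM := gramM_isSymm hS
  have h1 : form (gramM S) (cuspVec r) (cuspVec r) = 0 := by
    rw [form_cuspVec_int]; simp [cuspVec]
  have h2 : ∀ a : KIndex r → ℤ, form (gramM S) (cuspVec r) (inclK a) = 0 := fun a => by
    rw [form_cuspVec_int]; simp [inclK]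
  have h3 : ∀ a : KIndex r → ℤ, form (gramK S) a a = 2 * q →
      form (gramM S) (inclK a) (inclK a) = 2 * q := fun a ha => by
    rw [form_inclK_inclK, ha]
  have key : ∀ (a : KIndex r → ℤ) (ha : form (gramK S) a a = 2 * q) (Z : KIndex r → ℂ),
      act (eichler hM h1 (h2 a) (h3 a ha)) (coneVec S Z) = coneVec S (Z + castVec ℂ a) := by
    intro a ha Z
    have h4 : form (gramM S) (act (eichler hM h1 (h2 a) (h3 a ha)) (coneVec S Z))
        (act (eichler hM h1 (h2 a) (h3 a ha)) (coneVec S Z)) = 0 := by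
      rw [form_act (eichler_mem_discriminantKernel _ _ _ _).1, form_coneVec]
    have h5 := eq_smul_coneVec h4 one_ne_zero (W := Z + castVec ℂ a) ?_ ?_
    · rwa [one_smul] at h5
    · rw [act_eichler, eichlerMap, form_cuspVec]
      simp [coneVec, cuspVec, inclK, castVec]
    · intro i
      rw [act_eichler, eichlerMap, form_cuspVec]
      simp [coneVec, cuspVec, inclK, castVec]
  have hmem : ∀ (a : KIndex r → ℤ), ∀ Z ∈ tubeK S, Z + castVec ℂ a ∈ tubeK S := fun a Z hZ => by
    simpa [tubeK, tubeOver, castVec] using hZ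
  have ha' : form (gramK S) (-a) (-a) = 2 * q := by
    rw [form_neg_left, form_neg_right, neg_neg, hq]
  refine ⟨eichler hM h1 (h2 a) (h3 a hq), ⟨eichler_mem_discriminantKernel _ _ _ _,
    mem_orthogonalGroupPlus_of (eichler_mem_discriminantKernel _ _ _ _).1
      (fun Z hZ => ⟨1, one_ne_zero, _, hmem a Z hZ, ?_⟩)
      fun Z hZ => ⟨1, one_ne_zero, _, hmem (-a) Z hZ, ?_⟩⟩, fun Z _ => key a hq Z⟩
  · rw [one_smul, key a hq Z]
  · have hinv : (eichler hM h1 (h2 a) (h3 a hq))⁻¹ = eichler hM h1 (h2 (-a)) (h3 (-a) ha') := by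
      refine Units.ext ?_
      change eichlerMatrix _ _ (-(inclK a)) _ = eichlerMatrix _ _ (inclK (-a)) _
      congr 1
      funext i
      rcases i with i | i <;> simp [inclK]
    rw [one_smul, hinv, key (-a) ha' Z]

/-! ### Transvections of `II₁,₁ ⊕ L(-1)` -/

theorem im_form_castVec {ι : Type*} [Fintype ι] (G : Matrix ι ι ℤ) (a : ι → ℤ) (Z : ι → ℂ) :
    (form G (castVec ℂ a) Z).im = form G (castVec ℝ a) fun i => (Z i).im := by
  simp only [form_eq_sum, Complex.im_sum]
  refine Finset.sum_congr rfl fun i _ => Finset.sum_congr rfl fun j _ => ?_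
  simp [castVec]

theorem im_eichlerMap {ι : Type*} [Fintype ι] [DecidableEq ι] (G : Matrix ι ι ℤ) (e a : ι → ℤ)
    (q : ℤ) (Z : ι → ℂ) :
    (fun i => (eichlerMap G (castVec ℂ e) (castVec ℂ a) q Z i).im)
      = eichlerMap G (castVec ℝ e) (castVec ℝ a) q fun i => (Z i).im := by
  funext i
  simp only [eichlerMap, Pi.add_apply, Pi.sub_apply, Pi.smul_apply, smul_eq_mul, Complex.add_im,
    Complex.sub_im, ← im_form_castVec]
  simp [castVec]

theorem form_castVec_eq {ι : Type*} [Fintype ι] {G : Matrix ι ι ℤ} {a b : ι → ℤ} {n : ℤ}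
    (h : form G a b = n) : form G (castVec R a) (castVec R b) = n := by
  rw [form_castVec, h]

/-- Replace `a` by s·a with s running from 0 to 1. The norm is preserved and stays positive, so the
second coordinate never vanishes and keeps the sign it has for the identity at s = 0. -/
theorem eichlerMap_mem_coneK (hS : IsEvenPosDef S) {e a : KIndex r → ℝ} {q : ℝ}
    (he : form (gramK S) e e = 0) (hea : form (gramK S) e a = 0)
    (ha : form (gramK S) a a = 2 * q) {Y : KIndex r → ℝ} (hY : Y ∈ coneK S) :
    eichlerMap (gramK S) e a q Y ∈ coneK S := by
  have hform : ∀ s : ℝ, 0 < form (gramK S) (eichlerMap (gramK S) e (s • a) (s ^ 2 * q) Y)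
      (eichlerMap (gramK S) e (s • a) (s ^ 2 * q) Y) := fun s => by
    rw [form_eichlerMap (gramK_isSymm hS) he (by rw [form_smul_right, hea, mul_zero])
      (by rw [form_smul_left, form_smul_right, ha]; ring)]
    exact hY.2
  set p : ℝ → ℝ := fun s => eichlerMap (gramK S) e (s • a) (s ^ 2 * q) Y (Sum.inl 1)
  have hp : Continuous p := by
    simp only [p, eichlerMap, form_smul_left, Pi.add_apply, Pi.sub_apply, Pi.smul_apply,
      smul_eq_mul]
    fun_prop
  have h0 : 0 < p 0 := by
    have : p 0 = Y (Sum.inl 1) := by simp [p, eichlerMap, form_zero_left]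
    rw [this]
    exact hY.1
  have h1 : 0 < p 1 := by
    by_contra! h
    obtain ⟨s, -, hs⟩ := intermediate_value_Icc' zero_le_one hp.continuousOn ⟨h, h0.le⟩
    exact inl_one_ne_zero hS (hform s) hs
  have h2 := hform 1
  simp only [p, one_smul, one_pow, one_mul] at h1 h2
  exact ⟨h1, h2⟩

theorem eichlerMap_mem_tubeK (hS : IsEvenPosDef S) {e a : KIndex r → ℤ} {q : ℤ}
    (he : form (gramK S) e e = 0) (hea : form (gramK S) e a = 0)
    (ha : form (gramK S) a a = 2 * q) {Z : KIndex r → ℂ} (hZ : Z ∈ tubeK S) :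
    eichlerMap (gramK S) (castVec ℂ e) (castVec ℂ a) q Z ∈ tubeK S := by
  change (fun i => (eichlerMap (gramK S) (castVec ℂ e) (castVec ℂ a) q Z i).im) ∈ coneK S
  rw [im_eichlerMap]
  refine eichlerMap_mem_coneK hS ?_ ?_ ?_ hZ
  · simpa using form_castVec_eq (R := ℝ) he
  · simpa using form_castVec_eq (R := ℝ) hea
  · simpa using form_castVec_eq (R := ℝ) ha

/-- Transvections inside II₁,₁ ⊕ L(-1) act linearly on the tube domain with automorphy factor 1.
They serve twice: for the elliptic law, with `e` on the ω-axis, and for Koecher's principle, with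
many isotropic `e`. -/
theorem exists_transvection (hS : IsEvenPosDef S) {e a : KIndex r → ℤ} {q : ℤ}
    (he : form (gramK S) e e = 0) (hea : form (gramK S) e a = 0)
    (ha : form (gramK S) a a = 2 * q) :
    ∃ g ∈ discriminantKernel (gramM S) ⊓ orthogonalGroupPlus S,
      ∀ Z ∈ tubeK S, act g (coneVec S Z)
        = coneVec S (eichlerMap (gramK S) (castVec ℂ e) (castVec ℂ a) q Z) := by
  have hM := gramM_isSymm hS
  have h1 : form (gramM S) (inclK e) (inclK e) = 0 := by rw [form_inclK_inclK, he]
  have h2 : ∀ a : KIndex r → ℤ, form (gramK S) e a = 0 →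
    form (gramM S) (inclK e) (inclK a) = 0 := fun a ha => by rw [form_inclK_inclK, ha]
  have h3 : ∀ a : KIndex r → ℤ, form (gramK S) a a = 2 * q →
      form (gramM S) (inclK a) (inclK a) = 2 * q := fun a ha => by
    rw [form_inclK_inclK, ha]
  have key : ∀ (a : KIndex r → ℤ) (hea : form (gramK S) e a = 0) (ha : form (gramK S) a a = 2 * q)
      (Z : KIndex r → ℂ), act (eichler hM h1 (h2 a hea) (h3 a ha)) (coneVec S Z)
        = coneVec S (eichlerMap (gramK S) (castVec ℂ e) (castVec ℂ a) q Z) := by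
    intro a hea ha Z
    have h4 : form (gramM S) (act (eichler hM h1 (h2 a hea) (h3 a ha)) (coneVec S Z))
        (act (eichler hM h1 (h2 a hea) (h3 a ha)) (coneVec S Z)) = 0 := by
      rw [form_act (eichler_mem_discriminantKernel _ _ _ _).1, form_coneVec]
    have h5 := eq_smul_coneVec h4 one_ne_zero
      (W := eichlerMap (gramK S) (castVec ℂ e) (castVec ℂ a) q Z) ?_ ?_
    · rwa [one_smul] at h5
    · rw [act_eichler, eichlerMap]
      simp [coneVec, inclK, castVec]
    · intro i
      rw [act_eichler, eichlerMap, form_inclK, form_inclK]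
      simp [coneVec, inclK, castVec, eichlerMap]
  have hea' : form (gramK S) e (-a) = 0 := by rw [form_neg_right, hea, neg_zero]
  have ha' : form (gramK S) (-a) (-a) = 2 * q := by
    rw [form_neg_left, form_neg_right, neg_neg, ha]
  refine ⟨eichler hM h1 (h2 a hea) (h3 a ha), ⟨eichler_mem_discriminantKernel _ _ _ _,
    mem_orthogonalGroupPlus_of (eichler_mem_discriminantKernel _ _ _ _).1
      (fun Z hZ => ⟨1, one_ne_zero, _, eichlerMap_mem_tubeK hS he hea ha hZ, ?_⟩)
      fun Z hZ => ⟨1, one_ne_zero, _, eichlerMap_mem_tubeK hS he hea' ha' hZ, ?_⟩⟩,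
    fun Z _ => key a hea ha Z⟩
  · rw [one_smul, key a hea ha Z]
  · have hinv : (eichler hM h1 (h2 a hea) (h3 a ha))⁻¹
        = eichler hM h1 (h2 (-a) hea') (h3 (-a) ha') := by
      refine Units.ext ?_
      change eichlerMatrix _ _ (-(inclK a)) _ = eichlerMatrix _ _ (inclK (-a)) _
      congr 1
      funext i
      rcases i with i | i <;> simp [inclK]
    rw [one_smul, hinv, key (-a) hea' ha' Z]

/-! ### Elements acting on the hyperbolic planes -/

/-- The hyperbolic planes are unimodular: pairing with their basis vectors reads off the plane
coordinates of a dual vector. -/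
theorem dualLattice_gramM {l : MIndex r → ℚ} (hl : l ∈ dualLattice (gramM S)) :
    (∀ i, ∃ n : ℤ, l (Sum.inl i) = n) ∧ ∀ i, ∃ n : ℤ, l (Sum.inr (Sum.inl i)) = n := by
  have h0 : ∀ v : Fin r → ℚ, v ⬝ᵥ (S.map (Int.cast : ℤ → ℚ) *ᵥ fun _ => (0 : ℚ)) = 0 := fun v =>
    form_zero_right S v
  refine ⟨fun i => ?_, fun i => ?_⟩
  · fin_cases i
    · obtain ⟨n, hn⟩ := hl (Sum.elim ![0, 1] 0)
      refine ⟨n, ?_⟩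
      rw [← hn, form_gramM_eq, form_gramK]
      simp [castVec, form, h0]
    · obtain ⟨n, hn⟩ := hl (Sum.elim ![1, 0] 0)
      refine ⟨n, ?_⟩
      rw [← hn, form_gramM_eq, form_gramK]
      simp [castVec, form, h0]
  · fin_cases i
    · obtain ⟨n, hn⟩ := hl (Sum.elim 0 (Sum.elim ![0, 1] 0))
      refine ⟨n, ?_⟩
      rw [← hn, form_gramM_eq, form_gramK]
      simp [castVec, form, h0]
    · obtain ⟨n, hn⟩ := hl (Sum.elim 0 (Sum.elim ![1, 0] 0))
      refine ⟨n, ?_⟩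
      rw [← hn, form_gramM_eq, form_gramK]
      simp [castVec, form, h0]

/-- The matrix exchanging the coordinates of the second hyperbolic plane. -/
def swapMatrix (r : ℕ) : Matrix (MIndex r) (MIndex r) ℤ :=
  Matrix.fromBlocks 1 0 0 (Matrix.fromBlocks !![0, 1; 1, 0] 0 0 1)

theorem swapMatrix_mul : swapMatrix r * swapMatrix r = 1 := by
  simp [swapMatrix, Matrix.fromBlocks_multiply, ← Matrix.one_fin_two]

/-- The exchange of the coordinates of the second hyperbolic plane. -/
def swapGL (r : ℕ) : GL (MIndex r) ℤ := ⟨swapMatrix r, swapMatrix r, swapMatrix_mul, swapMatrix_mul⟩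

/-- The exchange of the first two coordinates of a vector. -/
def swapK {R : Type*} (x : KIndex r → R) : KIndex r → R :=
  Sum.elim ![x (Sum.inl 1), x (Sum.inl 0)] fun i => x (Sum.inr i)

theorem act_swapGL (x : MIndex r → R) :
    act (swapGL r) x = Sum.elim (fun i => x (Sum.inl i)) (swapK fun i => x (Sum.inr i)) := by
  funext i
  simp only [act, swapGL, swapMatrix, Matrix.mulVec, dotProduct, Matrix.map_apply,
    Fintype.sum_sum_type, Fin.sum_univ_two]
  rcases i with i | i | i
  · fin_cases i <;> simp
  · fin_cases i <;> simp [swapK]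
  · simp [swapK, Matrix.one_apply, apply_ite (Int.cast : ℤ → R)]

theorem form_swapK (x y : KIndex r → R) :
    form (gramK S) (swapK x) (swapK y) = form (gramK S) x y := by
  rw [form_gramK, form_gramK]
  simp [swapK]
  ring

theorem swapGL_mem_orthogonalGroup : swapGL r ∈ orthogonalGroup (gramM S) := by
  refine mem_orthogonalGroup_of_form fun x y => ?_
  rw [act_swapGL, act_swapGL, form_gramM_eq, form_gramM_eq]
  simp only [Sum.elim_inl, Sum.elim_inr]
  rw [form_swapK]

theorem swapK_mem_tubeK (hS : IsEvenPosDef S) {Z : KIndex r → ℂ} (hZ : Z ∈ tubeK S) :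
    swapK Z ∈ tubeK S := by
  have h := coneK_inl_zero_pos (Y := fun j => (Z j).im) hS hZ
  have h2 : (fun j => (swapK Z j).im) = swapK fun j => (Z j).im := by
    funext j
    rcases j with j | j
    · fin_cases j <;> simp [swapK]
    · simp [swapK]
  rw [mem_tubeK, h2, form_swapK]
  exact ⟨by simpa [swapK] using h, hZ.2⟩

theorem act_swapGL_coneVec (Z : KIndex r → ℂ) :
    act (swapGL r) (coneVec S Z) = coneVec S (swapK Z) := by
  rw [act_swapGL]
  funext i
  rcases i with i | i
  · simp [coneVec, form_swapK]
  · simp [coneVec]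

/-- This element is the source of the symmetry f_m(n, ℓ) = f_n(m, ℓ). -/
theorem swapGL_mem (hS : IsEvenPosDef S) :
    swapGL r ∈ discriminantKernel (gramM S) ⊓ orthogonalGroupPlus S := by
  refine ⟨⟨swapGL_mem_orthogonalGroup, fun l hl => ?_⟩, ?_⟩
  · obtain ⟨-, h2⟩ := dualLattice_gramM hl
    obtain ⟨n, hn⟩ := h2 0
    obtain ⟨n', hn'⟩ := h2 1
    refine ⟨Sum.elim 0 (Sum.elim ![n' - n, n - n'] 0), ?_⟩
    rw [act_swapGL]
    funext i
    rcases i with i | i | i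
    · simp [castVec]
    · fin_cases i <;> simp [castVec, swapK, hn, hn']
    · simp [castVec, swapK]
  · have h : ∀ Z ∈ tubeK S, ∃ t : ℂ, t ≠ 0 ∧ ∃ W ∈ tubeK S,
        act (swapGL r) (coneVec S Z) = t • coneVec S W := fun Z hZ =>
      ⟨1, one_ne_zero, _, swapK_mem_tubeK hS hZ, by rw [one_smul, act_swapGL_coneVec]⟩
    have hinv : (swapGL r)⁻¹ = swapGL r := Units.ext rfl
    exact mem_orthogonalGroupPlus_of swapGL_mem_orthogonalGroup h (by rwa [hinv])

end GroupElements

end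

end OrthogonalModular

namespace OrthogonalModular

noncomputable section

open Complex

/-! ### The embedded SL(2, ℤ) and the action of W. -/

section GroupElements

variable {r : ℕ} {R : Type*} [CommRing R] {S : Matrix (Fin r) (Fin r) ℤ}

/-- The action of `SL(2)` on `M`. -/
def slMap (a b c d : R) (x : MIndex r → R) : MIndex r → R :=
  Sum.elim ![a * x (Sum.inl 0) - b * x (Sum.inr (Sum.inl 0)),
      c * x (Sum.inr (Sum.inl 1)) + d * x (Sum.inl 1)]
    (Sum.elim ![d * x (Sum.inr (Sum.inl 0)) - c * x (Sum.inl 0),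
      a * x (Sum.inr (Sum.inl 1)) + b * x (Sum.inl 1)] fun i => x (Sum.inr (Sum.inr i)))

/-- The matrix of the action of `SL(2)` on `M`. -/
def slMatrix (r : ℕ) (a b c d : ℤ) : Matrix (MIndex r) (MIndex r) ℤ :=
  Matrix.fromBlocks !![a, 0; 0, d] (Matrix.fromCols !![-b, 0; 0, c] 0)
    (Matrix.fromRows !![-c, 0; 0, b] 0) (Matrix.fromBlocks !![d, 0; 0, a] 0 0 1)

theorem slMatrix_mulVec (a b c d : ℤ) (x : MIndex r → R) :
    (slMatrix r a b c d).map (Int.cast : ℤ → R) *ᵥ x = slMap (a : R) b c d x := by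
  funext i
  simp only [slMatrix, Matrix.mulVec, dotProduct, Matrix.map_apply,
    Fintype.sum_sum_type, Fin.sum_univ_two]
  rcases i with i | i | i
  · fin_cases i
    · simp [slMap]; ring
    · simp [slMap]; ring
  · fin_cases i
    · simp [slMap]; ring
    · simp [slMap]; ring
  · simp [slMap, Matrix.one_apply, apply_ite (Int.cast : ℤ → R)]

theorem slMap_slMap {a b c d : R} (h : a * d - b * c = 1) (x : MIndex r → R) :
    slMap a b c d (slMap d (-b) (-c) a x) = x := by
  funext i
  rcases i with i | i | i
  · fin_cases i
    · simp [slMap]; linear_combination h * x (Sum.inl 0)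
    · simp [slMap]; linear_combination h * x (Sum.inl 1)
  · fin_cases i
    · simp [slMap]; linear_combination h * x (Sum.inr (Sum.inl 0))
    · simp [slMap]; linear_combination h * x (Sum.inr (Sum.inl 1))
  · simp [slMap]

theorem slMatrix_mul {a b c d : ℤ} (h : a * d - b * c = 1) :
    slMatrix r a b c d * slMatrix r d (-b) (-c) a = 1 := by
  refine Matrix.ext_iff_mulVec.mpr fun x => ?_
  have e : ∀ (a b c d : ℤ) (x : MIndex r → ℤ), slMatrix r a b c d *ᵥ x = slMap a b c d x :=
    fun a b c d x => by simpa using! slMatrix_mulVec a b c d x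
  rw [← Matrix.mulVec_mulVec, e, e, slMap_slMap h, Matrix.one_mulVec]

/-- The action of `SL(2, ℤ)` on `M`. -/
def slGL (r : ℕ) {a b c d : ℤ} (h : a * d - b * c = 1) : GL (MIndex r) ℤ where
  val := slMatrix r a b c d
  inv := slMatrix r d (-b) (-c) a
  val_inv := slMatrix_mul h
  inv_val := by
    have := slMatrix_mul (r := r) (a := d) (b := -b) (c := -c) (d := a) (by linarith)
    rwa [neg_neg, neg_neg] at this

theorem act_slGL {a b c d : ℤ} (h : a * d - b * c = 1) (x : MIndex r → R) :
    act (slGL r h) x = slMap (a : R) b c d x :=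
  slMatrix_mulVec a b c d x

theorem slGL_mem_discriminantKernel {a b c d : ℤ} (h : a * d - b * c = 1) :
    slGL r h ∈ discriminantKernel (gramM S) := by
  refine ⟨mem_orthogonalGroup_of_form fun x y => ?_, fun l hl => ?_⟩
  · rw [act_slGL, act_slGL, form_gramM_eq, form_gramM_eq, form_gramK, form_gramK]
    simp [slMap]
    linear_combination (x (Sum.inl 0) * y (Sum.inl 1) + x (Sum.inl 1) * y (Sum.inl 0)
      + x (Sum.inr (Sum.inl 0)) * y (Sum.inr (Sum.inl 1))
      + x (Sum.inr (Sum.inl 1)) * y (Sum.inr (Sum.inl 0))) * h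
  · obtain ⟨h1, h2⟩ := dualLattice_gramM hl
    obtain ⟨nA, hA⟩ := h1 0
    obtain ⟨nB, hB⟩ := h1 1
    obtain ⟨nC, hC⟩ := h2 0
    obtain ⟨nD, hD⟩ := h2 1
    refine ⟨Sum.elim ![a * nA - b * nC - nA, c * nD + d * nB - nB]
      (Sum.elim ![d * nC - c * nA - nC, a * nD + b * nB - nD] 0), ?_⟩
    rw [act_slGL]
    funext i
    rcases i with i | i | i
    · fin_cases i <;> simp [castVec, slMap, hA, hB, hC, hD]
    · fin_cases i <;> simp [castVec, slMap, hA, hB, hC, hD]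
    · simp [castVec, slMap]

/-- The point with coordinates `(ω, τ, z)`. -/
def kPoint {R : Type*} (τ : R) (z : Fin r → R) (ω : R) : KIndex r → R := Sum.elim ![ω, τ] z

theorem kPoint_eta {R : Type*} (Z : KIndex r → R) :
    kPoint (Z (Sum.inl 1)) (fun i => Z (Sum.inr i)) (Z (Sum.inl 0)) = Z := by
  funext i
  rcases i with i | i
  · fin_cases i <;> rfl
  · rfl

theorem form_kPoint (τ τ' : R) (z z' : Fin r → R) (ω ω' : R) :
    form (gramK S) (kPoint τ z ω) (kPoint τ' z' ω') = ω * τ' + τ * ω' - form S z z' := by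
  rw [form_gramK]
  simp [kPoint]

theorem kPoint_im (τ : ℂ) (z : Fin r → ℂ) (ω : ℂ) :
    (fun i => (kPoint τ z ω i).im) = kPoint τ.im (fun i => (z i).im) ω.im := by
  funext i
  rcases i with i | i
  · fin_cases i <;> rfl
  · rfl

theorem kPoint_mem_tubeK {τ : ℂ} {z : Fin r → ℂ} {ω : ℂ} : kPoint τ z ω ∈ tubeK S ↔
    0 < τ.im ∧ form S (fun i => (z i).im) (fun i => (z i).im) < 2 * τ.im * ω.im := by
  rw [mem_tubeK, kPoint_im, form_kPoint]
  refine and_congr Iff.rfl ⟨fun h => by linarith, fun h => by linarith⟩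

theorem conj_act {ι : Type*} [Fintype ι] [DecidableEq ι] (g : GL ι ℤ) (Z : ι → ℂ) :
    (fun i => (starRingEnd ℂ) (act g Z i)) = act g fun i => (starRingEnd ℂ) (Z i) :=
  (act_map (starRingEnd ℂ) g Z).symm

theorem act_mem_affineCone {g : GL (MIndex r) ℤ} (hg : g ∈ orthogonalGroup (gramM S))
    {Z : MIndex r → ℂ} (hZ : Z ∈ affineCone S)
    (h : 0 < (act g Z (Sum.inr (Sum.inl 1)) / act g Z (Sum.inl 1)).im) :
    act g Z ∈ affineCone S := by
  refine ⟨?_, ?_, h⟩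
  · rw [form_act hg, hZ.1]
  · rw [conj_act, form_act hg]
    exact hZ.2.1

/-- The action of `SL(2, ℤ)` on the tube domain. -/
def slPoint (S : Matrix (Fin r) (Fin r) ℤ) (a b c d : ℂ) (τ : ℂ) (z : Fin r → ℂ) (ω : ℂ) :
    KIndex r → ℂ :=
  kPoint ((a * τ + b) / (c * τ + d)) ((c * τ + d)⁻¹ • z)
    (ω - c * form S z z / (2 * (c * τ + d)))

theorem smul_im_pos {a b c d : ℤ} (h : a * d - b * c = 1) {τ : ℂ} (hτ : 0 < τ.im) :
    0 < ((a * τ + b) / (c * τ + d)).im := by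
  set γ : SL(2, ℤ) := ⟨!![a, b; c, d], by rw [Matrix.det_fin_two_of, h]⟩
  have h1 := UpperHalfPlane.specialLinearGroup_apply γ ⟨τ, hτ⟩
  have h2 := (γ • (⟨τ, hτ⟩ : ℍ)).im_pos
  rw [h1] at h2
  simpa [UpperHalfPlane.im, γ] using h2

theorem denom_ne_zero' {a b c d : ℤ} (h : a * d - b * c = 1) {τ : ℂ} (hτ : 0 < τ.im) :
    (c * τ + d : ℂ) ≠ 0 := fun h0 => by
  have := smul_im_pos h hτ
  rw [h0, div_zero, Complex.zero_im] at this
  exact lt_irrefl _ this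

/-- The second coordinate of the image is cτ + d, and by `eq_smul_coneVec` it is the automorphy
factor. -/
theorem act_slGL_coneVec {a b c d : ℤ} (h : a * d - b * c = 1) {τ : ℂ} (hτ : 0 < τ.im)
    (z : Fin r → ℂ) (ω : ℂ) : act (slGL r h) (coneVec S (kPoint τ z ω))
      = (c * τ + d : ℂ) • coneVec S (slPoint S a b c d τ z ω) := by
  have hJ := denom_ne_zero' h hτ
  refine eq_smul_coneVec ?_ hJ ?_ fun i => ?_
  · rw [form_act (slGL_mem_discriminantKernel h).1, form_coneVec]
  · rw [act_slGL]
    simp [slMap, coneVec, kPoint]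
  · rw [act_slGL]
    rcases i with i | i
    · fin_cases i
      · simp [slMap, coneVec, kPoint, slPoint]
        rw [form_gramK]
        simp
        field_simp
        ring
      · simp [slMap, coneVec, kPoint, slPoint]
        rw [mul_div_assoc', mul_div_cancel_left₀ _ hJ]
    · simp [slMap, coneVec, kPoint, slPoint]
      field_simp

theorem slPoint_mem_tubeK {a b c d : ℤ} (h : a * d - b * c = 1) {τ : ℂ} {z : Fin r → ℂ} {ω : ℂ}
    (hZ : kPoint τ z ω ∈ tubeK S) : slPoint S a b c d τ z ω ∈ tubeK S := by
  have hτ := (kPoint_mem_tubeK.mp hZ).1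
  have hJ := denom_ne_zero' h hτ
  have h1 := act_slGL_coneVec (S := S) h hτ z ω
  have h2 : act (slGL r h) (coneVec S (kPoint τ z ω)) ∈ affineCone S := by
    refine act_mem_affineCone (slGL_mem_discriminantKernel h).1 (coneVec_mem.mpr hZ) ?_
    rw [h1]
    simp only [Pi.smul_apply, smul_eq_mul]
    rw [mul_div_mul_left _ _ hJ]
    simpa [coneVec, slPoint, kPoint] using smul_im_pos h hτ
  have h3 := smul_mem_affineCone (inv_ne_zero hJ) h2
  rw [h1, smul_smul, inv_mul_cancel₀ hJ, one_smul] at h3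
  exact coneVec_mem.mp h3

theorem slGL_mem {a b c d : ℤ} (h : a * d - b * c = 1) :
    slGL r h ∈ discriminantKernel (gramM S) ⊓ orthogonalGroupPlus S := by
  have key : ∀ {a b c d : ℤ} (h : a * d - b * c = 1), ∀ Z ∈ tubeK S, ∃ t : ℂ, t ≠ 0 ∧
      ∃ W ∈ tubeK S, act (slGL r h) (coneVec S Z) = t • coneVec S W := by
    intro a b c d h Z hZ
    rw [← kPoint_eta Z] at hZ ⊢
    exact ⟨_, denom_ne_zero' h hZ.1, _, slPoint_mem_tubeK h hZ, act_slGL_coneVec h hZ.1 _ _⟩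
  refine ⟨slGL_mem_discriminantKernel h,
    mem_orthogonalGroupPlus_of (slGL_mem_discriminantKernel h).1 (key h) ?_⟩
  have h' : d * a - (-b) * (-c) = 1 := by linarith
  have hinv : (slGL r h)⁻¹ = slGL r h' := Units.ext rfl
  rw [hinv]
  exact key h'

theorem act_embedL (σ : GL (Fin r) ℤ) (x : MIndex r → R) :
    act (embedL σ) x = Sum.elim (fun i => x (Sum.inl i)) (Sum.elim
      (fun i => x (Sum.inr (Sum.inl i))) (act σ fun i => x (Sum.inr (Sum.inr i)))) := by
  funext i
  simp only [act, embedL, Units.coe_map, MonoidHom.coe_mk, OneHom.coe_mk, Matrix.mulVec,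
    dotProduct, Matrix.map_apply, Fintype.sum_sum_type, Fin.sum_univ_two]
  rcases i with i | i | i
  · fin_cases i <;> simp
  · fin_cases i <;> simp
  · simp [Matrix.mulVec, dotProduct]

theorem act_embedL_coneVec {σ : GL (Fin r) ℤ} (hσ : σ ∈ orthogonalGroup S) (τ : ℂ)
    (z : Fin r → ℂ) (ω : ℂ) : act (embedL σ) (coneVec S (kPoint τ z ω))
      = coneVec S (kPoint τ (act σ z) ω) := by
  rw [act_embedL]
  have : form (gramK S) (kPoint τ (act σ z) ω) (kPoint τ (act σ z) ω)
      = form (gramK S) (kPoint τ z ω) (kPoint τ z ω) := by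
    rw [form_kPoint, form_kPoint, form_act hσ]
  funext i
  rcases i with i | i | i
  · simp [coneVec, this]
  · simp [coneVec, kPoint]
  · simp [coneVec, kPoint]

theorem kPoint_act_mem_tubeK {σ : GL (Fin r) ℤ} (hσ : σ ∈ orthogonalGroup S) {τ : ℂ}
    {z : Fin r → ℂ} {ω : ℂ} (hZ : kPoint τ z ω ∈ tubeK S) :
    kPoint τ (act σ z) ω ∈ tubeK S := by
  have h : (fun i => (act σ z i).im) = act σ fun i => (z i).im := by
    funext i
    simp [act, Matrix.mulVec, dotProduct, Complex.im_sum]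
  rw [kPoint_mem_tubeK] at hZ ⊢
  rwa [h, form_act hσ]

end GroupElements

/-! ### Modular forms as functions on the tube domain. -/

section TubeFunctions

variable {r : ℕ} {S : Matrix (Fin r) (Fin r) ℤ}

open Classical in
/-- A function on the affine cone, restricted to the tube domain in coordinates. -/
def tubeFun (S : Matrix (Fin r) (Fin r) ℤ) (F : affineCone S → ℂ) (Z : KIndex r → ℂ) : ℂ :=
  if h : coneVec S Z ∈ affineCone S then F ⟨coneVec S Z, h⟩ else 0

theorem tubeFun_of_mem (F : affineCone S → ℂ) {Z : KIndex r → ℂ} (hZ : Z ∈ tubeK S) :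
    tubeFun S F Z = F ⟨coneVec S Z, coneVec_mem.mpr hZ⟩ :=
  dif_pos _

theorem tubeVector_eq (Z : ℍ × (Fin r → ℂ) × ℍ) :
    tubeVector S Z = coneVec S (kPoint (Z.1 : ℂ) Z.2.1 (Z.2.2 : ℂ)) := by
  rw [tubeVector, coneVec, form_kPoint]
  congr 2
  ring_nf

theorem mem_tubeDomain_iff (Z : ℍ × (Fin r → ℂ) × ℍ) :
    Z ∈ tubeDomain S ↔ kPoint (Z.1 : ℂ) Z.2.1 (Z.2.2 : ℂ) ∈ tubeK S := by
  rw [kPoint_mem_tubeK]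
  simp only [tubeDomain, Set.mem_ofPred_eq, sub_pos]
  exact ⟨fun h => ⟨Z.1.im_pos, h⟩, fun h => h.2⟩

theorem apply_tubePoint (F : affineCone S → ℂ) (Z : tubeDomain S) :
    F (tubePoint S Z) = tubeFun S F (kPoint (Z.1.1 : ℂ) Z.1.2.1 (Z.1.2.2 : ℂ)) := by
  rw [tubeFun_of_mem F ((mem_tubeDomain_iff Z.1).mp Z.2)]
  congr 1
  exact Subtype.ext (tubeVector_eq Z.1)

theorem differentiable_form {ι : Type*} [Fintype ι] (G : Matrix ι ι ℤ) :
    Differentiable ℂ fun Z : ι → ℂ => form G Z Z := by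
  simp only [form_eq_sum]
  fun_prop

theorem differentiable_coneVec : Differentiable ℂ (coneVec S) := by
  rw [differentiable_pi]
  rintro (i | i)
  · fin_cases i
    · simp only [coneVec, Sum.elim_inl]
      have h : Differentiable ℂ fun Z : KIndex r → ℂ => form (gramK S) Z Z :=
        differentiable_form (gramK S)
      simpa using! (h.mul_const (2⁻¹ : ℂ)).neg
    · simp [coneVec]
  · simp only [coneVec, Sum.elim_inr]
    fun_prop

variable {Γ : Subgroup (GL (MIndex r) ℤ)} {k : ℤ} {F : affineCone S → ℂ}

theorem differentiableOn_tubeFun (hF : F ∈ modularForms S Γ k) :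
    DifferentiableOn ℂ (tubeFun S F) (tubeK S) := by
  obtain ⟨⟨G, hG, hG'⟩, -⟩ := hF
  refine (hG.comp differentiable_coneVec.differentiableOn
    fun Z hZ => coneVec_mem.mpr hZ).congr fun Z hZ => ?_
  rw [tubeFun_of_mem F hZ, hG']
  rfl

/-- By invariance and homogeneity, F(coneVec Z) = F(t · coneVec Z') = t^{-k} F(coneVec Z'). -/
theorem tubeFun_transform (hF : F ∈ modularForms S Γ k) {g : GL (MIndex r) ℤ} (hg : g ∈ Γ)
    {Z Z' : KIndex r → ℂ} (hZ : Z ∈ tubeK S) (hZ' : Z' ∈ tubeK S) {t : ℂ} (ht : t ≠ 0)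
    (h : act g (coneVec S Z) = t • coneVec S Z') : tubeFun S F Z' = t ^ k * tubeFun S F Z := by
  have h1 := hF.2.1 t ⟨coneVec S Z', coneVec_mem.mpr hZ'⟩
    ⟨t • coneVec S Z', smul_mem_affineCone ht (coneVec_mem.mpr hZ')⟩ ht rfl
  have h2 := hF.2.2 g hg ⟨coneVec S Z, coneVec_mem.mpr hZ⟩
    ⟨t • coneVec S Z', smul_mem_affineCone ht (coneVec_mem.mpr hZ')⟩ h.symm
  rw [tubeFun_of_mem F hZ, tubeFun_of_mem F hZ', ← h2, h1, ← mul_assoc, ← zpow_add₀ ht,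
    add_neg_cancel, zpow_zero, one_mul]

theorem eq_zero_of_tubeFun (hF : F ∈ modularForms S Γ k) (h : ∀ Z ∈ tubeK S, tubeFun S F Z = 0) :
    F = 0 := by
  funext Z
  obtain ⟨t, ht, W, hW, hZ⟩ := exists_eq_smul_coneVec Z.2
  rw [hF.2.1 t ⟨coneVec S W, coneVec_mem.mpr hW⟩ Z ht hZ, ← tubeFun_of_mem F hW, h W hW]
  simp

variable {W : Subgroup (GL (Fin r) ℤ)}

theorem mem_Gam_of_mem {g : GL (MIndex r) ℤ}
    (hg : g ∈ discriminantKernel (gramM S) ⊓ orthogonalGroupPlus S) : g ∈ Gam S W :=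
  Subgroup.mem_sup_left hg

theorem tubeFun_add_int (hS : IsEvenPosDef S) (hF : F ∈ modularForms S (Gam S W) k)
    {Z : KIndex r → ℂ} (hZ : Z ∈ tubeK S) (a : KIndex r → ℤ) :
    tubeFun S F (Z + fun j => (a j : ℂ)) = tubeFun S F Z := by
  obtain ⟨g, hg, h⟩ := exists_translation hS a
  have hZ' : Z + castVec ℂ a ∈ tubeK S := by
    simpa [tubeK, tubeOver, castVec] using hZ
  have := tubeFun_transform hF (mem_Gam_of_mem hg) hZ hZ' one_ne_zero (by rw [h Z hZ, one_smul])
  rwa [one_zpow, one_mul] at this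

theorem tubeFun_eichlerMap (hS : IsEvenPosDef S) (hF : F ∈ modularForms S (Gam S W) k)
    {e a : KIndex r → ℤ} {q : ℤ} (he : form (gramK S) e e = 0) (hea : form (gramK S) e a = 0)
    (ha : form (gramK S) a a = 2 * q) {Z : KIndex r → ℂ} (hZ : Z ∈ tubeK S) :
    tubeFun S F (eichlerMap (gramK S) (castVec ℂ e) (castVec ℂ a) q Z) = tubeFun S F Z := by
  obtain ⟨g, hg, h⟩ := exists_transvection hS he hea ha
  have := tubeFun_transform hF (mem_Gam_of_mem hg) hZ (eichlerMap_mem_tubeK hS he hea ha hZ)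
    one_ne_zero (by rw [h Z hZ, one_smul])
  rwa [one_zpow, one_mul] at this

theorem tubeFun_swapK (hS : IsEvenPosDef S) (hF : F ∈ modularForms S (Gam S W) k)
    {Z : KIndex r → ℂ} (hZ : Z ∈ tubeK S) : tubeFun S F (swapK Z) = tubeFun S F Z := by
  have := tubeFun_transform hF (mem_Gam_of_mem (swapGL_mem hS)) hZ (swapK_mem_tubeK hS hZ)
    one_ne_zero (by rw [act_swapGL_coneVec, one_smul])
  rwa [one_zpow, one_mul] at this

theorem tubeFun_slPoint (hF : F ∈ modularForms S (Gam S W) k) {a b c d : ℤ}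
    (h : a * d - b * c = 1) {τ : ℂ} {z : Fin r → ℂ} {ω : ℂ} (hZ : kPoint τ z ω ∈ tubeK S) :
    tubeFun S F (slPoint S a b c d τ z ω) = (c * τ + d) ^ k * tubeFun S F (kPoint τ z ω) :=
  tubeFun_transform hF (mem_Gam_of_mem (slGL_mem h)) hZ (slPoint_mem_tubeK h hZ)
    (denom_ne_zero' h hZ.1) (act_slGL_coneVec h hZ.1 z ω)

theorem tubeFun_act (hF : F ∈ modularForms S (Gam S W) k) {σ : GL (Fin r) ℤ} (hσ : σ ∈ W)
    (hW : W ≤ orthogonalGroup S) {τ : ℂ} {z : Fin r → ℂ} {ω : ℂ}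
    (hZ : kPoint τ z ω ∈ tubeK S) :
    tubeFun S F (kPoint τ (act σ z) ω) = tubeFun S F (kPoint τ z ω) := by
  have := tubeFun_transform hF (Subgroup.mem_sup_right (Subgroup.mem_map_of_mem embedL hσ)) hZ
    (kPoint_act_mem_tubeK (hW hσ) hZ) one_ne_zero
    (by rw [act_embedL_coneVec (hW hσ), one_smul])
  rwa [one_zpow, one_mul] at this

end TubeFunctions

end

end OrthogonalModular

namespace OrthogonalModular

noncomputable section

open Complex Filter Topology

/-! ### The dual lattice as integral exponents. -/

section DualLattice

variable {r : ℕ} {S : Matrix (Fin r) (Fin r) ℤ}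

/-- The integral functional on the lattice that is given by a vector of the dual lattice. -/
def dualVec (l : dualLattice S) (j : Fin r) : ℤ := (l.2 (Pi.single j 1)).choose

theorem form_castVec_single {ι R : Type*} [Fintype ι] [DecidableEq ι] [CommRing R]
    (G : Matrix ι ι ℤ) (x : ι → R) (j : ι) :
    form G x (castVec R (Pi.single j 1)) = ∑ i, x i * G i j := by
  simp [form_eq_sum, castVec, Pi.single_apply]

theorem dualVec_spec (l : dualLattice S) (j : Fin r) :
    (dualVec l j : ℚ) = ∑ i, (l : Fin r → ℚ) i * S i j := by
  rw [← form_castVec_single]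
  exact ((l.2 (Pi.single j 1)).choose_spec).symm

theorem sum_dualVec_mul {R : Type*} [Field R] [CharZero R] (l : dualLattice S) (z : Fin r → R) :
    ∑ j, (dualVec l j : R) * z j = form S (fun i => ((l : Fin r → ℚ) i : R)) z := by
  rw [form_eq_sum, Finset.sum_comm]
  refine Finset.sum_congr rfl fun j _ => ?_
  have : (dualVec l j : R) = ((dualVec l j : ℚ) : R) := by simp
  rw [this, dualVec_spec, Rat.cast_sum, Finset.sum_mul]
  refine Finset.sum_congr rfl fun i _ => ?_
  push_cast
  ring

theorem IsEvenPosDef.det_ne_zero (hS : IsEvenPosDef S) : S.det ≠ 0 := by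
  have h := hS.posDef.det_pos
  have h2 : (S.map (Int.cast : ℤ → ℝ)).det = (S.det : ℝ) := (Int.cast_det (R := ℝ) S).symm
  rw [h2] at h
  exact_mod_cast h.ne'

theorem isUnit_det_rat (hS : IsEvenPosDef S) : IsUnit (S.map (Int.cast : ℤ → ℚ)).det := by
  have h2 : (S.map (Int.cast : ℤ → ℚ)).det = (S.det : ℚ) := (Int.cast_det (R := ℚ) S).symm
  rw [h2, isUnit_iff_ne_zero]
  exact_mod_cast hS.det_ne_zero

theorem vecMul_eq_dualVec (l : dualLattice S) :
    (l : Fin r → ℚ) ᵥ* S.map (Int.cast : ℤ → ℚ) = fun j => (dualVec l j : ℚ) := by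
  funext j
  rw [dualVec_spec]
  simp [Matrix.vecMul, dotProduct]

theorem dualVec_injective (hS : IsEvenPosDef S) :
    Function.Injective (dualVec : dualLattice S → Fin r → ℤ) := by
  intro l l' h
  have h1 : (l : Fin r → ℚ) ᵥ* S.map (Int.cast : ℤ → ℚ)
      = (l' : Fin r → ℚ) ᵥ* S.map (Int.cast : ℤ → ℚ) := by
    rw [vecMul_eq_dualVec, vecMul_eq_dualVec, h]
  have h2 := congrArg (fun v => v ᵥ* (S.map (Int.cast : ℤ → ℚ))⁻¹) h1
  simp only [Matrix.vecMul_vecMul, Matrix.mul_nonsing_inv _ (isUnit_det_rat hS),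
    Matrix.vecMul_one] at h2
  exact Subtype.ext h2

/-- The preimage of v is v S⁻¹. Together with injectivity this turns sums over the dual lattice into
sums over ℤ^r. -/
theorem dualVec_surjective (hS : IsEvenPosDef S) :
    Function.Surjective (dualVec : dualLattice S → Fin r → ℤ) := by
  intro v
  set l : Fin r → ℚ := castVec ℚ v ᵥ* (S.map (Int.cast : ℤ → ℚ))⁻¹
  have h1 : l ᵥ* S.map (Int.cast : ℤ → ℚ) = castVec ℚ v := by
    simp only [l, Matrix.vecMul_vecMul, Matrix.nonsing_inv_mul _ (isUnit_det_rat hS),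
      Matrix.vecMul_one]
  have hl : l ∈ dualLattice S := fun x => by
    refine ⟨∑ j, v j * x j, ?_⟩
    rw [form, Matrix.dotProduct_mulVec, h1]
    simp [dotProduct, castVec]
  refine ⟨⟨l, hl⟩, funext fun j => ?_⟩
  have := congrFun ((vecMul_eq_dualVec ⟨l, hl⟩).symm.trans h1) j
  simpa [castVec] using this

/-- Clears denominators, so that the isotropic vector attached to a point of the dual lattice can be
taken integral. -/
theorem exists_denominator (l : Fin r → ℚ) :
    ∃ D : ℤ, 0 < D ∧ ∃ x : Fin r → ℤ, ∀ i, (x i : ℚ) = D * l i := by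
  refine ⟨∏ i, ((l i).den : ℤ), Finset.prod_pos fun i _ => by exact_mod_cast (l i).den_pos,
    fun i => (l i).num * ∏ j ∈ Finset.univ.erase i, ((l j).den : ℤ), fun i => ?_⟩
  rw [← Finset.mul_prod_erase _ _ (Finset.mem_univ i)]
  push_cast
  have := Rat.mul_den_eq_num (l i)
  rw [← this]
  ring

end DualLattice

/-! ### Symmetries of Fourier coefficients and Koecher's principle. -/

section Koecher

variable {ι : Type*} [Fintype ι] {C : Set (ι → ℝ)}

/-- `c` are the Fourier coefficients of `f` on the tube over `C`. -/
def HasFourierCoeff (C : Set (ι → ℝ)) (f : (ι → ℂ) → ℂ) (c : (ι → ℤ) → ℂ) : Prop :=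
  ∀ Z ∈ tubeOver C, HasSum (fun N => c N * fourierExp N Z) (f Z)

/-- Substituting T transports exponents along ν without changing f, so uniqueness of the
coefficients applies. Extension by zero off the image of ν makes injectivity of ν sufficient. -/
theorem HasFourierCoeff.apply_eq {f : (ι → ℂ) → ℂ} {c : (ι → ℤ) → ℂ} (hc : HasFourierCoeff C f c)
    (hne : C.Nonempty) {T : (ι → ℂ) → ι → ℂ} {ν : (ι → ℤ) → ι → ℤ}
    (hT : ∀ Z ∈ tubeOver C, T Z ∈ tubeOver C) (hf : ∀ Z ∈ tubeOver C, f (T Z) = f Z)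
    (hν : Function.Injective ν) (hνT : ∀ N Z, fourierExp N (T Z) = fourierExp (ν N) Z)
    (N : ι → ℤ) : c (ν N) = c N := by
  obtain ⟨Y, hY⟩ := hne
  have hmem : ∀ X : ι → ℝ, realAdd X (fun j => I * (Y j : ℂ)) ∈ tubeOver C := fun X => by
    rw [realAdd_mem_tubeOver]
    simpa [tubeOver] using hY
  have h := fourierExp_coeff_unique (a := Function.extend ν c 0) (b := c) (f := f)
    (fun j => I * (Y j : ℂ)) (fun X => by
      rw [hasSum_extend_fourierExp hν]
      simp only [← hνT]
      rw [← hf _ (hmem X)]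
      exact hc _ (hT _ (hmem X))) (fun X => hc _ (hmem X))
  rw [← hν.extend_apply c 0 N, h]

variable {r : ℕ} {S : Matrix (Fin r) (Fin r) ℤ} {W : Subgroup (GL (Fin r) ℤ)} {k : ℤ}
  {F : affineCone S → ℂ}

theorem coneK_nonempty (S : Matrix (Fin r) (Fin r) ℤ) : (coneK S).Nonempty :=
  ⟨kPoint 1 0 1, by simp [kPoint], by simp [form_kPoint, form_zero_left]⟩

theorem exists_hasFourierCoeff (hS : IsEvenPosDef S) (hF : F ∈ modularForms S (Gam S W) k) :
    ∃ c, HasFourierCoeff (coneK S) (tubeFun S F) c :=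
  exists_fourierExp_expansion isOpen_coneK (convex_coneK hS) (differentiableOn_tubeFun hF)
    fun _ hZ a => tubeFun_add_int hS hF hZ a

theorem fourierExp_swapK (N : KIndex r → ℤ) (Z : KIndex r → ℂ) :
    fourierExp N (swapK Z) = fourierExp (swapK N) Z := by
  simp [fourierExp, swapK, add_comm]

theorem coeff_swapK (hS : IsEvenPosDef S) (hF : F ∈ modularForms S (Gam S W) k)
    {c : (KIndex r → ℤ) → ℂ} (hc : HasFourierCoeff (coneK S) (tubeFun S F) c)
    (N : KIndex r → ℤ) : c (swapK N) = c N := by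
  refine hc.apply_eq (coneK_nonempty S) (T := swapK) (fun Z hZ => swapK_mem_tubeK hS hZ)
    (fun Z hZ => tubeFun_swapK hS hF hZ) (fun N N' h => ?_) fourierExp_swapK N
  funext i
  rcases i with i | i
  · fin_cases i
    · exact congrFun h (Sum.inl 1)
    · exact congrFun h (Sum.inl 0)
  · exact congrFun h (Sum.inr i)

/-- The transposed Eichler transvection on exponents. -/
def eichlerDual (G : Matrix ι ι ℤ) (e a : ι → ℤ) (q : ℤ) (N : ι → ℤ) : ι → ℤ :=
  N + (N ⬝ᵥ a) • (e ᵥ* G) - (N ⬝ᵥ e) • (a ᵥ* G) - (q * (N ⬝ᵥ e)) • (e ᵥ* G)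

theorem sum_vecMul_mul {R : Type*} [CommRing R] (G : Matrix ι ι ℤ) (e : ι → ℤ) (Z : ι → R) :
    ∑ j, ((e ᵥ* G) j : R) * Z j = form G (castVec R e) Z := by
  rw [form_eq_sum, Finset.sum_comm]
  refine Finset.sum_congr rfl fun j _ => ?_
  simp only [Matrix.vecMul, dotProduct, castVec, Int.cast_sum, Int.cast_mul, Finset.sum_mul]
  exact Finset.sum_congr rfl fun i _ => by ring

theorem sum_eichlerDual_mul {R : Type*} [CommRing R] (G : Matrix ι ι ℤ) (e a : ι → ℤ) (q : ℤ)
    (N : ι → ℤ) (Z : ι → R) : ∑ j, (eichlerDual G e a q N j : R) * Z j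
      = ∑ j, (N j : R) * Z j + (N ⬝ᵥ a : ℤ) * form G (castVec R e) Z
        - (N ⬝ᵥ e : ℤ) * form G (castVec R a) Z
        - q * (N ⬝ᵥ e : ℤ) * form G (castVec R e) Z := by
  rw [← sum_vecMul_mul, ← sum_vecMul_mul]
  simp only [Finset.mul_sum, ← Finset.sum_add_distrib, ← Finset.sum_sub_distrib]
  refine Finset.sum_congr rfl fun j _ => ?_
  simp only [eichlerDual, Pi.add_apply, Pi.sub_apply, Pi.smul_apply, smul_eq_mul]
  push_cast
  ring

theorem fourierExp_eichlerMap (G : Matrix ι ι ℤ) (e a : ι → ℤ) (q : ℤ) (N : ι → ℤ) (Z : ι → ℂ) :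
    fourierExp N (eichlerMap G (castVec ℂ e) (castVec ℂ a) q Z)
      = fourierExp (eichlerDual G e a q N) Z := by
  rw [fourierExp, fourierExp, sum_eichlerDual_mul]
  congr 2
  simp only [dotProduct, Int.cast_sum, Int.cast_mul, Finset.sum_mul, Finset.mul_sum,
    ← Finset.sum_add_distrib, ← Finset.sum_sub_distrib]
  refine Finset.sum_congr rfl fun j _ => ?_
  simp only [eichlerMap, castVec, Pi.add_apply, Pi.sub_apply, Pi.smul_apply, smul_eq_mul]
  ring

/-- The number N·e is invariant, N·a changes by -2q N·e, and these two numbers determine the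
translation that was applied to N. -/
theorem eichlerDual_injective {G : Matrix ι ι ℤ} (hG : G.IsSymm) {e a : ι → ℤ} {q : ℤ}
    (he : form G e e = 0) (hea : form G e a = 0) (ha : form G a a = 2 * q) :
    Function.Injective (eichlerDual G e a q) := by
  intro N N' h
  have key : ∀ (N x : ι → ℤ), eichlerDual G e a q N ⬝ᵥ x = N ⬝ᵥ x + (N ⬝ᵥ a) * form G e x
      - (N ⬝ᵥ e) * form G a x - q * (N ⬝ᵥ e) * form G e x := fun N x => by
    have := sum_eichlerDual_mul G e a q N x
    simp only [castVec_int, Int.cast_id] at this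
    exact this
  have h1 : N ⬝ᵥ e = N' ⬝ᵥ e := by
    have h2 := congrArg (fun v => v ⬝ᵥ e) h
    simp only [key, he, form_comm hG a e, hea] at h2
    linarith
  have h3 : N ⬝ᵥ a = N' ⬝ᵥ a := by
    have h2 := congrArg (fun v => v ⬝ᵥ a) h
    simp only [key, hea, ha, h1] at h2
    linarith
  simp only [eichlerDual, h1, h3] at h
  simpa using h

theorem coeff_eichlerDual (hS : IsEvenPosDef S) (hF : F ∈ modularForms S (Gam S W) k)
    {c : (KIndex r → ℤ) → ℂ} (hc : HasFourierCoeff (coneK S) (tubeFun S F) c)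
    {e a : KIndex r → ℤ} {q : ℤ} (he : form (gramK S) e e = 0) (hea : form (gramK S) e a = 0)
    (ha : form (gramK S) a a = 2 * q) (N : KIndex r → ℤ) :
    c (eichlerDual (gramK S) e a q N) = c N :=
  hc.apply_eq (coneK_nonempty S) (fun _ hZ => eichlerMap_mem_tubeK hS he hea ha hZ)
    (fun _ hZ => tubeFun_eichlerMap hS hF he hea ha hZ)
    (eichlerDual_injective (gramK_isSymm hS) he hea ha) (fourierExp_eichlerMap _ e a q) N

/-- A Fourier coefficient vanishes if its index is negative on an isotropic vector in the closure
of the positive cone. -/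
theorem coeff_eq_zero_of_isotropic (hS : IsEvenPosDef S) (hF : F ∈ modularForms S (Gam S W) k)
    {c : (KIndex r → ℤ) → ℂ} (hc : HasFourierCoeff (coneK S) (tubeFun S F) c)
    {e a : KIndex r → ℤ} {q : ℤ} (he : form (gramK S) e e = 0) (he1 : 0 < e (Sum.inl 1))
    (hea : form (gramK S) e a = 0) (ha : form (gramK S) a a = 2 * q) (hq : q < 0)
    {N : KIndex r → ℤ} (hN : N ⬝ᵥ e < 0) : c N = 0 := by
  obtain ⟨Y, hY⟩ := coneK_nonempty S
  set Z : KIndex r → ℂ := fun j => I * (Y j : ℂ)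
  have hZ : Z ∈ tubeOver (coneK S) := by simpa [tubeOver, Z] using hY
  have heY : 0 < form (gramK S) (castVec ℝ e) Y := by
    rw [form_comm (gramK_isSymm hS)]
    refine form_gramK_pos hS hY.1 hY.2 (by simpa [castVec] using he1) ?_
    have := form_castVec_eq (R := ℝ) (G := gramK S) (a := e) (b := e) (n := 0) (by simpa using he)
    rw [this]
    simp
  have hs := (hc Z hZ).summable.norm
  set B := ∑' N, ‖c N * fourierExp N Z‖
  set γ : ℝ := (q : ℝ) * (N ⬝ᵥ e : ℤ) * form (gramK S) (castVec ℝ e) Y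
  have hγ : 0 < γ := mul_pos (mul_pos_of_neg_of_neg (by exact_mod_cast hq)
    (by exact_mod_cast hN)) heY
  set α : ℝ := ∑ j, (N j : ℝ) * Y j
  set β : ℝ := (N ⬝ᵥ a : ℤ) * form (gramK S) (castVec ℝ e) Y
        - (N ⬝ᵥ e : ℤ) * form (gramK S) (castVec ℝ a) Y
  -- Use t·a for all t. The coefficient stays the same, while the exponent of the exponential is
  -- 2π(γt² - βt - α), where γ > 0 because `q` and N·e are both negative. Each term is at most the
  -- sum B of the norms, which is impossible for large t unless `c N` is zero.
  have hbound : ∀ t : ℕ, ‖c N‖ * Real.exp (2 * Real.pi * (t * (γ * t - β) - α)) ≤ B := fun t => by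
    have h1 : form (gramK S) e ((t : ℤ) • a) = 0 := by
      rw [form_smul_right, hea, mul_zero]
    have h2 : form (gramK S) ((t : ℤ) • a) ((t : ℤ) • a) = 2 * ((t : ℤ) ^ 2 * q) := by
      rw [form_smul_left, form_smul_right, ha]
      ring
    have h3 := coeff_eichlerDual hS hF hc he h1 h2 N
    have h4 := hs.le_tsum (eichlerDual (gramK S) e ((t : ℤ) • a) ((t : ℤ) ^ 2 * q) N)
      fun _ _ => norm_nonneg _
    rw [h3, norm_mul, norm_fourierExp] at h4
    refine le_of_eq_of_le ?_ h4
    congr 2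
    have h5 : ∀ j, (Z j).im = Y j := fun j => by simp [Z]
    simp only [h5]
    rw [sum_eichlerDual_mul]
    have h6 : castVec ℝ ((t : ℤ) • a) = (t : ℝ) • castVec ℝ a := by
      funext i; simp [castVec]
    have h7 : ((N ⬝ᵥ ((t : ℤ) • a) : ℤ) : ℝ) = t * (N ⬝ᵥ a : ℤ) := by
      rw [dotProduct_smul, smul_eq_mul]
      push_cast
      ring
    rw [h6, form_smul_left, h7]
    simp only [γ, α, β]
    push_cast
    ring
  by_contra hne
  have hpos : 0 < ‖c N‖ := norm_pos_iff.mpr hne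
  have htend : Tendsto (fun t : ℕ => ‖c N‖ * Real.exp (2 * Real.pi * (t * (γ * t - β) - α)))
      atTop atTop := by
    refine Tendsto.const_mul_atTop hpos (Real.tendsto_exp_atTop.comp
      (Tendsto.const_mul_atTop (by positivity) ?_))
    have h1 : Tendsto (fun t : ℕ => (t : ℝ)) atTop atTop := tendsto_natCast_atTop_atTop
    have h2 : Tendsto (fun t : ℕ => γ * (t : ℝ) - β) atTop atTop :=
      tendsto_atTop_add_const_right _ _ (Tendsto.const_mul_atTop hγ h1)
    exact tendsto_atTop_add_const_right _ _ (h1.atTop_mul_atTop₀ h2)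
  obtain ⟨t, ht⟩ := (htend.eventually (eventually_gt_atTop B)).exists
  exact absurd (hbound t) (not_le.mpr ht)

/-- The vector with (τ, z, ω) = (2D², 2Dx, (x, x)) is isotropic, and its pairing with the exponent
is 2D² (n + v·y + m (y, y) / 2) at y = x / D. A vector orthogonal to it of negative norm is built
from a basis vector b of L, which exists as r > 0. -/
theorem coeff_eq_zero_of_neg (hr : 0 < r) (hS : IsEvenPosDef S)
    (hF : F ∈ modularForms S (Gam S W) k)
    {c : (KIndex r → ℤ) → ℂ} (hc : HasFourierCoeff (coneK S) (tubeFun S F) c)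
    {n m D : ℤ} {v x : Fin r → ℤ} (hD : 0 < D)
    (h : m * form S x x + 2 * D ^ 2 * n + 2 * D * (v ⬝ᵥ x) < 0) : c (kPoint n v m) = 0 := by
  set b : Fin r → ℤ := Pi.single ⟨0, hr⟩ 1
  obtain ⟨q, hq⟩ := hS.even b
  have hb : 0 < form S b b := by
    have h1 : 0 < form S (castVec ℝ b) (castVec ℝ b) := hS.form_pos fun h0 => by
      have := congrFun h0 ⟨0, hr⟩
      simp [castVec, b] at this
    rw [form_castVec] at h1
    exact_mod_cast h1
  refine coeff_eq_zero_of_isotropic hS hF hc (e := kPoint (2 * D ^ 2) ((2 * D) • x) (form S x x))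
    (a := kPoint 0 ((2 * D ^ 2) • b) (form S b ((2 * D) • x))) (q := -((2 * D ^ 2) ^ 2 * q))
    ?_ ?_ ?_ ?_ ?_ ?_
  · rw [form_kPoint, form_smul_left, form_smul_right]
    ring
  · simpa [kPoint] using pow_pos hD 2
  · simp only [form_kPoint, form_smul_right, form_smul_left, form_comm hS.isSymm x b]
    ring
  · simp only [form_kPoint, form_smul_right, form_smul_left, hq]
    ring
  · have : 0 < q := by linarith
    have : 0 < (2 * D ^ 2) ^ 2 * q := by positivity
    linarith
  · refine lt_of_eq_of_lt ?_ h
    have h1 : (kPoint n v m : KIndex r → ℤ) ⬝ᵥ kPoint (2 * D ^ 2) ((2 * D) • x) (form S x x)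
        = m * form S x x + n * (2 * D ^ 2) + v ⬝ᵥ ((2 * D) • x) := by
      simp [kPoint, dotProduct, Fintype.sum_sum_type]
    rw [h1, dotProduct_smul, smul_eq_mul]
    ring

end Koecher

end

end OrthogonalModular

namespace OrthogonalModular

noncomputable section

open Complex Filter Topology

/-! ### Vanishing of the Fourier coefficients of modular forms. -/

section FourierCoefficients

variable {r : ℕ} {S : Matrix (Fin r) (Fin r) ℤ} {W : Subgroup (GL (Fin r) ℤ)} {k : ℤ}
  {F : affineCone S → ℂ} {c : (KIndex r → ℤ) → ℂ}

theorem coeff_eq_zero_of_neg_left (hr : 0 < r) (hS : IsEvenPosDef S)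
    (hF : F ∈ modularForms S (Gam S W) k) (hc : HasFourierCoeff (coneK S) (tubeFun S F) c)
    {n m : ℤ} {v : Fin r → ℤ} (hn : n < 0) : c (kPoint n v m) = 0 := by
  refine coeff_eq_zero_of_neg hr hS hF hc (x := 0) (D := 1) one_pos ?_
  rw [form_zero_left, dotProduct_zero]
  linarith

theorem coeff_comm (hS : IsEvenPosDef S)
    (hF : F ∈ modularForms S (Gam S W) k) (hc : HasFourierCoeff (coneK S) (tubeFun S F) c)
    (n m : ℤ) (v : Fin r → ℤ) : c (kPoint n v m) = c (kPoint m v n) := by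
  have h : swapK (kPoint m v n) = kPoint n v m := by
    simp [swapK, kPoint]
  rw [← h, coeff_swapK hS hF hc]

theorem coeff_eq_zero_of_neg_right (hr : 0 < r) (hS : IsEvenPosDef S)
    (hF : F ∈ modularForms S (Gam S W) k) (hc : HasFourierCoeff (coneK S) (tubeFun S F) c)
    {n m : ℤ} {v : Fin r → ℤ} (hm : m < 0) : c (kPoint n v m) = 0 := by
  rw [coeff_comm hS hF hc, coeff_eq_zero_of_neg_left hr hS hF hc hm]

/-- For m > 0 the function n + (ℓ, y) + m (y, y) / 2 takes its minimum n - (ℓ, ℓ) / (2m) at y = -ℓ /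
m, which is the point tested. For m = 0 it is affine in y, and y = -tℓ with t > n / (ℓ, ℓ) makes it
negative. -/
theorem coeff_eq_zero_of_disc (hr : 0 < r) (hS : IsEvenPosDef S)
    (hF : F ∈ modularForms S (Gam S W) k) (hc : HasFourierCoeff (coneK S) (tubeFun S F) c)
    {n m : ℕ} {l : dualLattice S} (h : 2 * (n : ℚ) * m - form S (l : Fin r → ℚ) l < 0) :
    c (kPoint (n : ℤ) (dualVec l) (m : ℤ)) = 0 := by
  obtain ⟨D, hD, x, hx⟩ := exists_denominator (l : Fin r → ℚ)
  have hx' : castVec ℚ x = (D : ℚ) • (l : Fin r → ℚ) := funext hx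
  have hxx : ((form S x x : ℤ) : ℚ) = D ^ 2 * form S (l : Fin r → ℚ) l := by
    rw [← form_castVec, hx', form_smul_left, form_smul_right]
    ring
  have hlx : ((dualVec l ⬝ᵥ x : ℤ) : ℚ) = D * form S (l : Fin r → ℚ) l := by
    have := sum_dualVec_mul (R := ℚ) l (castVec ℚ x)
    rw [hx', form_smul_right, ← hx'] at this
    simp only [Rat.cast_id] at this
    rw [← this]
    simp [dotProduct, castVec]
  have hDq : (0 : ℚ) < D := by exact_mod_cast hD
  rcases Nat.eq_zero_or_pos m with rfl | hm
  · have hl : 0 < form S (l : Fin r → ℚ) l := by simpa using h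
    obtain ⟨t, ht⟩ := exists_nat_gt ((n : ℚ) / form S (l : Fin r → ℚ) l)
    rw [div_lt_iff₀ hl] at ht
    refine coeff_eq_zero_of_neg hr hS hF hc (x := (-(t : ℤ)) • x) hD ?_
    rw [dotProduct_smul, smul_eq_mul]
    have : (((0 : ℕ) : ℤ) * form S ((-(t : ℤ)) • x) ((-(t : ℤ)) • x) + 2 * D ^ 2 * n
        + 2 * D * (-(t : ℤ) * (dualVec l ⬝ᵥ x)) : ℚ) < 0 := by
      rw [hlx]
      have := mul_pos (mul_pos hDq hDq) (sub_pos.mpr ht)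
      push_cast
      nlinarith
    exact_mod_cast this
  · have hmq : (0 : ℚ) < m := by exact_mod_cast hm
    refine coeff_eq_zero_of_neg hr hS hF hc (x := -x) (D := m * D) (by positivity) ?_
    rw [dotProduct_neg, form_neg_left, form_neg_right, neg_neg]
    have : ((m : ℤ) * form S x x + 2 * (m * D) ^ 2 * n
        + 2 * (m * D) * (-(dualVec l ⬝ᵥ x)) : ℚ) < 0 := by
      rw [hlx, hxx]
      have := mul_pos (mul_pos (mul_pos hDq hDq) hmq) (neg_pos.mpr h)
      push_cast
      nlinarith
    exact_mod_cast this

end FourierCoefficients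

/-! ### Jacobi forms as exponential series in (τ, z). -/

section JacobiFunctions

variable {r : ℕ} {S : Matrix (Fin r) (Fin r) ℤ} {W : Subgroup (GL (Fin r) ℤ)} {k : ℤ}

/-- The point with coordinates `(τ, z)`. -/
def jPoint {R : Type*} (τ : R) (z : Fin r → R) : Unit ⊕ Fin r → R := Sum.elim (fun _ => τ) z

/-- The exponent of a term of the Fourier expansion of a Jacobi form. -/
def jIndex (p : ℕ × dualLattice S) : Unit ⊕ Fin r → ℤ := jPoint (p.1 : ℤ) (dualVec p.2)

theorem jPoint_injective {R : Type*} {τ τ' : R} {z z' : Fin r → R}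
    (h : jPoint τ z = jPoint τ' z') : τ = τ' ∧ z = z' :=
  ⟨congrFun h (Sum.inl ()), funext fun i => congrFun h (Sum.inr i)⟩

theorem jPoint_eta {R : Type*} (Z : Unit ⊕ Fin r → R) :
    jPoint (Z (Sum.inl ())) (fun i => Z (Sum.inr i)) = Z := by
  funext i
  rcases i with i | i <;> rfl

theorem jIndex_injective (hS : IsEvenPosDef S) :
    Function.Injective (jIndex : ℕ × dualLattice S → _) := by
  rintro ⟨n, l⟩ ⟨n', l'⟩ h
  obtain ⟨h1, h2⟩ := jPoint_injective h
  exact Prod.ext (by exact_mod_cast h1) (dualVec_injective hS h2)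

theorem fourierExp_jPoint (n : ℤ) (v : Fin r → ℤ) (τ : ℂ) (z : Fin r → ℂ) :
    fourierExp (jPoint n v) (jPoint τ z)
      = Complex.exp (2 * Real.pi * Complex.I * (n * τ + ∑ j, (v j : ℂ) * z j)) := by
  simp [fourierExp, jPoint, Fintype.sum_sum_type]

theorem exp_eq_fourierExp (p : ℕ × dualLattice S) (τ : ℂ) (z : Fin r → ℂ) :
    Complex.exp (2 * Real.pi * Complex.I *
        (p.1 * τ + form S (fun i => ((p.2 : Fin r → ℚ) i : ℂ)) z))
      = fourierExp (jIndex p) (jPoint τ z) := by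
  rw [jIndex, fourierExp_jPoint, sum_dualVec_mul]
  simp

theorem hasFourierExpansion_iff {φ : JFun r} {f : ℕ → dualLattice S → ℂ} :
    HasFourierExpansion S φ f ↔ ∀ (τ : ℍ) (z : Fin r → ℂ), HasSum
      (fun p : ℕ × dualLattice S => f p.1 p.2 * fourierExp (jIndex p) (jPoint (τ : ℂ) z))
      (φ τ z) := by
  simp only [HasFourierExpansion, exp_eq_fourierExp]

/-- The upper half space of the imaginary parts of `(τ, z)`. -/
def halfSpace (r : ℕ) : Set (Unit ⊕ Fin r → ℝ) := {Y | 0 < Y (Sum.inl ())}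

theorem isOpen_halfSpace : IsOpen (halfSpace r) := isOpen_lt continuous_const (continuous_apply _)

theorem halfSpace_nonempty : (halfSpace r).Nonempty := ⟨fun _ => 1, by simp [halfSpace]⟩

theorem jPoint_mem (τ : ℍ) (z : Fin r → ℂ) : jPoint (τ : ℂ) z ∈ tubeOver (halfSpace r) := τ.im_pos

/-- A function of `(τ, z)` in coordinates. -/
def jFun (φ : JFun r) (Z : Unit ⊕ Fin r → ℂ) : ℂ :=
  φ (UpperHalfPlane.ofComplex (Z (Sum.inl ()))) fun i => Z (Sum.inr i)

theorem jFun_jPoint (φ : JFun r) (τ : ℍ) (z : Fin r → ℂ) : jFun φ (jPoint (τ : ℂ) z) = φ τ z := by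
  simp [jFun, jPoint, UpperHalfPlane.ofComplex_apply]

theorem exists_jPoint {Z : Unit ⊕ Fin r → ℂ} (hZ : Z ∈ tubeOver (halfSpace r)) :
    ∃ (τ : ℍ) (z : Fin r → ℂ), Z = jPoint (τ : ℂ) z :=
  ⟨⟨Z (Sum.inl ()), hZ⟩, fun i => Z (Sum.inr i), (jPoint_eta Z).symm⟩

theorem hasFourierCoeff_jFun_iff {φ : JFun r} {c : (Unit ⊕ Fin r → ℤ) → ℂ} :
    HasFourierCoeff (halfSpace r) (jFun φ) c ↔
      ∀ (τ : ℍ) (z : Fin r → ℂ), HasSum (fun N => c N * fourierExp N (jPoint (τ : ℂ) z)) (φ τ z) := by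
  constructor
  · intro h τ z
    rw [← jFun_jPoint φ τ z]
    exact h _ (jPoint_mem τ z)
  · intro h Z hZ
    obtain ⟨τ, z, rfl⟩ := exists_jPoint hZ
    rw [jFun_jPoint]
    exact h τ z

/-- The Fourier coefficients of a Jacobi form as a function of all integral exponents. -/
def extendCoeff (f : ℕ → dualLattice S → ℂ) : (Unit ⊕ Fin r → ℤ) → ℂ :=
  Function.extend jIndex (fun p : ℕ × dualLattice S => f p.1 p.2) 0

theorem extendCoeff_jIndex (hS : IsEvenPosDef S) (f : ℕ → dualLattice S → ℂ)
    (p : ℕ × dualLattice S) : extendCoeff f (jIndex p) = f p.1 p.2 :=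
  (jIndex_injective hS).extend_apply _ _ p

theorem extendCoeff_of_neg (f : ℕ → dualLattice S → ℂ) {n : ℤ} (hn : n < 0) (v : Fin r → ℤ) :
    extendCoeff f (jPoint n v) = 0 := by
  refine Function.extend_apply' _ _ _ ?_
  rintro ⟨p, hp⟩
  have := (jPoint_injective hp).1
  omega

theorem hasFourierExpansion_iff_coeff (hS : IsEvenPosDef S) {φ : JFun r}
    {f : ℕ → dualLattice S → ℂ} :
    HasFourierExpansion S φ f ↔ HasFourierCoeff (halfSpace r) (jFun φ) (extendCoeff f) := by
  rw [hasFourierExpansion_iff, hasFourierCoeff_jFun_iff]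
  refine forall_congr' fun τ => forall_congr' fun z => ?_
  exact (hasSum_extend_fourierExp (jIndex_injective hS)).symm

theorem HasFourierCoeff.unique {ι : Type*} [Fintype ι] {C : Set (ι → ℝ)} {f : (ι → ℂ) → ℂ}
    {c c' : (ι → ℤ) → ℂ} (hc : HasFourierCoeff C f c) (hc' : HasFourierCoeff C f c')
    (hne : C.Nonempty) : c = c' := by
  obtain ⟨Y, hY⟩ := hne
  have hmem : ∀ X : ι → ℝ, realAdd X (fun j => I * (Y j : ℂ)) ∈ tubeOver C := fun X => by
    rw [realAdd_mem_tubeOver]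
    simpa [tubeOver] using hY
  exact fourierExp_coeff_unique _ (fun X => hc _ (hmem X)) fun X => hc' _ (hmem X)

theorem HasFourierExpansion.unique (hS : IsEvenPosDef S) {φ : JFun r}
    {f f' : ℕ → dualLattice S → ℂ} (h : HasFourierExpansion S φ f)
    (h' : HasFourierExpansion S φ f') : f = f' := by
  rw [hasFourierExpansion_iff_coeff hS] at h h'
  have := h.unique h' halfSpace_nonempty
  funext n l
  rw [← extendCoeff_jIndex hS f (n, l), this, extendCoeff_jIndex hS f' (n, l)]

theorem HasFourierCoeff.differentiableOn {ι : Type*} [Fintype ι] {C : Set (ι → ℝ)}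
    (hC : IsOpen C) {f : (ι → ℂ) → ℂ} {c : (ι → ℤ) → ℂ} (hc : HasFourierCoeff C f c) :
    DifferentiableOn ℂ f (tubeOver C) :=
  (differentiableOn_tsum_fourierExp (isOpen_tubeOver hC) (ν := id)
    fun Z hZ => (hc Z hZ).summable).congr fun Z hZ => (hc Z hZ).tsum_eq.symm

theorem differentiable_jPoint : Differentiable ℂ fun p : ℂ × (Fin r → ℂ) => jPoint p.1 p.2 := by
  rw [differentiable_pi]
  rintro (i | i)
  · simp only [jPoint, Sum.elim_inl]
    fun_prop
  · simp only [jPoint, Sum.elim_inr]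
    fun_prop

theorem HasFourierExpansion.holomorphic (hS : IsEvenPosDef S) {φ : JFun r}
    {f : ℕ → dualLattice S → ℂ} (h : HasFourierExpansion S φ f) : DifferentiableOn ℂ
    (fun p : ℂ × (Fin r → ℂ) => φ (UpperHalfPlane.ofComplex p.1) p.2) {p | 0 < p.1.im} :=
  ((((hasFourierExpansion_iff_coeff hS).mp h).differentiableOn isOpen_halfSpace).comp
    differentiable_jPoint.differentiableOn fun _ hp => hp)

end JacobiFunctions

/-! ### Transformation laws of Fourier–Jacobi coefficients. -/

section FourierJacobi

variable {r : ℕ} {S : Matrix (Fin r) (Fin r) ℤ} {W : Subgroup (GL (Fin r) ℤ)} {k : ℤ}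
  {F : affineCone S → ℂ}

/-- Power series in ξ are exponential series in the single variable ω; uniqueness is applied on the
line Im ω = y + 1. -/
theorem eq_of_hasSum_xi {u v : ℕ → ℂ} {s : ℂ → ℂ} {y : ℝ}
    (hu : ∀ ω : ℂ, y < ω.im → HasSum (fun j => u j * exp (2 * Real.pi * I * (j * ω))) (s ω))
    (hv : ∀ ω : ℂ, y < ω.im → HasSum (fun j => v j * exp (2 * Real.pi * I * (j * ω))) (s ω)) :
    u = v := by
  set ν : ℕ → Unit → ℤ := fun j _ => j
  have hν : Function.Injective ν := fun j j' h => by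
    have := congrFun h ()
    simpa [ν] using this
  have hexp : ∀ (j : ℕ) (Z : Unit → ℂ),
      fourierExp (ν j) Z = exp (2 * Real.pi * I * (j * Z ())) := fun j Z => by
    simp [fourierExp, ν]
  set Z : Unit → ℂ := fun _ => I * (y + 1)
  have hZ : ∀ X : Unit → ℝ, y < (realAdd X Z ()).im := fun X => by
    simp [realAdd, Z]
  have h := fourierExp_coeff_unique (a := Function.extend ν u 0) (b := Function.extend ν v 0)
    (f := fun Z => s (Z ())) Z (fun X => by
      rw [hasSum_extend_fourierExp hν]
      simp only [hexp]
      exact hu _ (hZ X)) (fun X => by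
      rw [hasSum_extend_fourierExp hν]
      simp only [hexp]
      exact hv _ (hZ X))
  funext j
  rw [← hν.extend_apply u 0 j, h, hν.extend_apply]

theorem exists_kPoint_mem (hS : IsEvenPosDef S) {τ : ℂ} (hτ : 0 < τ.im) (z : Fin r → ℂ) :
    ∃ y : ℝ, 0 < y ∧ ∀ ω : ℂ, y < ω.im → kPoint τ z ω ∈ tubeK S := by
  have hz := hS.form_nonneg fun i => (z i).im
  refine ⟨(form S (fun i => (z i).im) (fun i => (z i).im) + 1) / (2 * τ.im), by positivity,
    fun ω hω => kPoint_mem_tubeK.mpr ⟨hτ, ?_⟩⟩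
  rw [div_lt_iff₀ (by positivity)] at hω
  linarith

theorem isFourierJacobiExpansion_iff (hS : IsEvenPosDef S) {ψ : ℕ → JFun r} :
    IsFourierJacobiExpansion S F ψ ↔ ∀ (τ : ℍ) (z : Fin r → ℂ) (ω : ℂ),
      kPoint (τ : ℂ) z ω ∈ tubeK S → HasSum (fun j => ψ j τ z * exp (2 * Real.pi * I * (j * ω)))
        (tubeFun S F (kPoint (τ : ℂ) z ω)) := by
  constructor
  · intro h τ z ω hZ
    have hω : 0 < ω.im := coneK_inl_zero_pos (Y := fun j => (kPoint (τ : ℂ) z ω j).im) hS hZ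
    have h1 : ((τ, z, ⟨ω, hω⟩) : ℍ × (Fin r → ℂ) × ℍ) ∈ tubeDomain S :=
      (mem_tubeDomain_iff _).mpr hZ
    have h2 := h ⟨_, h1⟩
    rwa [apply_tubePoint F ⟨_, h1⟩] at h2
  · intro h Z
    rw [apply_tubePoint F Z]
    exact h _ _ _ ((mem_tubeDomain_iff Z.1).mp Z.2)

/-- The relevant elements of Γ shift ω by an amount s that depends on (τ, z) only. Comparing
coefficients of ξ^j turns each invariance of F into a law for every ψ_j. -/
theorem IsFourierJacobiExpansion.transform (hS : IsEvenPosDef S) {ψ : ℕ → JFun r}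
    (h : IsFourierJacobiExpansion S F ψ) {τ τ' : ℍ} {z z' : Fin r → ℂ} {A s : ℂ}
    (hmem : ∀ ω, kPoint (τ : ℂ) z ω ∈ tubeK S → kPoint (τ' : ℂ) z' (ω + s) ∈ tubeK S)
    (heq : ∀ ω, kPoint (τ : ℂ) z ω ∈ tubeK S →
      tubeFun S F (kPoint (τ' : ℂ) z' (ω + s)) = A * tubeFun S F (kPoint (τ : ℂ) z ω)) (j : ℕ) :
    ψ j τ' z' * exp (2 * Real.pi * I * (j * s)) = A * ψ j τ z := by
  rw [isFourierJacobiExpansion_iff hS] at h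
  obtain ⟨y, -, hy⟩ := exists_kPoint_mem hS τ.im_pos z
  refine congrFun (eq_of_hasSum_xi (u := fun j => ψ j τ' z' * exp (2 * Real.pi * I * (j * s)))
    (v := fun j => A * ψ j τ z) (s := fun ω => A * tubeFun S F (kPoint (τ : ℂ) z ω)) (y := y)
    (fun ω hω => ?_) fun ω hω => ?_) j
  · rw [← heq ω (hy ω hω)]
    convert h τ' z' (ω + s) (hmem ω (hy ω hω)) using 2 with j
    rw [mul_assoc, ← exp_add]
    ring_nf
  · simp only [mul_assoc A]
    exact (h τ z ω (hy ω hω)).mul_left A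

theorem IsFourierJacobiExpansion.unique (hS : IsEvenPosDef S) {ψ ψ' : ℕ → JFun r}
    (h : IsFourierJacobiExpansion S F ψ) (h' : IsFourierJacobiExpansion S F ψ') : ψ = ψ' := by
  rw [isFourierJacobiExpansion_iff hS] at h h'
  funext j τ z
  obtain ⟨y, -, hy⟩ := exists_kPoint_mem hS τ.im_pos z
  exact congrFun (eq_of_hasSum_xi (fun ω hω => h τ z ω (hy ω hω))
    fun ω hω => h' τ z ω (hy ω hω)) j

theorem IsFourierJacobiExpansion.invariant (hS : IsEvenPosDef S) {ψ : ℕ → JFun r}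
    (h : IsFourierJacobiExpansion S F ψ) (hF : F ∈ modularForms S (Gam S W) k)
    (hW : W ≤ orthogonalGroup S) {σ : GL (Fin r) ℤ} (hσ : σ ∈ W) (j : ℕ) (τ : ℍ)
    (z : Fin r → ℂ) : ψ j τ (act σ z) = ψ j τ z := by
  have := h.transform hS (τ := τ) (τ' := τ) (z := z) (z' := act σ z) (A := 1) (s := 0)
    (fun ω hω => by rw [add_zero]; exact kPoint_act_mem_tubeK (hW hσ) hω)
    (fun ω hω => by rw [add_zero, one_mul]; exact tubeFun_act hF hσ hW hω) j
  simpa using this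

/-- The transvection with `e` on the ω-axis and `a` = x, followed by the translation by y, sends z
to z + xτ + y and shifts ω by (x, z) + (x, x)τ / 2. -/
theorem IsFourierJacobiExpansion.elliptic (hS : IsEvenPosDef S) {ψ : ℕ → JFun r}
    (h : IsFourierJacobiExpansion S F ψ) (hF : F ∈ modularForms S (Gam S W) k)
    (x y : Fin r → ℤ) (j : ℕ) (τ : ℍ) (z : Fin r → ℂ) :
    ψ j τ (z + (τ : ℂ) • castVec ℂ x + castVec ℂ y)
      = Complex.exp (-(j * Real.pi * Complex.I *
          (form S (castVec ℂ x) (castVec ℂ x) * (τ : ℂ) + 2 * form S (castVec ℂ x) z)))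
        * ψ j τ z := by
  obtain ⟨q, hq⟩ := hS.even x
  set e : KIndex r → ℤ := kPoint 0 0 1
  set a : KIndex r → ℤ := kPoint 0 x 0
  have he : form (gramK S) e e = 0 := by simp [e, form_kPoint, form_zero_left]
  have hea : form (gramK S) e a = 0 := by simp [e, a, form_kPoint, form_zero_left]
  have ha : form (gramK S) a a = 2 * (-q) := by
    simp only [a, form_kPoint, hq]
    ring
  have hcast : ∀ (t : ℤ) (v : Fin r → ℤ) (w : ℤ),
      castVec ℂ (kPoint t v w) = kPoint (t : ℂ) (castVec ℂ v) (w : ℂ) := fun t v w => by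
    funext i
    rcases i with i | i
    · fin_cases i <;> rfl
    · rfl
  set s : ℂ := form S (castVec ℂ x) z + q * τ
  have hmap : ∀ ω, eichlerMap (gramK S) (castVec ℂ e) (castVec ℂ a) ((-q : ℤ) : ℂ)
      (kPoint (τ : ℂ) z ω) + (fun i => ((kPoint 0 y 0 : KIndex r → ℤ) i : ℂ))
      = kPoint (τ : ℂ) (z + (τ : ℂ) • castVec ℂ x + castVec ℂ y) (ω + s) := fun ω => by
    have h0 : (fun i => ((kPoint 0 y 0 : KIndex r → ℤ) i : ℂ)) = castVec ℂ (kPoint 0 y 0) := rfl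
    have h1 : castVec ℂ (0 : Fin r → ℤ) = 0 := by funext i; simp [castVec]
    rw [h0]
    simp only [eichlerMap, e, a, hcast, form_kPoint, h1, form_zero_left]
    funext i
    rcases i with i | i
    · fin_cases i
      · simp [kPoint, s]
        ring
      · simp [kPoint]
    · simp [kPoint]
  have hmem : ∀ ω, kPoint (τ : ℂ) z ω ∈ tubeK S → eichlerMap (gramK S) (castVec ℂ e)
      (castVec ℂ a) ((-q : ℤ) : ℂ) (kPoint (τ : ℂ) z ω) ∈ tubeK S := fun ω hω =>
    eichlerMap_mem_tubeK hS he hea ha hω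
  have key := h.transform hS (τ := τ) (τ' := τ) (z := z) (A := 1) (s := s)
    (z' := z + (τ : ℂ) • castVec ℂ x + castVec ℂ y)
    (fun ω hω => by
      rw [← hmap ω]
      simpa [tubeK, tubeOver] using hmem ω hω)
    (fun ω hω => by
      rw [← hmap ω, tubeFun_add_int hS hF (hmem ω hω), tubeFun_eichlerMap hS hF he hea ha hω,
        one_mul]) j
  rw [one_mul] at key
  rw [← key, mul_left_comm, ← exp_add, form_castVec, hq]
  have : -(j * Real.pi * Complex.I * (((q + q : ℤ) : ℂ) * (τ : ℂ) + 2 * form S (castVec ℂ x) z))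
      + 2 * Real.pi * I * (j * s) = 0 := by
    simp only [s]
    push_cast
    ring
  rw [this, exp_zero, mul_one]

/-- The action of SL(2, ℤ) shifts ω by -c(z, z) / (2(cτ + d)), whence the exponential factor. -/
theorem IsFourierJacobiExpansion.modular (hS : IsEvenPosDef S) {ψ : ℕ → JFun r}
    (h : IsFourierJacobiExpansion S F ψ) (hF : F ∈ modularForms S (Gam S W) k)
    (γ : SL(2, ℤ)) (j : ℕ) (τ : ℍ) (z : Fin r → ℂ) :
    ψ j (γ • τ) ((((γ 1 0 : ℤ) : ℂ) * τ + ((γ 1 1 : ℤ) : ℂ))⁻¹ • z)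
      = (((γ 1 0 : ℤ) : ℂ) * τ + ((γ 1 1 : ℤ) : ℂ)) ^ k *
        Complex.exp (j * Real.pi * Complex.I *
          (((γ 1 0 : ℤ) : ℂ) * form S z z / (((γ 1 0 : ℤ) : ℂ) * τ + ((γ 1 1 : ℤ) : ℂ)))) *
        ψ j τ z := by
  have hdet : γ 0 0 * γ 1 1 - γ 0 1 * γ 1 0 = 1 := by
    have := γ.2
    rwa [Matrix.det_fin_two] at this
  set J : ℂ := ((γ 1 0 : ℤ) : ℂ) * τ + ((γ 1 1 : ℤ) : ℂ)
  set s : ℂ := -(((γ 1 0 : ℤ) : ℂ) * form S z z / (2 * J))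
  have hτ' : ((γ • τ : ℍ) : ℂ) = (((γ 0 0 : ℤ) : ℂ) * τ + ((γ 0 1 : ℤ) : ℂ)) / J := by
    rw [UpperHalfPlane.specialLinearGroup_apply]
    simp [J]
  have hpt : ∀ ω, slPoint S (γ 0 0 : ℤ) (γ 0 1 : ℤ) (γ 1 0 : ℤ) (γ 1 1 : ℤ) (τ : ℂ) z ω
      = kPoint ((γ • τ : ℍ) : ℂ) (J⁻¹ • z) (ω + s) := fun ω => by
    rw [slPoint, hτ', ← sub_eq_add_neg]
  have key := h.transform hS (τ := τ) (τ' := γ • τ) (z := z) (A := J ^ k) (s := s)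
    (z' := J⁻¹ • z) (fun ω hω => by rw [← hpt]; exact slPoint_mem_tubeK hdet hω)
    (fun ω hω => by rw [← hpt]; exact tubeFun_slPoint hF hdet hω) j
  rw [mul_right_comm, ← key, mul_assoc, ← exp_add]
  have : 2 * Real.pi * I * (j * s) + j * Real.pi * Complex.I *
      (((γ 1 0 : ℤ) : ℂ) * form S z z / J) = 0 := by
    simp only [s]
    rw [show ((γ 1 0 : ℤ) : ℂ) * form S z z / (2 * J)
      = ((γ 1 0 : ℤ) : ℂ) * form S z z / J / 2 by rw [div_div, mul_comm 2 J]]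
    ring
  rw [this, exp_zero, mul_one]

end FourierJacobi

end

end OrthogonalModular

namespace OrthogonalModular

noncomputable section

open Complex Filter Topology

/-! ### The expansion of a modular form is a formal expansion. -/

section Expansion

variable {r : ℕ} {S : Matrix (Fin r) (Fin r) ℤ} {W : Subgroup (GL (Fin r) ℤ)} {k : ℤ}
  {F : affineCone S → ℂ}

/-- The exponent of a term of the Fourier expansion of a modular form. -/
def kExponent (p : ℕ × (ℕ × dualLattice S)) : KIndex r → ℤ :=
  kPoint (p.2.1 : ℤ) (dualVec p.2.2) (p.1 : ℤ)

theorem kPoint_injective {R : Type*} {τ τ' ω ω' : R} {z z' : Fin r → R}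
    (h : kPoint τ z ω = kPoint τ' z' ω') : τ = τ' ∧ z = z' ∧ ω = ω' :=
  ⟨congrFun h (Sum.inl 1), funext fun i => congrFun h (Sum.inr i), congrFun h (Sum.inl 0)⟩

theorem kExponent_injective (hS : IsEvenPosDef S) :
    Function.Injective (kExponent : ℕ × (ℕ × dualLattice S) → _) := by
  rintro ⟨m, n, l⟩ ⟨m', n', l'⟩ h
  obtain ⟨h1, h2, h3⟩ := kPoint_injective h
  exact Prod.ext (by exact_mod_cast h3)
    (Prod.ext (by exact_mod_cast h1) (dualVec_injective hS h2))

theorem fourierExp_kExponent (p : ℕ × (ℕ × dualLattice S)) (τ : ℂ) (z : Fin r → ℂ) (ω : ℂ) :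
    fourierExp (kExponent p) (kPoint τ z ω)
      = fourierExp (jIndex p.2) (jPoint τ z) * exp (2 * Real.pi * I * (p.1 * ω)) := by
  rw [jIndex, fourierExp_jPoint, ← exp_add]
  simp only [fourierExp, kExponent, kPoint, Fintype.sum_sum_type, Fin.sum_univ_two, Sum.elim_inl,
    Sum.elim_inr, Matrix.cons_val_zero, Matrix.cons_val_one, Int.cast_natCast]
  ring_nf

/-- Coefficients with n < 0 or m < 0 vanish by Koecher's principle, and `dualVec` identifies the
remaining exponents with triples (m, n, ℓ). -/
theorem hasSum_kExponent (hr : 0 < r) (hS : IsEvenPosDef S)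
    (hF : F ∈ modularForms S (Gam S W) k) {c : (KIndex r → ℤ) → ℂ}
    (hc : HasFourierCoeff (coneK S) (tubeFun S F) c) {Z : KIndex r → ℂ} (hZ : Z ∈ tubeK S) :
    HasSum (fun p => c (kExponent p) * fourierExp (kExponent (S := S) p) Z) (tubeFun S F Z) := by
  have hext : c = Function.extend (kExponent (S := S)) (fun p => c (kExponent p)) 0 := by
    funext N
    by_cases hN : ∃ p, kExponent (S := S) p = N
    · obtain ⟨p, rfl⟩ := hN
      rw [(kExponent_injective hS).extend_apply]
    · rw [Function.extend_apply' _ _ _ hN, Pi.zero_apply, ← kPoint_eta N]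
      rcases lt_or_ge (N (Sum.inl 1)) 0 with h1 | h1
      · exact coeff_eq_zero_of_neg_left hr hS hF hc h1
      rcases lt_or_ge (N (Sum.inl 0)) 0 with h0 | h0
      · exact coeff_eq_zero_of_neg_right hr hS hF hc h0
      obtain ⟨n, hn⟩ := Int.eq_ofNat_of_zero_le h1
      obtain ⟨m, hm⟩ := Int.eq_ofNat_of_zero_le h0
      obtain ⟨l, hl⟩ := dualVec_surjective hS fun i => N (Sum.inr i)
      refine absurd ⟨(m, n, l), ?_⟩ hN
      rw [← kPoint_eta N, hn, hm, ← hl, kExponent]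
  have := hc Z hZ
  rw [hext] at this
  exact (hasSum_extend_fourierExp (kExponent_injective hS)).mp this

/-- The Fourier-Jacobi coefficients with given Fourier coefficients. -/
def jacobiCoeff (S : Matrix (Fin r) (Fin r) ℤ) (c : (KIndex r → ℤ) → ℂ) (j : ℕ) : JFun r :=
  fun τ z => ∑' q : ℕ × dualLattice S, c (kExponent (j, q)) * fourierExp (jIndex q) (jPoint (τ : ℂ) z)

theorem summable_jacobiCoeff {c : (KIndex r → ℤ) → ℂ} (hc : ∀ Z ∈ tubeK S,
    HasSum (fun p => c (kExponent p) * fourierExp (kExponent (S := S) p) Z) (tubeFun S F Z))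
    (hS : IsEvenPosDef S) (j : ℕ) (τ : ℍ) (z : Fin r → ℂ) :
    Summable fun q : ℕ × dualLattice S =>
      c (kExponent (j, q)) * fourierExp (jIndex q) (jPoint (τ : ℂ) z) := by
  obtain ⟨y, -, hy⟩ := exists_kPoint_mem hS τ.im_pos z
  have hω : y < (I * (y + 1 : ℝ) : ℂ).im := by simp
  have h := (hc _ (hy _ hω)).summable.prod_factor j
  simp only [fourierExp_kExponent, ← mul_assoc] at h
  exact (summable_mul_right_iff (exp_ne_zero _)).mp h

theorem hasFourierExpansion_jacobiCoeff {c : (KIndex r → ℤ) → ℂ} (hc : ∀ Z ∈ tubeK S,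
    HasSum (fun p => c (kExponent p) * fourierExp (kExponent (S := S) p) Z) (tubeFun S F Z))
    (hS : IsEvenPosDef S) (j : ℕ) :
    HasFourierExpansion S (jacobiCoeff S c j) fun n l => c (kExponent (j, n, l)) :=
  hasFourierExpansion_iff.mpr fun τ z => (summable_jacobiCoeff hc hS j τ z).hasSum

theorem isFourierJacobiExpansion_jacobiCoeff {c : (KIndex r → ℤ) → ℂ} (hc : ∀ Z ∈ tubeK S,
    HasSum (fun p => c (kExponent p) * fourierExp (kExponent (S := S) p) Z) (tubeFun S F Z))
    (hS : IsEvenPosDef S) :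
    IsFourierJacobiExpansion S F (jacobiCoeff S c) := by
  rw [isFourierJacobiExpansion_iff hS]
  intro τ z ω hZ
  refine (hc _ hZ).prod_fiberwise fun j => ?_
  simp only [fourierExp_kExponent, ← mul_assoc]
  exact (summable_jacobiCoeff hc hS j τ z).hasSum.mul_right _

/-- The local majorant of the full Fourier series, summed over the exponents of fixed index j,
dominates the j-th Fourier–Jacobi term. -/
theorem summableLocallyUniformlyOn_jacobiCoeff {c : (KIndex r → ℤ) → ℂ} (hc : ∀ Z ∈ tubeK S,
    HasSum (fun p => c (kExponent p) * fourierExp (kExponent (S := S) p) Z) (tubeFun S F Z)) :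
    SummableLocallyUniformlyOn (fjTerm (jacobiCoeff S c)) (tubeDomain S) := by
  have hcont : Continuous fun Z : ℍ × (Fin r → ℂ) × ℍ =>
      kPoint (Z.1 : ℂ) Z.2.1 (Z.2.2 : ℂ) := by
    refine continuous_pi ?_
    rintro (i | i)
    · fin_cases i
      · exact UpperHalfPlane.continuous_coe.comp (continuous_snd.comp continuous_snd)
      · exact UpperHalfPlane.continuous_coe.comp continuous_fst
    · exact (continuous_apply i).comp (continuous_fst.comp continuous_snd)
  have hpre : tubeDomain S = (fun Z : ℍ × (Fin r → ℂ) × ℍ =>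
      kPoint (Z.1 : ℂ) Z.2.1 (Z.2.2 : ℂ)) ⁻¹' tubeK S :=
    Set.ext fun Z => mem_tubeDomain_iff Z
  refine SummableLocallyUniformlyOn_of_locally_bounded
    (hpre ▸ isOpen_tubeK.preimage hcont) fun K hK hKc => ?_
  refine hKc.induction_on (p := fun K => ∃ u : ℕ → ℝ, Summable u ∧ ∀ n, ∀ Z ∈ K,
    ‖fjTerm (jacobiCoeff S c) n Z‖ ≤ u n) ⟨0, summable_zero, by simp⟩
    (fun s t hst ⟨u, hu, h⟩ => ⟨u, hu, fun n Z hZ => h n Z (hst hZ)⟩) ?_ ?_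
  · rintro s t ⟨u, hu, h⟩ ⟨v, hv, h'⟩
    refine ⟨fun n => |u n| + |v n|, hu.abs.add hv.abs, ?_⟩
    rintro n Z (hZ | hZ)
    · exact (h n Z hZ).trans ((le_abs_self _).trans (le_add_of_nonneg_right (abs_nonneg _)))
    · exact (h' n Z hZ).trans ((le_abs_self _).trans (le_add_of_nonneg_left (abs_nonneg _)))
  · intro Z hZ
    have hZ' : kPoint (Z.1 : ℂ) Z.2.1 (Z.2.2 : ℂ) ∈ tubeK S := (mem_tubeDomain_iff Z).mp (hK hZ)
    obtain ⟨u, hu, ε, hε, hb⟩ := exists_summable_majorant (isOpen_tubeK (S := S))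
      (fun Z hZ => (hc Z hZ).summable) hZ'
    have hb' : ∀ p, ∀ Z' ∈ Metric.ball (kPoint (Z.1 : ℂ) Z.2.1 (Z.2.2 : ℂ)) ε,
        ‖c (kExponent p) * fourierExp (kExponent (S := S) p) Z'‖ ≤ u p := fun p Z' h =>
      (le_mul_of_one_le_right (norm_nonneg _)
        (le_add_of_nonneg_right (Finset.sum_nonneg fun _ _ => abs_nonneg _))).trans (hb p Z' h)
    refine ⟨_, mem_nhdsWithin_of_mem_nhds (hcont.continuousAt.preimage_mem_nhds
      (Metric.ball_mem_nhds _ hε)), fun j => ∑' q, u (j, q), hu.prod, fun j Z' h => ?_⟩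
    have hterm : fjTerm (jacobiCoeff S c) j Z' = ∑' q, c (kExponent (j, q))
        * fourierExp (kExponent (S := S) (j, q)) (kPoint (Z'.1 : ℂ) Z'.2.1 (Z'.2.2 : ℂ)) := by
      simp only [fourierExp_kExponent, ← mul_assoc, tsum_mul_right, fjTerm, jacobiCoeff]
    rw [hterm]
    exact tsum_of_norm_bounded (hu.prod_factor j).hasSum fun q => hb' (j, q) _ h

/-- The Fourier-Jacobi expansion of a modular form is a formal Fourier-Jacobi expansion, and it
converges locally uniformly. -/
theorem exists_isFourierJacobiExpansion (hr : 0 < r) (hS : IsEvenPosDef S)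
    (hW : W ≤ orthogonalGroup S) (hF : F ∈ modularForms S (Gam S W) k) :
    ∃ ψ ∈ formalExpansions S W k, IsFourierJacobiExpansion S F ψ ∧
      SummableLocallyUniformlyOn (fjTerm ψ) (tubeDomain S) := by
  obtain ⟨c, hc⟩ := exists_hasFourierCoeff hS hF
  have hc' := fun Z => hasSum_kExponent (Z := Z) hr hS hF hc
  have hFJ := isFourierJacobiExpansion_jacobiCoeff hc' hS
  have hf := hasFourierExpansion_jacobiCoeff hc' hS
  exact ⟨jacobiCoeff S c, ⟨fun j => ⟨⟨(hf j).holomorphic hS,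
    fun σ hσ τ z => hFJ.invariant hS hF hW hσ j τ z, fun x y τ z => hFJ.elliptic hS hF x y j τ z,
    fun γ τ z => hFJ.modular hS hF γ j τ z, _, hf j⟩, _, hf j,
    fun n l hl => coeff_eq_zero_of_disc hr hS hF hc hl⟩, _, hf,
    fun j n l => coeff_comm hS hF hc _ _ _⟩, hFJ, summableLocallyUniformlyOn_jacobiCoeff hc'⟩

end Expansion

end

end OrthogonalModular

namespace OrthogonalModular

noncomputable section

open Complex Filter Topology

/-! ### Lattice invariance of the coefficients of Jacobi forms. -/

section EllipticCoefficients

variable {r : ℕ} {S : Matrix (Fin r) (Fin r) ℤ} {W : Subgroup (GL (Fin r) ℤ)} {k : ℤ} {t : ℕ}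
  {φ : JFun r}

/-- The Fourier coefficients of a Jacobi form are invariant under the lattice. -/
theorem IsWeakJacobiForm.coeff_translate (h : IsWeakJacobiForm S W k t φ)
    {c : (Unit ⊕ Fin r → ℤ) → ℂ} (hc : HasFourierCoeff (halfSpace r) (jFun φ) c)
    {x : Fin r → ℤ} {q : ℤ} (hq : form S x x = 2 * q) (n : ℤ) (v : Fin r → ℤ) :
    c (jPoint (n + v ⬝ᵥ x + t * q) (v + (t : ℤ) • (x ᵥ* S))) = c (jPoint n v) := by
  set T : (Unit ⊕ Fin r → ℤ) → Unit ⊕ Fin r → ℤ := fun N =>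
    jPoint (N (Sum.inl ()) + (fun i => N (Sum.inr i)) ⬝ᵥ x + t * q)
      ((fun i => N (Sum.inr i)) + (t : ℤ) • (x ᵥ* S))
  have hT : Function.Injective T := by
    intro N N' hN
    obtain ⟨h1, h2⟩ := jPoint_injective hN
    have h3 := add_right_cancel h2
    rw [h3] at h1
    rw [← jPoint_eta N, ← jPoint_eta N', h3]
    congr 1
    linarith
  -- Moving the elliptic factor to the other side turns the term of exponent N at z + xτ into the
  -- term of exponent T N at z.
  have hTexp : ∀ N (τ : ℍ) (z : Fin r → ℂ),
      fourierExp N (jPoint (τ : ℂ) (z + (τ : ℂ) • castVec ℂ x)) * exp (t * Real.pi * I *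
        (form S (castVec ℂ x) (castVec ℂ x) * (τ : ℂ) + 2 * form S (castVec ℂ x) z))
      = fourierExp (T N) (jPoint (τ : ℂ) z) := by
    intro N τ z
    nth_rewrite 1 [← jPoint_eta N]
    simp only [T]
    rw [fourierExp_jPoint, fourierExp_jPoint, ← exp_add]
    congr 1
    simp only [Pi.add_apply, Pi.smul_apply, smul_eq_mul, Int.cast_add, Int.cast_mul,
      Int.cast_natCast, add_mul, mul_add, Finset.sum_add_distrib, form_castVec, hq, mul_assoc]
    rw [← Finset.mul_sum, sum_vecMul_mul]
    simp only [dotProduct, castVec, Int.cast_sum, Int.cast_mul, Int.cast_ofNat, Finset.sum_mul,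
      mul_assoc]
    have : ∀ i, ((N (Sum.inr i) : ℤ) : ℂ) * ((τ : ℂ) * (x i : ℂ))
      = (N (Sum.inr i) : ℂ) * ((x i : ℂ) * (τ : ℂ)) := fun i => by ring
    simp only [this]
    ring
  have key : HasFourierCoeff (halfSpace r) (jFun φ) (Function.extend T c 0) := by
    rw [hasFourierCoeff_jFun_iff]
    intro τ z
    rw [hasSum_extend_fourierExp hT]
    have h1 := h.elliptic x 0 τ z
    have h0 : castVec ℂ (0 : Fin r → ℤ) = 0 := by funext i; simp [castVec]
    rw [h0, add_zero] at h1
    have h2 := (hasFourierCoeff_jFun_iff.mp hc τ (z + (τ : ℂ) • castVec ℂ x)).mul_right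
      (exp (t * Real.pi * I *
        (form S (castVec ℂ x) (castVec ℂ x) * (τ : ℂ) + 2 * form S (castVec ℂ x) z)))
    rw [h1, mul_right_comm _ (φ τ z), ← exp_add, neg_add_cancel, exp_zero, one_mul] at h2
    exact h2.congr_fun fun N => by rw [mul_assoc, hTexp]
  have := hc.unique key halfSpace_nonempty
  have h3 : T (jPoint n v) = jPoint (n + v ⬝ᵥ x + t * q) (v + (t : ℤ) • (x ᵥ* S)) := rfl
  rw [← h3]
  nth_rewrite 1 [this]
  rw [hT.extend_apply]

end EllipticCoefficients

/-! ### Bounds on compact sets. -/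

section Boundedness

variable {ι P : Type*} [Fintype ι] {a : P → ℂ} {ν : P → ι → ℤ} {D K : Set (ι → ℂ)}

/-- An absolutely convergent exponential series is bounded on compact sets. -/
theorem exists_tsum_norm_fourierExp_le (hD : IsOpen D)
    (h : ∀ Z ∈ D, Summable fun p => a p * fourierExp (ν p) Z) (hK : IsCompact K) (hKD : K ⊆ D) :
    ∃ C : ℝ, ∀ Z ∈ K, ∑' p, ‖a p * fourierExp (ν p) Z‖ ≤ C := by
  refine hK.induction_on (p := fun K => ∃ C : ℝ, ∀ Z ∈ K, ∑' p, ‖a p * fourierExp (ν p) Z‖ ≤ C)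
    ⟨0, by simp⟩ (fun s s' hs ⟨C, hC⟩ => ⟨C, fun Z hZ => hC Z (hs hZ)⟩) ?_ fun Z hZ => ?_
  · rintro s s' ⟨C, hC⟩ ⟨C', hC'⟩
    exact ⟨max C C', fun Z hZ => hZ.elim (fun h => (hC Z h).trans (le_max_left _ _))
      fun h => (hC' Z h).trans (le_max_right _ _)⟩
  · obtain ⟨u, hu, ε, hε, hb⟩ := exists_summable_majorant hD h (hKD hZ)
    refine ⟨_, mem_nhdsWithin_of_mem_nhds (Metric.ball_mem_nhds _ hε), ∑' p, u p,
      fun Z' hZ' => ?_⟩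
    have hle : ∀ p, ‖a p * fourierExp (ν p) Z'‖ ≤ u p := fun p =>
      (le_mul_of_one_le_right (norm_nonneg _)
        (le_add_of_nonneg_right (Finset.sum_nonneg fun _ _ => abs_nonneg _))).trans (hb p Z' hZ')
    exact (Summable.of_nonneg_of_le (fun _ => norm_nonneg _) hle hu).tsum_le_tsum hle hu

end Boundedness

/-! ### Vanishing in nonpositive weight and positive index. -/

section Vanishing

variable {r : ℕ} {S : Matrix (Fin r) (Fin r) ℤ} {W : Subgroup (GL (Fin r) ℤ)} {k : ℤ} {t : ℕ}
  {φ : JFun r}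

/-- Completing the square: 2t times the expression is (2nt - (ℓ, ℓ)) + (ℓ + ty, ℓ + ty). -/
theorem discriminant_exponent_nonneg (hS : IsEvenPosDef S) (ht : 0 < t) {n : ℕ}
    {l : dualLattice S} (h : 0 ≤ 2 * (n : ℚ) * t - form S (l : Fin r → ℚ) l) (y : Fin r → ℝ) :
    0 ≤ (n : ℝ) + ∑ j, (dualVec l j : ℝ) * y j + t * form S y y / 2 := by
  set l' : Fin r → ℝ := fun i => ((l : Fin r → ℚ) i : ℝ)
  have h1 : (0 : ℝ) ≤ 2 * n * t - form S l' l' := by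
    have h2 := form_map (S := S) (Rat.castHom ℝ) (l : Fin r → ℚ) l
    simp only [Rat.coe_castHom] at h2
    rw [show form S l' l' = _ from h2]
    exact_mod_cast h
  have h2 := hS.form_nonneg (l' + (t : ℝ) • y)
  rw [form_add_left, form_add_right, form_add_right, form_smul_left, form_smul_right,
    form_smul_left, form_smul_right, form_comm hS.isSymm y l'] at h2
  rw [sum_dualVec_mul]
  have ht' : (0 : ℝ) < t := by exact_mod_cast ht
  have h3 : 0 ≤ (2 * t : ℝ) * ((n : ℝ) + form S l' y + t * form S y y / 2) := by nlinarith
  exact nonneg_of_mul_nonneg_right h3 (by positivity)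

/-- The Gaussian weight exp(-πt (Im z, Im z) / Im τ) cancels the absolute value of the elliptic
factor. -/
theorem IsWeakJacobiForm.norm_translate (h : IsWeakJacobiForm S W k t φ) (hS : IsEvenPosDef S)
    (x : Fin r → ℤ) (τ : ℍ) (z : Fin r → ℂ) :
    ‖φ τ (z + (τ : ℂ) • castVec ℂ x)‖ * Real.exp (-(Real.pi * t *
      form S (fun i => ((z + (τ : ℂ) • castVec ℂ x) i).im)
        (fun i => ((z + (τ : ℂ) • castVec ℂ x) i).im) / τ.im))
      = ‖φ τ z‖ * Real.exp (-(Real.pi * t *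
        form S (fun i => (z i).im) (fun i => (z i).im) / τ.im)) := by
  have h1 := h.elliptic x 0 τ z
  have h0 : castVec ℂ (0 : Fin r → ℤ) = 0 := by funext i; simp [castVec]
  rw [h0, add_zero] at h1
  have him : (fun i => ((z + (τ : ℂ) • castVec ℂ x) i).im)
      = (fun i => (z i).im) + τ.im • castVec ℝ x := by
    funext i
    simp [castVec]
  have hx : form S (castVec ℂ x) (castVec ℂ x) = ((form S (castVec ℝ x) (castVec ℝ x) : ℝ) : ℂ) := by
    rw [form_castVec, form_castVec]
    simp
  have hxz : (form S (castVec ℂ x) z).im = form S (castVec ℝ x) fun i => (z i).im := by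
    simp [form_eq_sum, castVec, Complex.im_sum, Complex.mul_im]
  have hre : (-(t * Real.pi * I * (form S (castVec ℂ x) (castVec ℂ x) * (τ : ℂ)
      + 2 * form S (castVec ℂ x) z)) : ℂ).re
      = Real.pi * t * (form S (castVec ℝ x) (castVec ℝ x) * τ.im
        + 2 * form S (castVec ℝ x) fun i => (z i).im) := by
    rw [hx, ← hxz, show (-(t * Real.pi * I * (((form S (castVec ℝ x) (castVec ℝ x) : ℝ) : ℂ)
      * (τ : ℂ) + 2 * form S (castVec ℂ x) z)) : ℂ) = ((-(t * Real.pi) : ℝ) : ℂ)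
        * (I * (((form S (castVec ℝ x) (castVec ℝ x) : ℝ) : ℂ) * (τ : ℂ)
          + (2 : ℝ) * form S (castVec ℂ x) z)) by push_cast; ring, re_ofReal_mul, I_mul_re, add_im,
      im_ofReal_mul, im_ofReal_mul, UpperHalfPlane.coe_im]
    ring
  rw [h1, norm_mul, norm_exp, hre, him, form_add_left, form_add_right, form_add_right,
    form_smul_left, form_smul_right, form_smul_left, form_smul_right,
    form_comm hS.isSymm (fun i => (z i).im) (castVec ℝ x), mul_right_comm, ← Real.exp_add,
    mul_comm]
  congr 2
  have := τ.im_pos.ne'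
  field_simp
  ring

/-- By `norm_translate`, y = Im z / Im τ may be taken in the unit cube. A weighted term then has
size |f(n, ℓ)| exp(-2πv (n + (ℓ, y) + t (y, y) / 2)) with v = Im τ. The bracket is nonnegative when
f(n, ℓ) ≠ 0, so the size is at most that at v = 1/2, where the weight is dropped and compactness
gives the bound. -/
theorem IsHolomorphicJacobiForm.exists_bound (h : IsHolomorphicJacobiForm S W k t φ)
    (hS : IsEvenPosDef S) (ht : 0 < t) : ∃ C : ℝ, ∀ (τ : ℍ) (z : Fin r → ℂ), 1 / 2 ≤ τ.im →
      ‖φ τ z‖ * Real.exp (-(Real.pi * t *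
        form S (fun i => (z i).im) (fun i => (z i).im) / τ.im)) ≤ C := by
  obtain ⟨f, hf, hf0⟩ := h.2
  rw [hasFourierExpansion_iff] at hf
  set E : (Fin r → ℝ) → Unit ⊕ Fin r → ℂ := fun y => jPoint (I / 2) fun i => I / 2 * (y i : ℂ)
  have hE : Continuous E := by
    refine continuous_pi ?_
    rintro (i | i)
    · exact continuous_const
    · simp only [E, jPoint, Sum.elim_inr]
      fun_prop
  obtain ⟨C, hC⟩ := exists_tsum_norm_fourierExp_le (a := fun p : ℕ × dualLattice S => f p.1 p.2)
    (ν := jIndex) (isOpen_tubeOver isOpen_halfSpace) (fun Z hZ => by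
      obtain ⟨τ, z, rfl⟩ := exists_jPoint hZ
      exact (hf τ z).summable)
    ((isCompact_Icc (a := (0 : Fin r → ℝ)) (b := 1)).image hE) (by
      rintro _ ⟨y, -, rfl⟩
      simp [E, tubeOver, halfSpace, jPoint])
  refine ⟨C, fun τ z hτ => ?_⟩
  have hv := τ.im_pos
  set x : Fin r → ℤ := fun i => ⌊(z i).im / τ.im⌋
  set z' : Fin r → ℂ := z - (τ : ℂ) • castVec ℂ x
  have hz : z = z' + (τ : ℂ) • castVec ℂ x := by simp [z']
  set y : Fin r → ℝ := fun i => Int.fract ((z i).im / τ.im)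
  have hy : ∀ i, (z' i).im = τ.im * y i := fun i => by
    have : (z' i).im = (z i).im - τ.im * x i := by simp [z', castVec]
    rw [this]
    simp only [y, Int.fract, x]
    field_simp
  rw [hz, h.1.norm_translate hS]
  have hsum := (hf τ z').summable.norm
  have hform : form S (fun i => (z' i).im) (fun i => (z' i).im) / τ.im = τ.im * form S y y := by
    rw [show (fun i => (z' i).im) = τ.im • y from funext hy, form_smul_left, form_smul_right]
    field_simp
  have hmem : E y ∈ E '' Set.Icc 0 1 := ⟨y, ⟨fun i => Int.fract_nonneg _,
    fun i => (Int.fract_lt_one _).le⟩, rfl⟩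
  have hEsum : Summable fun p : ℕ × dualLattice S => ‖f p.1 p.2 * fourierExp (jIndex p) (E y)‖ := by
    have := (hf ⟨I / 2, by simp⟩ fun i => I / 2 * (y i : ℂ)).summable.norm
    exact this
  refine le_trans ?_ (hC _ hmem)
  calc ‖φ τ z'‖ * Real.exp (-(Real.pi * t *
        form S (fun i => (z' i).im) (fun i => (z' i).im) / τ.im))
      ≤ (∑' p : ℕ × dualLattice S, ‖f p.1 p.2 * fourierExp (jIndex p) (jPoint (τ : ℂ) z')‖)
        * Real.exp (-(Real.pi * t * (τ.im * form S y y))) := by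
        rw [mul_div_assoc, hform]
        gcongr
        rw [← (hf τ z').tsum_eq]
        exact norm_tsum_le_tsum_norm hsum
    _ ≤ _ := by
        rw [← tsum_mul_right]
        refine (hsum.mul_right _).tsum_le_tsum (fun p => ?_) hEsum
        rw [norm_mul, norm_mul, mul_assoc]
        by_cases hp : f p.1 p.2 = 0
        · simp [hp]
        have hD : 0 ≤ 2 * (p.1 : ℚ) * t - form S (p.2 : Fin r → ℚ) p.2 := by
          by_contra hlt
          exact hp (hf0 _ _ (not_le.mp hlt))
        have hpos := discriminant_exponent_nonneg hS ht hD y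
        refine mul_le_mul_of_nonneg_left ?_ (norm_nonneg _)
        rw [norm_fourierExp, norm_fourierExp, ← Real.exp_add, Real.exp_le_exp]
        simp only [jIndex, jPoint, E, Fintype.sum_sum_type, Sum.elim_inl, Sum.elim_inr,
          Finset.univ_unique, Finset.sum_singleton, hy, UpperHalfPlane.coe_im]
        have e1 : ∀ i, (I / 2 * (y i : ℂ)).im = y i / 2 := fun i => by
          simp [Complex.mul_im]; ring
        have e2 : (I / 2 : ℂ).im = 1 / 2 := by simp
        have e3 : ∑ i, (dualVec p.2 i : ℝ) * (τ.im * y i)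
            = τ.im * ∑ i, (dualVec p.2 i : ℝ) * y i := by
          rw [Finset.mul_sum]; exact Finset.sum_congr rfl fun i _ => by ring
        have e4 : ∑ i, (dualVec p.2 i : ℝ) * (y i / 2)
            = (∑ i, (dualVec p.2 i : ℝ) * y i) / 2 := by
          rw [Finset.sum_div]; exact Finset.sum_congr rfl fun i _ => by ring
        simp only [e1, e2, e3, e4, Int.cast_natCast]
        set s := ∑ i, (dualVec p.2 i : ℝ) * y i
        have hq : 0 ≤ (t : ℝ) * form S y y := mul_nonneg (Nat.cast_nonneg t) (hS.form_nonneg y)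
        have hkey : 0 ≤ (τ.im - 1 / 2) * ((p.1 : ℝ) + s + t * form S y y / 2) :=
          mul_nonneg (by linarith) hpos
        have : 0 ≤ 2 * Real.pi * ((τ.im - 1 / 2) * ((p.1 : ℝ) + s + t * form S y y / 2)
            + t * form S y y / 4) := by positivity
        linarith

/-- Some γ moves τ to imaginary part at least 1/2 with |cτ + d| ≤ 1. For real z the exponential in
the modular law cancels the Gaussian weight exactly, and |cτ + d|^k ≥ 1 because k ≤ 0. -/
theorem IsHolomorphicJacobiForm.exists_bound_real (h : IsHolomorphicJacobiForm S W k t φ)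
    (hS : IsEvenPosDef S) (ht : 0 < t) (hk : k ≤ 0) :
    ∃ C : ℝ, ∀ (τ : ℍ) (x : Fin r → ℝ), ‖φ τ fun i => (x i : ℂ)‖ ≤ C := by
  obtain ⟨C, hC⟩ := h.exists_bound hS ht
  refine ⟨C, fun τ x => ?_⟩
  obtain ⟨γ, h1, h2⟩ := ModularGroup.exists_one_half_le_im_smul_and_norm_denom_le τ
  set J : ℂ := ((γ 1 0 : ℤ) : ℂ) * τ + ((γ 1 1 : ℤ) : ℂ)
  have hJ : UpperHalfPlane.denom γ τ = J := by
    simp [UpperHalfPlane.denom, J]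
  have hJ0 : J ≠ 0 := hJ ▸ UpperHalfPlane.denom_ne_zero _ _
  have him : (γ • τ).im = τ.im / normSq J := by
    rw [ModularGroup.im_smul_eq_div_normSq, hJ]
  have hN : 0 < normSq J := normSq_pos.mpr hJ0
  set z : Fin r → ℂ := fun i => (x i : ℂ)
  have key := hC (γ • τ) (J⁻¹ • z) h1
  have hmod := h.1.modular γ τ z
  change φ (γ • τ) (J⁻¹ • z) = J ^ k * exp (t * Real.pi * I *
    (((γ 1 0 : ℤ) : ℂ) * form S z z / J)) * φ τ z at hmod
  have hzz : form S z z = ((form S x x : ℝ) : ℂ) := form_map Complex.ofRealHom x x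
  have hJim : J.im = (γ 1 0 : ℤ) * τ.im := by simp [J]
  have hz' : (fun i => ((J⁻¹ • z) i).im) = (-((γ 1 0 : ℤ) * τ.im) / normSq J) • x := by
    funext i
    simp [z, Complex.mul_im, Complex.inv_im, hJim]
  have hre : (t * Real.pi * I * (((γ 1 0 : ℤ) : ℂ) * form S z z / J) : ℂ).re
      = Real.pi * t * ((γ 1 0 : ℤ) ^ 2 * τ.im * form S x x / normSq J) := by
    rw [hzz, show (t * Real.pi * I * (((γ 1 0 : ℤ) : ℂ) * ((form S x x : ℝ) : ℂ) / J) : ℂ)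
      = ((t * Real.pi * ((γ 1 0 : ℤ) * form S x x) : ℝ) : ℂ) * (I * J⁻¹) by push_cast; ring,
      re_ofReal_mul, I_mul_re, Complex.inv_im, hJim]
    ring
  rw [hmod, hz', norm_mul, norm_mul, norm_exp, hre, form_smul_left, form_smul_right, him,
    mul_right_comm _ ‖φ τ z‖ _, mul_assoc ‖J ^ k‖ (Real.exp _) (Real.exp _),
    ← Real.exp_add] at key
  have hzero : Real.pi * t * ((γ 1 0 : ℤ) ^ 2 * τ.im * form S x x / normSq J)
      + -(Real.pi * t * (-((γ 1 0 : ℤ) * τ.im) / normSq J * (-((γ 1 0 : ℤ) * τ.im) / normSq J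
        * form S x x)) / (τ.im / normSq J)) = 0 := by
    have := τ.im_pos.ne'
    field_simp
    ring
  rw [hzero, Real.exp_zero, mul_one] at key
  refine le_trans (le_mul_of_one_le_left (norm_nonneg _) ?_) key
  rw [norm_zpow]
  refine one_le_zpow_of_nonpos₀ (norm_pos_iff.mpr hJ0) (hJ ▸ h2) hk

/-- Holomorphic Jacobi forms of positive index and nonpositive weight vanish. -/
theorem IsHolomorphicJacobiForm.eq_zero (h : IsHolomorphicJacobiForm S W k t φ) (hr : 0 < r)
    (hS : IsEvenPosDef S) (ht : 0 < t) (hk : k ≤ 0) : φ = 0 := by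
  obtain ⟨C, hC⟩ := h.exists_bound_real hS ht hk
  obtain ⟨f, hf⟩ := h.1.fourier
  set c := extendCoeff f
  have hc : HasFourierCoeff (halfSpace r) (jFun φ) c := (hasFourierExpansion_iff_coeff hS).mp hf
  -- Bessel's inequality holds on the slice Im τ = y, z real, with a bound independent of y; as y →
  -- 0 the exponentials tend to 1.
  have hbessel : ∀ T : Finset (Unit ⊕ Fin r → ℤ), ∑ N ∈ T, ‖c N‖ ^ 2 ≤ C ^ 2 := by
    intro T
    set Z : ℝ → Unit ⊕ Fin r → ℂ := fun y => jPoint (I * y) 0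
    have hb : ∀ y : ℝ, 0 < y → ∑ N ∈ T, ‖c N * fourierExp N (Z y)‖ ^ 2 ≤ C ^ 2 := by
      intro y hy
      have hX : ∀ X : Unit ⊕ Fin r → ℝ, ∃ τ : ℍ, realAdd X (Z y)
          = jPoint (τ : ℂ) fun i => (X (Sum.inr i) : ℂ) := fun X =>
        ⟨⟨X (Sum.inl ()) + I * y, by simpa using hy⟩, by
          funext i
          rcases i with i | i <;> simp [realAdd, Z, jPoint]⟩
      refine sum_norm_coeff_sq_le (f := jFun φ) (Z y) (fun X => ?_) (fun X => ?_) T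
      · obtain ⟨τ, hτ⟩ := hX X
        rw [hτ]
        exact hc _ (jPoint_mem _ _)
      · obtain ⟨τ, hτ⟩ := hX X
        rw [hτ, jFun_jPoint]
        exact hC τ _
    have hcont : Continuous fun y : ℝ => ∑ N ∈ T, ‖c N * fourierExp N (Z y)‖ ^ 2 := by
      simp only [fourierExp, Z, jPoint, Fintype.sum_sum_type, Sum.elim_inl, Sum.elim_inr]
      fun_prop
    have hlim : Tendsto (fun y : ℝ => ∑ N ∈ T, ‖c N * fourierExp N (Z y)‖ ^ 2) (𝓝[>] 0)
        (𝓝 (∑ N ∈ T, ‖c N * fourierExp N (Z 0)‖ ^ 2)) :=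
      (hcont.tendsto 0).mono_left nhdsWithin_le_nhds
    have hle := le_of_tendsto hlim (eventually_nhdsWithin_of_forall fun y hy => hb y hy)
    have hZ0 : ∀ N, fourierExp N (Z 0) = 1 := fun N => by
      have : Z 0 = 0 := by
        funext i
        rcases i with i | i <;> simp [Z, jPoint]
      simp [this, fourierExp]
    simpa [hZ0] using hle
  -- Translating by multiples of a basis vector repeats each coefficient at infinitely many
  -- exponents, so a nonzero one would violate the bound on finite sums.
  have hc0 : ∀ n v, c (jPoint n v) = 0 := by
    intro n v
    set b : Fin r → ℤ := Pi.single ⟨0, hr⟩ 1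
    have hb0 : b ≠ 0 := by simp [b]
    have hbb : 0 < form S b b := by
      have h1 : castVec ℝ b ≠ 0 := fun h0 => hb0 (funext fun i => by
        have := congrFun h0 i
        simpa [castVec] using this)
      have h2 := hS.form_pos h1
      rw [form_castVec] at h2
      exact_mod_cast h2
    have hbS : (b ᵥ* S) ⬝ᵥ b = form S b b := by
      have h1 := sum_vecMul_mul S b b
      have h2 : castVec ℤ b = b := by funext i; simp [castVec]
      rw [h2] at h1
      simpa [dotProduct] using h1
    have horb : ∀ j : ℕ, ∃ n', c (jPoint n' (v + ((t : ℤ) * j) • (b ᵥ* S))) = c (jPoint n v) := by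
      intro j
      obtain ⟨q, hq⟩ := hS.even ((j : ℤ) • b)
      have := h.1.coeff_translate hc (hq.trans (two_mul q).symm) n v
      rw [Matrix.smul_vecMul, smul_smul] at this
      exact ⟨_, this⟩
    choose n' hn' using horb
    have hinj : Function.Injective fun j : ℕ => jPoint (n' j) (v + ((t : ℤ) * j) • (b ᵥ* S)) := by
      intro j j' hj
      have h1 := add_left_cancel (jPoint_injective hj).2
      have h2 := congrArg (fun w => w ⬝ᵥ b) h1
      simp only [smul_dotProduct, hbS, smul_eq_mul] at h2
      have h3 := mul_left_cancel₀ (by exact_mod_cast ht.ne' : (t : ℤ) ≠ 0)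
        (mul_right_cancel₀ hbb.ne' h2)
      exact_mod_cast h3
    by_contra hne
    have hpos : 0 < ‖c (jPoint n v)‖ ^ 2 := by positivity
    obtain ⟨M, hM⟩ := exists_nat_gt (C ^ 2 / ‖c (jPoint n v)‖ ^ 2)
    rw [div_lt_iff₀ hpos] at hM
    have := hbessel ((Finset.range M).map ⟨_, hinj⟩)
    simp only [Finset.sum_map, Function.Embedding.coeFn_mk, hn', Finset.sum_const,
      Finset.card_range, nsmul_eq_mul] at this
    linarith
  funext τ z
  have h1 := hasFourierCoeff_jFun_iff.mp hc τ z
  have h2 : ∀ N, c N = 0 := fun N => jPoint_eta N ▸ hc0 _ _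
  simp only [h2, zero_mul] at h1
  exact h1.unique hasSum_zero

end Vanishing

end

end OrthogonalModular

namespace OrthogonalModular

noncomputable section

open Complex Filter Topology

/-! ### Index zero: Jacobi forms are modular forms. -/

section IndexZero

/-- The slash action of the whole of SL(2, ℤ) fixes g, so boundedness at infinity gives boundedness
at every cusp. -/
theorem exists_modularForm {k : ℤ} {g : ℍ → ℂ}
    (hg : DifferentiableOn ℂ (fun w : ℂ => g (UpperHalfPlane.ofComplex w)) {w | 0 < w.im})
    (hmod : ∀ (γ : SL(2, ℤ)) (τ : ℍ),
      g (γ • τ) = (((γ 1 0 : ℤ) : ℂ) * τ + ((γ 1 1 : ℤ) : ℂ)) ^ k * g τ)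
    (hb : UpperHalfPlane.IsBoundedAtImInfty g) : ∃ G : ModularForm 𝒮ℒ k, g = G := by
  have hslash : ∀ γ : SL(2, ℤ), SlashAction.map k γ g = g := fun γ => by
    funext τ
    have hJ : UpperHalfPlane.denom γ τ = ((γ 1 0 : ℤ) : ℂ) * τ + ((γ 1 1 : ℤ) : ℂ) := by
      simp [UpperHalfPlane.denom]
    rw [ModularForm.SL_slash_apply, hmod, ← hJ, mul_right_comm,
      ← zpow_add₀ (UpperHalfPlane.denom_ne_zero _ _), add_neg_cancel, zpow_zero, one_mul]
  refine ⟨{ toFun := g, slash_action_eq' := ?_, holo' := ?_, bdd_at_cusps' := ?_ }, rfl⟩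
  · rintro _ ⟨γ, rfl⟩
    exact hslash γ
  · rw [UpperHalfPlane.mdifferentiable_iff]
    exact hg
  · intro c hc
    rw [Subgroup.IsArithmetic.isCusp_iff_isCusp_SL2Z] at hc
    rw [OnePoint.isBoundedAt_iff_forall_SL2Z hc]
    intro γ _
    exact (hslash γ).symm ▸ hb

variable {r : ℕ} {S : Matrix (Fin r) (Fin r) ℤ} {W : Subgroup (GL (Fin r) ℤ)} {k : ℤ} {t : ℕ}
  {φ : JFun r}

/-- For index zero a lattice translation fixes ℓ and moves n by (ℓ, x). If ℓ ≠ 0 this reaches a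
negative n. -/
theorem IsWeakJacobiForm.coeff_eq_zero_of_index_zero (h : IsWeakJacobiForm S W k 0 φ)
    (hS : IsEvenPosDef S) {f : ℕ → dualLattice S → ℂ} (hf : HasFourierExpansion S φ f) (n : ℕ)
    {l : dualLattice S} (hl : dualVec l ≠ 0) : f n l = 0 := by
  set c := extendCoeff f
  have hc : HasFourierCoeff (halfSpace r) (jFun φ) c := (hasFourierExpansion_iff_coeff hS).mp hf
  obtain ⟨i, hi⟩ := Function.ne_iff.mp hl
  -- This choice gives n + (ℓ, x) = n - (n + 1) v_i² < 0, where v_i ≠ 0 is the i-th entry of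
  -- `dualVec l`.
  set x : Fin r → ℤ := Pi.single i (-(n + 1 : ℤ) * dualVec l i)
  obtain ⟨q, hq⟩ := hS.even x
  have h1 := h.coeff_translate hc (hq.trans (two_mul q).symm) n (dualVec l)
  have h2 : c (jPoint (n : ℤ) (dualVec l)) = f n l := extendCoeff_jIndex hS f (n, l)
  have h0 : 0 < dualVec l i * dualVec l i := mul_self_pos.mpr hi
  have hx : dualVec l ⬝ᵥ x = -(n + 1 : ℤ) * (dualVec l i * dualVec l i) := by
    simp only [x, dotProduct_single]
    ring
  rw [← h2, ← h1]
  refine extendCoeff_of_neg f ?_ _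
  rw [hx]
  push_cast
  nlinarith

/-- Weak Jacobi forms of index zero are modular forms. -/
theorem IsWeakJacobiForm.exists_modularForm (h : IsWeakJacobiForm S W k 0 φ)
    (hS : IsEvenPosDef S) : ∃ G : ModularForm 𝒮ℒ k, ∀ τ z, φ τ z = G τ := by
  obtain ⟨f, hf⟩ := h.fourier
  have hf0 := fun n l => h.coeff_eq_zero_of_index_zero hS hf n (l := l)
  have hsum := hasFourierExpansion_iff.mp hf
  -- Only ℓ = 0 survives: the terms do not involve z, and their sizes decrease in Im τ, so the value
  -- at i bounds the series for Im τ ≥ 1.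
  have hexp : ∀ (p : ℕ × dualLattice S) (τ τ' : ℂ) (z z' : Fin r → ℂ),
      ‖f p.1 p.2 * fourierExp (jIndex p) (jPoint τ z)‖
        = ‖f p.1 p.2‖ * Real.exp (-(2 * Real.pi * (p.1 * τ.im))) ∧
      (τ = τ' → f p.1 p.2 * fourierExp (jIndex p) (jPoint τ z)
        = f p.1 p.2 * fourierExp (jIndex p) (jPoint τ' z')) := by
    intro p τ τ' z z'
    by_cases hl : dualVec p.2 = 0
    · refine ⟨?_, ?_⟩
      · rw [norm_mul, norm_fourierExp]
        simp [jIndex, jPoint, Fintype.sum_sum_type, hl]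
      · rintro rfl
        rw [jIndex, fourierExp_jPoint, fourierExp_jPoint]
        simp [hl]
    · simp [hf0 _ _ hl]
  have hconst : ∀ τ z, φ τ z = φ τ 0 := fun τ z =>
    (hsum τ z).unique ((hsum τ 0).congr_fun fun p => (hexp p τ τ z 0).2 rfl)
  obtain ⟨G, hG⟩ := OrthogonalModular.exists_modularForm (k := k) (g := fun τ => φ τ 0) (by
      have := h.holomorphic
      exact this.comp (f := fun w : ℂ => (w, (0 : Fin r → ℂ))) (by fun_prop) fun w hw => hw)
    (fun γ τ => by
      have := h.modular γ τ 0
      rw [smul_zero] at this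
      rw [this]
      simp) (by
      rw [UpperHalfPlane.isBoundedAtImInfty_iff]
      refine ⟨∑' p : ℕ × dualLattice S,
        ‖f p.1 p.2 * fourierExp (jIndex p) (jPoint ((UpperHalfPlane.I : ℍ) : ℂ) 0)‖, 1,
        fun τ hτ => ?_⟩
      refine (tsum_of_norm_bounded (hsum UpperHalfPlane.I 0).summable.norm.hasSum
        fun p => ?_).trans' (by rw [← (hsum τ 0).tsum_eq])
      rw [(hexp p _ τ 0 0).1, (hexp p _ τ 0 0).1]
      gcongr
      simpa using hτ)
  exact ⟨G, fun τ z => (hconst τ z).trans (congrFun hG τ)⟩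

end IndexZero

/-! ### Indices and weights of the generators. -/

section Generators

variable {r : ℕ} {S : Matrix (Fin r) (Fin r) ℤ} {W : Subgroup (GL (Fin r) ℤ)}
  {κ : Fin (r + 1) → ℤ} {m : Fin (r + 1) → ℕ} {φ : Fin (r + 1) → JFun r}

/-- A generator is represented only by itself. -/
theorem FreelyGenerate.eq_single (h : FreelyGenerate S W κ m φ) (i : Fin (r + 1))
    {c : (Fin (r + 1) → ℕ) →₀ (ℍ → ℂ)}
    (h1 : ∀ a, ∃ g : ModularForm 𝒮ℒ (-κ i + ∑ j, (a j : ℤ) * κ j), c a = g)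
    (h2 : ∀ a ∈ c.support, ∑ j, a j * m j = m i)
    (h3 : ∀ τ z, φ i τ z = ∑ a ∈ c.support, c a τ * ∏ j, φ j τ z ^ a j) :
    c = Finsupp.single (Pi.single i 1) 1 := by
  have hP : ∀ x : Fin (r + 1) → ℤ, ∑ j, ((Pi.single i 1 : Fin (r + 1) → ℕ) j : ℤ) * x j = x i :=
    fun x => by simp [Pi.single_apply]
  refine (h.existsUnique _ _ _ (h.isWeak i)).unique ⟨h1, h2, h3⟩ ⟨fun a => ?_, fun a ha => ?_,
    fun τ z => ?_⟩
  · by_cases ha : a = Pi.single i 1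
    · subst ha
      refine ⟨ModularForm.mcast (by rw [hP]; ring) (1 : ModularForm 𝒮ℒ 0), ?_⟩
      rw [Finsupp.single_eq_same]
      rfl
    · refine ⟨0, ?_⟩
      rw [Finsupp.single_eq_of_ne ha]
      rfl
  · have := Finsupp.support_single_subset ha
    rw [Finset.mem_singleton] at this
    subst this
    simp [Pi.single_apply]
  · change _ = (Finsupp.single (Pi.single i 1) (1 : ℍ → ℂ)).sum
      fun (a : Fin (r + 1) → ℕ) (g : ℍ → ℂ) => g τ * ∏ j, φ j τ z ^ a j
    rw [Finsupp.sum_single_index (by simp)]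
    simp [Pi.single_apply]

theorem single_ne (i : Fin (r + 1)) :
    (Finsupp.single (Pi.single i 1) 1 : (Fin (r + 1) → ℕ) →₀ (ℍ → ℂ)) (Pi.single i 1) ≠ 0 := by
  rw [Finsupp.single_eq_same]
  exact one_ne_zero

/-- Otherwise the zero polynomial would be a second representation of the generator. -/
theorem FreelyGenerate.ne_zero (h : FreelyGenerate S W κ m φ) (i : Fin (r + 1)) : φ i ≠ 0 := by
  intro h0
  have := h.eq_single i (c := 0) (fun a => ⟨0, rfl⟩) (by simp) (by simp [h0])
  exact single_ne i (this ▸ rfl)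

/-- A generator of index zero would be a modular form G and so have the constant polynomial G as a
second representation. -/
theorem FreelyGenerate.index_pos (h : FreelyGenerate S W κ m φ) (hS : IsEvenPosDef S)
    (i : Fin (r + 1)) : 0 < m i := by
  by_contra hm
  have hm0 : m i = 0 := by omega
  obtain ⟨G, hG⟩ := (hm0 ▸ h.isWeak i).exists_modularForm hS
  have := h.eq_single i (c := Finsupp.single 0 G) (fun a => ?_) (fun a ha => ?_) fun τ z => ?_
  · have h1 := single_ne i
    rw [← this, Finsupp.single_eq_of_ne (by simp)] at h1
    exact h1 rfl
  · by_cases ha : a = 0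
    · subst ha
      refine ⟨ModularForm.mcast (by simp) G, ?_⟩
      rw [Finsupp.single_eq_same]
      rfl
    · refine ⟨0, ?_⟩
      rw [Finsupp.single_eq_of_ne ha]
      rfl
  · have := Finsupp.support_single_subset ha
    rw [Finset.mem_singleton] at this
    subst this
    simp [hm0]
  · change _ = (Finsupp.single 0 (G : ℍ → ℂ)).sum
      fun (a : Fin (r + 1) → ℕ) (g : ℍ → ℂ) => g τ * ∏ j, φ j τ z ^ a j
    rw [Finsupp.sum_single_index (by simp)]
    simp [hG]

/-- The leading coefficient Δ^{m_i} φ_i of Φ_i is a nonzero holomorphic Jacobi form of positive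
index, and such forms have positive weight. This bounds the degrees of the monomials in the main
induction. -/
theorem weight_pos (hr : 0 < r) (hS : IsEvenPosDef S) (hW : W ≤ orthogonalGroup S)
    (h : FreelyGenerate S W κ m φ) (hlift : LiftsExist S W κ m φ) (i : Fin (r + 1)) :
    0 < -κ i + 12 * m i := by
  by_contra hw
  obtain ⟨F, hF, ψ, hψ, -, hψm⟩ := hlift.generators i
  obtain ⟨ψ', hψ', hFJ, -⟩ := exists_isFourierJacobiExpansion hr hS hW hF
  rw [← hψ.unique hS hFJ] at hψ'
  have h0 := (hψ'.1 (m i)).eq_zero hr hS (h.index_pos hS i) (not_lt.mp hw)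
  refine h.ne_zero i (funext fun τ => funext fun z => ?_)
  have := hψm τ z
  rw [h0] at this
  exact (mul_eq_zero.mp this.symm).resolve_left
    (pow_ne_zero _ (ModularForm.discriminant_ne_zero τ))

end Generators

end

end OrthogonalModular

namespace OrthogonalModular

noncomputable section

open Complex Filter Topology

/-! ### The discriminant function. -/

section Discriminant

theorem discriminant_smul (γ : SL(2, ℤ)) (τ : ℍ) : ModularForm.discriminant (γ • τ)
    = (((γ 1 0 : ℤ) : ℂ) * τ + ((γ 1 1 : ℤ) : ℂ)) ^ (12 : ℤ) * ModularForm.discriminant τ := by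
  have hJ : UpperHalfPlane.denom γ τ = ((γ 1 0 : ℤ) : ℂ) * τ + ((γ 1 1 : ℤ) : ℂ) := by
    simp [UpperHalfPlane.denom]
  have h : SlashAction.map (12 : ℤ) γ ModularForm.discriminant = ModularForm.discriminant :=
    CuspForm.discriminant.slash_action_eq' _ ⟨γ, rfl⟩
  have h1 := congrFun h τ
  rw [ModularForm.SL_slash_apply] at h1
  rw [← h1, ← hJ, mul_left_comm, ← zpow_add₀ (UpperHalfPlane.denom_ne_zero _ _), add_neg_cancel,
    zpow_zero, mul_one]

theorem differentiableOn_discriminant : DifferentiableOn ℂ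
    (fun w : ℂ => ModularForm.discriminant (UpperHalfPlane.ofComplex w)) {w | 0 < w.im} :=
  UpperHalfPlane.mdifferentiable_iff.mp CuspForm.discriminant.holo'

theorem discriminant_add_int {w : ℂ} (n : ℤ) :
    ModularForm.discriminant (UpperHalfPlane.ofComplex (w + n))
      = ModularForm.discriminant (UpperHalfPlane.ofComplex w) := by
  have h := SlashInvariantFormClass.periodic_comp_ofComplex (h := 1) CuspForm.discriminant
    (by simp)
  simpa using h.int_mul n w

theorem exists_exp_le_discriminant : ∃ A K : ℝ, 0 < K ∧ ∀ τ : ℍ, A ≤ τ.im →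
    Real.exp (-2 * Real.pi * τ.im) ≤ K * ‖ModularForm.discriminant τ‖ := by
  obtain ⟨K, hK, h⟩ := ModularForm.exp_isBigO_discriminant.exists_pos
  obtain ⟨A, hA⟩ := (UpperHalfPlane.atImInfty_mem _).mp h.bound
  exact ⟨A, K, hK, fun τ hτ => by simpa using hA τ hτ⟩

end Discriminant

/-! ### Division of Jacobi forms by powers of Δ. -/

section Division

variable {r : ℕ} {S : Matrix (Fin r) (Fin r) ℤ} {W : Subgroup (GL (Fin r) ℤ)} {k : ℤ} {t m : ℕ}
  {ψ : JFun r} {f : ℕ → dualLattice S → ℂ}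

theorem HasFourierCoeff.add_int {ι : Type*} [Fintype ι] {C : Set (ι → ℝ)} {f : (ι → ℂ) → ℂ}
    {c : (ι → ℤ) → ℂ} (hc : HasFourierCoeff C f c) {Z : ι → ℂ} (hZ : Z ∈ tubeOver C)
    (a : ι → ℤ) : f (Z + fun j => (a j : ℂ)) = f Z := by
  have hmem : (Z + fun j => (a j : ℂ)) ∈ tubeOver C := by
    simpa [tubeOver] using hZ
  refine (hc _ hmem).unique ((hc Z hZ).congr_fun fun N => ?_)
  rw [fourierExp_add, fourierExp_intCast, mul_one]

theorem exists_hasFourierExpansion (hS : IsEvenPosDef S) {φ : JFun r}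
    {c : (Unit ⊕ Fin r → ℤ) → ℂ} (hc : HasFourierCoeff (halfSpace r) (jFun φ) c)
    (hneg : ∀ n < 0, ∀ v, c (jPoint n v) = 0) : ∃ f, HasFourierExpansion S φ f := by
  refine ⟨fun n l => c (jIndex (n, l)), (hasFourierExpansion_iff_coeff hS).mpr ?_⟩
  convert hc using 1
  funext N
  by_cases hN : ∃ p, jIndex (S := S) p = N
  · obtain ⟨p, rfl⟩ := hN
    exact extendCoeff_jIndex hS _ p
  · rw [extendCoeff, Function.extend_apply' _ _ _ hN, Pi.zero_apply, ← jPoint_eta N]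
    rcases lt_or_ge (N (Sum.inl ())) 0 with h | h
    · exact (hneg _ h _).symm
    · obtain ⟨n, hn⟩ := Int.eq_ofNat_of_zero_le h
      obtain ⟨l, hl⟩ := dualVec_surjective hS fun i => N (Sum.inr i)
      refine absurd ⟨(n, l), ?_⟩ hN
      rw [← jPoint_eta N, hn, ← hl, jIndex]

/-- For real z, a term with n ≥ m at height Im τ ≥ 1 is at most its value at height 1 times exp(-2πm
(Im τ - 1)). -/
theorem HasFourierExpansion.exists_bound (hf : HasFourierExpansion S ψ f)
    (h0 : ∀ n < m, ∀ l, f n l = 0) : ∃ B : ℝ, 0 ≤ B ∧ ∀ (τ : ℍ) (x : Fin r → ℝ), 1 ≤ τ.im →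
      ‖ψ τ fun i => (x i : ℂ)‖ ≤ B * Real.exp (-2 * Real.pi * τ.im) ^ m := by
  rw [hasFourierExpansion_iff] at hf
  have hs := (hf UpperHalfPlane.I 0).summable.norm
  refine ⟨(∑' p : ℕ × dualLattice S, ‖f p.1 p.2 * fourierExp (jIndex p)
    (jPoint ((UpperHalfPlane.I : ℍ) : ℂ) 0)‖) * (Real.exp (-2 * Real.pi) ^ m)⁻¹,
    mul_nonneg (tsum_nonneg fun _ => norm_nonneg _) (by positivity), fun τ x hτ => ?_⟩
  rw [mul_assoc, ← tsum_mul_right, ← (hf τ _).tsum_eq]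
  refine tsum_of_norm_bounded (hs.mul_right _).hasSum fun p => ?_
  by_cases hp : p.1 < m
  · simp [h0 _ hp]
  rw [norm_mul, norm_mul, mul_assoc]
  refine mul_le_mul_of_nonneg_left ?_ (norm_nonneg _)
  rw [norm_fourierExp, norm_fourierExp, ← Real.exp_nat_mul, ← Real.exp_nat_mul, ← Real.exp_neg,
    ← Real.exp_add, ← Real.exp_add, Real.exp_le_exp]
  simp only [jIndex, jPoint, Fintype.sum_sum_type, Sum.elim_inl, Sum.elim_inr,
    Finset.univ_unique, Finset.sum_singleton, UpperHalfPlane.coe_im, ofReal_im, Pi.zero_apply,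
    zero_im, mul_zero, Finset.sum_const_zero, add_zero, Int.cast_natCast, UpperHalfPlane.I_im]
  have : (0 : ℝ) ≤ 2 * Real.pi * (((p.1 : ℝ) - m) * (τ.im - 1)) := by
    have h1 : (m : ℝ) ≤ p.1 := by exact_mod_cast not_lt.mp hp
    exact mul_nonneg (by positivity) (mul_nonneg (by linarith) (by linarith))
  linarith

/-- Quotients of weak Jacobi forms by powers of the discriminant. -/
theorem IsWeakJacobiForm.div_discriminant (h : IsWeakJacobiForm S W k t ψ) (hS : IsEvenPosDef S)
    (hf : HasFourierExpansion S ψ f) (h0 : ∀ n < m, ∀ l, f n l = 0) :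
    IsWeakJacobiForm S W (k - 12 * m) t fun τ z => ψ τ z / ModularForm.discriminant τ ^ m := by
  have hhol : DifferentiableOn ℂ (fun p : ℂ × (Fin r → ℂ) =>
      ψ (UpperHalfPlane.ofComplex p.1) p.2
        / ModularForm.discriminant (UpperHalfPlane.ofComplex p.1) ^ m) {p | 0 < p.1.im} := by
    have hΔ : DifferentiableOn ℂ (fun p : ℂ × (Fin r → ℂ) =>
        ModularForm.discriminant (UpperHalfPlane.ofComplex p.1)) {p | 0 < p.1.im} :=
      differentiableOn_discriminant.comp (f := fun p : ℂ × (Fin r → ℂ) => p.1) (by fun_prop)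
        fun p hp => hp
    have hne : ∀ p : ℂ × (Fin r → ℂ),
        ModularForm.discriminant (UpperHalfPlane.ofComplex p.1) ^ m ≠ 0 := fun p =>
      pow_ne_zero m (ModularForm.discriminant_ne_zero _)
    simp only [div_eq_mul_inv]
    exact h.holomorphic.fun_mul ((hΔ.fun_pow m).fun_inv fun p _ => hne p)
  refine ⟨hhol, fun σ hσ τ z => by rw [h.invariant σ hσ], fun x y τ z => by
    rw [h.elliptic, mul_div_assoc], fun γ τ z => ?_, ?_⟩
  · have hJ0 : ((γ 1 0 : ℤ) : ℂ) * τ + ((γ 1 1 : ℤ) : ℂ) ≠ 0 := by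
      have := UpperHalfPlane.denom_ne_zero γ τ
      simpa [UpperHalfPlane.denom] using this
    rw [h.modular, discriminant_smul, mul_pow, ← zpow_natCast (_ ^ (12 : ℤ)), ← zpow_mul,
      zpow_sub₀ hJ0]
    have h1 := ModularForm.discriminant_ne_zero τ
    field_simp
  · set g : JFun r := fun τ z => ψ τ z / ModularForm.discriminant τ ^ m
    have hψ := (hasFourierExpansion_iff_coeff hS).mp hf
    -- The quotient is holomorphic, as Δ has no zeros, and periodic; what remains is that no
    -- negative n occurs.
    obtain ⟨c, hc⟩ := exists_fourierExp_expansion (f := jFun g) (C := halfSpace r)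
      isOpen_halfSpace (convex_halfSpace_gt (LinearMap.proj (Sum.inl ())).isLinear 0)
      (hhol.comp (f := fun Z : Unit ⊕ Fin r → ℂ => (Z (Sum.inl ()), fun i => Z (Sum.inr i)))
        (by fun_prop) fun Z hZ => hZ) fun Z hZ a => by
        have h1 := hψ.add_int hZ a
        simp only [jFun, Pi.add_apply] at h1
        simp only [jFun, Pi.add_apply, g, h1, discriminant_add_int]
    refine exists_hasFourierExpansion hS (c := c) hc fun n hn v => ?_
    obtain ⟨B, hB0, hB⟩ := hf.exists_bound h0
    obtain ⟨A, K, hK, hA⟩ := exists_exp_le_discriminant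
    -- The decay of ψ to order m is matched by the lower bound for |Δ|^m, so the quotient is bounded
    -- near the cusp for real z.
    have hg : ∀ (τ : ℍ) (x : Fin r → ℝ), max A 1 ≤ τ.im →
        ‖g τ fun i => (x i : ℂ)‖ ≤ B * K ^ m := by
      intro τ x hτ
      have h1 := norm_pos_iff.mpr (ModularForm.discriminant_ne_zero τ)
      rw [norm_div, norm_pow, div_le_iff₀ (by positivity), mul_assoc, ← mul_pow]
      refine (hB τ x ((le_max_right _ _).trans hτ)).trans ?_
      gcongr
      exact hA τ ((le_max_left _ _).trans hτ)
    by_contra hne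
    have hpos := norm_pos_iff.mpr hne
    obtain ⟨M, hM⟩ := exists_nat_gt (B * K ^ m / ‖c (jPoint n v)‖)
    rw [div_lt_iff₀ hpos] at hM
    set y : ℝ := max (max A 1) M
    have hy1 : max A 1 ≤ y := le_max_left _ _
    have hy0 : 0 < y := one_pos.trans_le ((le_max_right A 1).trans hy1)
    have hyM : (M : ℝ) ≤ y := le_max_right _ _
    set Z : Unit ⊕ Fin r → ℂ := jPoint (I * y) 0
    have hX : ∀ X : Unit ⊕ Fin r → ℝ, ∃ τ : ℍ, τ.im = y ∧ realAdd X Z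
        = jPoint (τ : ℂ) fun i => (X (Sum.inr i) : ℂ) := fun X =>
      ⟨⟨X (Sum.inl ()) + I * y, by simpa using hy0⟩, by simp [UpperHalfPlane.im], by
        funext i
        rcases i with i | i <;> simp [realAdd, Z, jPoint]⟩
    -- Bessel's inequality for a single coefficient at height y gives |c| exp(-2πny) ≤ B K^m. As n ≤
    -- -1, the exponential is at least y ≥ M, and M was chosen too large for that.
    have hbes := sum_norm_coeff_sq_le (a := c) (f := jFun g) (C := B * K ^ m) Z (fun X => by
      obtain ⟨τ, -, hτ⟩ := hX X
      rw [hτ]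
      exact hc _ (jPoint_mem _ _)) (fun X => by
      obtain ⟨τ, hτy, hτ⟩ := hX X
      rw [hτ, jFun_jPoint]
      exact hg τ _ (hτy ▸ hy1)) {jPoint n v}
    rw [Finset.sum_singleton] at hbes
    have hle := (sq_le_sq₀ (norm_nonneg _) (by positivity)).mp hbes
    rw [norm_mul, norm_fourierExp] at hle
    simp only [Z, jPoint, Fintype.sum_sum_type, Sum.elim_inl, Sum.elim_inr,
      Finset.univ_unique, Finset.sum_singleton, Pi.zero_apply, zero_im, mul_zero,
      Finset.sum_const_zero, add_zero, I_mul_im, ofReal_re] at hle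
    have hn1 : (n : ℝ) ≤ -1 := by exact_mod_cast Int.le_sub_one_of_lt hn
    have hexp : y ≤ Real.exp (-(2 * Real.pi * (n * y))) := by
      refine le_trans ?_ (Real.add_one_le_exp _)
      have := Real.pi_gt_three
      nlinarith [mul_nonneg (by linarith : (0 : ℝ) ≤ -1 - n) hy0.le,
        mul_nonneg (mul_nonneg Real.pi_pos.le (by linarith : (0 : ℝ) ≤ -1 - n)) hy0.le]
    have : (M : ℝ) * ‖c (jPoint n v)‖ ≤ B * K ^ m :=
      (mul_comm (M : ℝ) _ ▸ mul_le_mul_of_nonneg_left (hyM.trans hexp) hpos.le).trans hle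
    linarith

end Division

end

end OrthogonalModular

namespace OrthogonalModular

noncomputable section

open Complex Filter Topology

/-! ### Products and sums of modular forms and their leading coefficients. -/

section Leading

variable {r : ℕ} {S : Matrix (Fin r) (Fin r) ℤ} {W : Subgroup (GL (Fin r) ℤ)} {k k' : ℤ}
  {m m' : ℕ} {F F' : affineCone S → ℂ} {ψ ψ' : ℕ → JFun r} {g g' : JFun r}

theorem mul_mem_modularForms {Γ : Subgroup (GL (MIndex r) ℤ)} (h : F ∈ modularForms S Γ k)
    (h' : F' ∈ modularForms S Γ k') : F * F' ∈ modularForms S Γ (k + k') := by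
  obtain ⟨⟨G, hG, hG'⟩, h1, h2⟩ := h
  obtain ⟨⟨H, hH, hH'⟩, h3, h4⟩ := h'
  refine ⟨⟨G * H, hG.mul hH, fun Z => by simp [hG', hH']⟩, fun t Z Z' ht hZ => ?_,
    fun γ hγ Z Z' hZ => ?_⟩
  · simp only [Pi.mul_apply]
    rw [h1 t Z Z' ht hZ, h3 t Z Z' ht hZ, neg_add, zpow_add₀ ht]
    ring
  · simp only [Pi.mul_apply]
    rw [h2 γ hγ Z Z' hZ, h4 γ hγ Z Z' hZ]

theorem const_mem_modularForms {Γ : Subgroup (GL (MIndex r) ℤ)} (c : ℂ) :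
    (fun _ => c) ∈ modularForms S Γ 0 :=
  ⟨⟨fun _ => c, differentiableOn_const c, fun _ => rfl⟩, by simp, by simp⟩

/-- The product of formal series. -/
def cauchyProduct (ψ ψ' : ℕ → JFun r) (j : ℕ) : JFun r :=
  ∑ p ∈ Finset.HasAntidiagonal.antidiagonal j, ψ p.1 * ψ' p.2

theorem IsFourierJacobiExpansion.mul (h : IsFourierJacobiExpansion S F ψ)
    (h' : IsFourierJacobiExpansion S F' ψ') :
    IsFourierJacobiExpansion S (F * F') (cauchyProduct ψ ψ') := by
  intro Z
  have h1 := (h Z).summable.norm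
  have h2 := (h' Z).summable.norm
  have h3 : fjTerm (cauchyProduct ψ ψ') = fun j Z =>
      ∑ p ∈ Finset.HasAntidiagonal.antidiagonal j, fjTerm ψ p.1 Z * fjTerm ψ' p.2 Z := by
    funext j Z
    simp only [fjTerm, cauchyProduct, Finset.sum_apply, Pi.mul_apply, Finset.sum_mul]
    refine Finset.sum_congr rfl fun p hp => ?_
    rw [← Finset.HasAntidiagonal.mem_antidiagonal.mp hp,
      mul_mul_mul_comm (ψ p.1 Z.1 Z.2.1) _ (ψ' p.2 Z.1 Z.2.1), ← exp_add]
    push_cast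
    ring_nf
  rw [h3, Pi.mul_apply, ← (h Z).tsum_eq, ← (h' Z).tsum_eq,
    tsum_mul_tsum_eq_tsum_sum_antidiagonal_of_summable_norm h1 h2]
  exact (summable_norm_sum_mul_antidiagonal_of_summable_norm h1 h2).of_norm.hasSum

theorem IsFourierJacobiExpansion.add (h : IsFourierJacobiExpansion S F ψ)
    (h' : IsFourierJacobiExpansion S F' ψ') :
    IsFourierJacobiExpansion S (F + F') (ψ + ψ') := fun Z =>
  ((h Z).add (h' Z)).congr_fun fun j => by simp [fjTerm, add_mul]

theorem IsFourierJacobiExpansion.smul (h : IsFourierJacobiExpansion S F ψ) (c : ℂ) :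
    IsFourierJacobiExpansion S (c • F) (c • ψ) := fun Z =>
  ((h Z).mul_left c).congr_fun fun j => by simp [fjTerm, mul_assoc]

theorem isFourierJacobiExpansion_zero : IsFourierJacobiExpansion S 0 0 := fun _ => by
  simp [fjTerm]

theorem isFourierJacobiExpansion_const (c : ℂ) :
    IsFourierJacobiExpansion S (fun _ => c) (Pi.single 0 fun _ _ => c) := fun Z => by
  convert hasSum_ite_eq (0 : ℕ) c using 2 with j
  rcases eq_or_ne j 0 with rfl | hj
  · simp [fjTerm]
  · simp [fjTerm, hj]

/-- There is a modular form of weight `k` with Fourier-Jacobi expansion `g ξᵐ + O(ξᵐ⁺¹)`. -/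
def HasLift (S : Matrix (Fin r) (Fin r) ℤ) (W : Subgroup (GL (Fin r) ℤ)) (k : ℤ) (m : ℕ)
    (g : JFun r) : Prop :=
  ∃ F ∈ modularForms S (Gam S W) k, ∃ ψ, IsFourierJacobiExpansion S F ψ ∧ (∀ j < m, ψ j = 0) ∧
    ψ m = g

theorem HasLift.mul (h : HasLift S W k m g) (h' : HasLift S W k' m' g') :
    HasLift S W (k + k') (m + m') (g * g') := by
  obtain ⟨F, hF, ψ, hψ, h0, rfl⟩ := h
  obtain ⟨F', hF', ψ', hψ', h0', rfl⟩ := h'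
  refine ⟨F * F', mul_mem_modularForms hF hF', _, hψ.mul hψ', fun j hj => ?_, ?_⟩
  · refine Finset.sum_eq_zero fun p hp => ?_
    rw [Finset.HasAntidiagonal.mem_antidiagonal] at hp
    rcases lt_or_ge p.1 m with h | h
    · rw [h0 _ h, zero_mul]
    · rw [h0' p.2 (by omega), mul_zero]
  · refine Finset.sum_eq_single_of_mem (m, m') (by simp) fun p hp hne => ?_
    rw [Finset.HasAntidiagonal.mem_antidiagonal] at hp
    rcases lt_trichotomy p.1 m with h | h | h
    · rw [h0 _ h, zero_mul]
    · exact absurd (Prod.ext h (by simp only; omega)) hne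
    · rw [h0' p.2 (by omega), mul_zero]

theorem HasLift.add (h : HasLift S W k m g) (h' : HasLift S W k m g') :
    HasLift S W k m (g + g') := by
  obtain ⟨F, hF, ψ, hψ, h0, rfl⟩ := h
  obtain ⟨F', hF', ψ', hψ', h0', rfl⟩ := h'
  exact ⟨F + F', add_mem hF hF', _, hψ.add hψ', fun j hj => by simp [h0 j hj, h0' j hj], rfl⟩

theorem HasLift.smul (h : HasLift S W k m g) (c : ℂ) : HasLift S W k m (c • g) := by
  obtain ⟨F, hF, ψ, hψ, h0, rfl⟩ := h
  exact ⟨c • F, Submodule.smul_mem _ c hF, _, hψ.smul c, fun j hj => by simp [h0 j hj], rfl⟩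

theorem hasLift_zero : HasLift S W k m 0 :=
  ⟨0, zero_mem _, 0, isFourierJacobiExpansion_zero, fun _ _ => rfl, rfl⟩

theorem hasLift_const (c : ℂ) : HasLift S W 0 0 fun _ _ => c :=
  ⟨_, const_mem_modularForms c, _, isFourierJacobiExpansion_const c, fun _ h => by omega,
    Pi.single_eq_same _ _⟩

theorem HasLift.pow (h : HasLift S W k m g) (n : ℕ) : HasLift S W (n * k) (n * m) (g ^ n) := by
  induction n with
  | zero =>
    simp only [Nat.cast_zero, zero_mul, pow_zero]
    exact hasLift_const 1
  | succ n ih =>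
    have := ih.mul h
    rw [pow_succ]
    convert this using 1
    · push_cast
      ring
    · ring

theorem hasLift_prod {ι : Type*} {k : ι → ℤ} {m : ι → ℕ} {g : ι → JFun r} (s : Finset ι)
    (h : ∀ i, HasLift S W (k i) (m i) (g i)) :
    HasLift S W (∑ i ∈ s, k i) (∑ i ∈ s, m i) (∏ i ∈ s, g i) := by
  classical
  induction s using Finset.induction_on with
  | empty => exact hasLift_const 1
  | insert i s hi ih =>
    rw [Finset.sum_insert hi, Finset.sum_insert hi, Finset.prod_insert hi]
    exact (h i).mul ih

theorem hasLift_sum {ι : Type*} {g : ι → JFun r} (s : Finset ι)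
    (h : ∀ i ∈ s, HasLift S W k m (g i)) : HasLift S W k m (∑ i ∈ s, g i) := by
  classical
  induction s using Finset.induction_on with
  | empty => exact hasLift_zero
  | insert i s hi ih =>
    rw [Finset.sum_insert hi]
    exact (h i (Finset.mem_insert_self _ _)).add
      (ih fun j hj => h j (Finset.mem_insert_of_mem hj))

end Leading

/-! ### Lifting modular forms for SL(2, ℤ). -/

section LevelOne

open ModularForm

variable {r : ℕ} {S : Matrix (Fin r) (Fin r) ℤ} {W : Subgroup (GL (Fin r) ℤ)}

/-- Subtracting a multiple of a monomial in `E₄` and `E₆` leaves a multiple of the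
discriminant. -/
theorem exists_eq_eisenstein_add_discriminant {k : ℤ} (g : ModularForm 𝒮ℒ k) {a b : ℕ}
    (hab : (a * 4 + b * 6 : ℤ) = k) : ∃ (c : ℂ) (g' : ModularForm 𝒮ℒ (k - 12)),
      ∀ τ, g τ = c * (E₄ τ ^ a * E₆ τ ^ b) + discriminant τ * g' τ := by
  set h : ModularForm 𝒮ℒ k := ModularForm.mcast hab ((E₄.pow a).mul (E₆.pow b))
  have hcoe : ⇑h = ⇑((E₄.pow a).mul (E₆.pow b)) := rfl
  have hτ : ∀ τ, h τ = E₄ τ ^ a * E₆ τ ^ b := fun τ => by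
    rw [hcoe]
    simp
  have h4 : PowerSeries.constantCoeff (UpperHalfPlane.qExpansion 1 E₄) = 1 := by
    rw [← PowerSeries.coeff_zero_eq_constantCoeff_apply]
    exact EisensteinSeries.E_qExpansion_coeff_zero _ ⟨2, rfl⟩
  have h6 : PowerSeries.constantCoeff (UpperHalfPlane.qExpansion 1 E₆) = 1 := by
    rw [← PowerSeries.coeff_zero_eq_constantCoeff_apply]
    exact EisensteinSeries.E_qExpansion_coeff_zero _ ⟨3, rfl⟩
  have h0 : (UpperHalfPlane.qExpansion 1 h).coeff 0 = 1 := by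
    rw [hcoe, ModularForm.qExpansion_mul one_pos one_mem_strictPeriods_SL,
      ModularForm.qExpansion_pow one_pos one_mem_strictPeriods_SL,
      ModularForm.qExpansion_pow one_pos one_mem_strictPeriods_SL,
      PowerSeries.coeff_zero_eq_constantCoeff_apply, map_mul, map_pow, map_pow, h4, h6]
    simp
  set c := (UpperHalfPlane.qExpansion 1 g).coeff 0
  have hcusp : (UpperHalfPlane.qExpansion 1 (g - c • h)).coeff 0 = 0 := by
    rw [← FunLike.coe_smul c h, ModularForm.qExpansion_sub one_pos one_mem_strictPeriods_SL, FunLike.coe_smul,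
      ModularForm.qExpansion_smul one_pos one_mem_strictPeriods_SL, map_sub,
      PowerSeries.coeff_smul, h0, smul_eq_mul, mul_one, sub_self]
  -- Both constant terms agree after scaling by c, so the difference is a cusp form, and cusp forms
  -- are divisible by Δ.
  refine ⟨c, CuspForm.discriminantEquiv (toCuspForm (g - c • h) hcusp), fun τ => ?_⟩
  rw [discriminant_mul_discriminantEquiv_apply, ← hτ]
  change g τ = c * h τ + (g τ - c * h τ)
  ring

/-- Modular forms are polynomials in E₄ and E₆, by induction on the weight: up to a multiple of E₄^a
E₆^b a form is Δ times one of weight k - 12, and Δ = (E₄³ - E₆²) / 1728 lifts as well. -/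
theorem hasLift_modularForm
    (h4 : HasLift S W 4 0 fun τ _ => E₄ τ) (h6 : HasLift S W 6 0 fun τ _ => E₆ τ)
    {k : ℤ} (g : ModularForm 𝒮ℒ k) : HasLift S W k 0 fun τ _ => g τ := by
  have hmono : ∀ a b : ℕ, HasLift S W (a * 4 + b * 6) 0 fun τ _ => E₄ τ ^ a * E₆ τ ^ b :=
    fun a b => (h4.pow a).mul (h6.pow b)
  have hΔ : HasLift S W 12 0 fun τ _ => discriminant τ := by
    have := ((hmono 3 0).add ((hmono 0 2).smul (-1))).smul (1 / 1728)
    convert this using 1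
    · norm_num
    funext τ z
    rw [discriminant_eq_E₄_cube_sub_E₆_sq]
    simp only [Pi.smul_apply, Pi.add_apply, smul_eq_mul]
    ring
  have hzero : ∀ {k : ℤ} (g : ModularForm 𝒮ℒ k), g = 0 → HasLift S W k 0 fun τ _ => g τ := by
    rintro k _ rfl
    exact hasLift_zero
  suffices H : ∀ (n : ℕ) (k : ℤ), k < n → ∀ g : ModularForm 𝒮ℒ k,
      HasLift S W k 0 fun τ _ => g τ from H (k.toNat + 1) k (by omega) g
  intro n
  induction n with
  | zero =>
    exact fun k hk g =>
      hzero g (rank_zero_iff_forall_zero.mp (levelOne_neg_weight_rank_zero (by simpa using hk)) g)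
  | succ n ih =>
    intro k hk g
    rcases lt_or_ge k n with hkn | hkn
    · exact ih k hkn g
    obtain rfl : k = n := by push_cast at hk; omega
    rcases Nat.even_or_odd n with hn | hn
    · rcases eq_or_ne n 2 with rfl | hn2
      · exact hzero g (rank_zero_iff_forall_zero.mp levelOne_weight_two_rank_zero g)
      -- Write n = 2j. If j = 2i, then n = 4i; if j = 2i + 1, then n = 4(i - 1) + 6, and i ≥ 1
      -- because n ≠ 2.
      · obtain ⟨a, b, hab⟩ : ∃ a b : ℕ, (a * 4 + b * 6 : ℤ) = n := by
          obtain ⟨j, hj⟩ := hn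
          rcases Nat.even_or_odd j with ⟨i, hi⟩ | ⟨i, hi⟩
          · exact ⟨i, 0, by push_cast; omega⟩
          · exact ⟨i - 1, 1, by omega⟩
        obtain ⟨c, g', hg'⟩ := exists_eq_eisenstein_add_discriminant g hab
        have h1 := (hmono a b).smul c
        rw [hab] at h1
        have h2 := hΔ.mul (ih _ (by omega) g')
        rw [add_sub_cancel, add_zero] at h2
        convert h1.add h2 using 1
        funext τ z
        simp [hg']
    · exact hzero g (levelOne_odd_weight_eq_zero (by exact_mod_cast hn) g)

end LevelOne

/-! ### Removing leading coefficients. -/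

section Main

variable {r : ℕ} {S : Matrix (Fin r) (Fin r) ℤ} {W : Subgroup (GL (Fin r) ℤ)}
  {κ : Fin (r + 1) → ℤ} {m : Fin (r + 1) → ℕ} {φ : Fin (r + 1) → JFun r} {k : ℤ} {t : ℕ}
  {ψ : ℕ → JFun r}

/-- For n < t the symmetry gives f_t(n, ℓ) = f_n(t, ℓ), which is zero because ψ_n = 0. -/
theorem isWeakJacobiForm_div_discriminant (hS : IsEvenPosDef S)
    (hψ : ψ ∈ formalExpansions S W k) (h0 : ∀ j < t, ψ j = 0) :
    IsWeakJacobiForm S W (k - 12 * t) t fun τ z => ψ t τ z / ModularForm.discriminant τ ^ t := by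
  obtain ⟨h, f, hf, hs⟩ := hψ
  refine (h t).1.div_discriminant hS (hf t) fun n _ l => ?_
  have hz : HasFourierExpansion S (0 : JFun r) 0 := fun τ z => by simp
  have hn := hf n
  rw [h0 n ‹_›] at hn
  rw [hs t n l, hn.unique hS hz]
  rfl

/-- The leading coefficient of a formal Fourier-Jacobi expansion is the leading coefficient of a
modular form, and it vanishes if its index is large. -/
theorem hasLift_leading (hr : 0 < r) (hS : IsEvenPosDef S) (hW : W ≤ orthogonalGroup S)
    (hfree : FreelyGenerate S W κ m φ) (hlift : LiftsExist S W κ m φ)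
    (hψ : ψ ∈ formalExpansions S W k) (h0 : ∀ j < t, ψ j = 0) :
    HasLift S W k t (ψ t) ∧ (k * ∑ i, (m i : ℤ) < t → ψ t = 0) := by
  have h4 : HasLift S W 4 0 fun τ _ => ModularForm.E₄ τ := by
    obtain ⟨F, hF, ψ, h, h'⟩ := hlift.weightFour
    exact ⟨F, hF, ψ, h, fun _ h => by omega, funext fun τ => funext fun z => h' τ z⟩
  have h6 : HasLift S W 6 0 fun τ _ => ModularForm.E₆ τ := by
    obtain ⟨F, hF, ψ, h, h'⟩ := hlift.weightSix
    exact ⟨F, hF, ψ, h, fun _ h => by omega, funext fun τ => funext fun z => h' τ z⟩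
  have hgen : ∀ i, HasLift S W (-κ i + 12 * m i) (m i)
      fun τ z => ModularForm.discriminant τ ^ m i * φ i τ z := fun i => by
    obtain ⟨F, hF, ψ, h, h', h''⟩ := hlift.generators i
    exact ⟨F, hF, ψ, h, h', funext fun τ => funext fun z => h'' τ z⟩
  obtain ⟨c, ⟨hc1, hc2, hc3⟩, -⟩ :=
    hfree.existsUnique _ _ _ (isWeakJacobiForm_div_discriminant hS hψ h0)
  -- As ∑ a_i m_i = t for each monomial, Δ^t distributes over the generators as ∏ (Δ^{m_i})^{a_i}.
  have hψt : ψ t = ∑ a ∈ c.support, fun τ z => c a τ *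
      ∏ i, (ModularForm.discriminant τ ^ m i * φ i τ z) ^ a i := by
    funext τ z
    rw [Finset.sum_apply, Finset.sum_apply,
      ← div_mul_cancel₀ (ψ t τ z) (pow_ne_zero t (ModularForm.discriminant_ne_zero τ)), hc3,
      Finset.sum_mul]
    refine Finset.sum_congr rfl fun a ha => ?_
    simp only [mul_pow, Finset.prod_mul_distrib, ← pow_mul, Finset.prod_pow_eq_pow_sum]
    rw [← hc2 a ha]
    simp only [mul_comm (m _)]
    ring
  have hat : ∀ a ∈ c.support, ∑ i, (a i : ℤ) * m i = t := fun a ha => by exact_mod_cast hc2 a ha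
  have hweight : ∀ a ∈ c.support, ∑ i, (a i : ℤ) * (-κ i + 12 * m i)
      = 12 * t - ∑ i, (a i : ℤ) * κ i := fun a ha => by
    rw [← hat a ha, Finset.mul_sum, ← Finset.sum_sub_distrib]
    exact Finset.sum_congr rfl fun i _ => by ring
  refine ⟨?_, fun ht => ?_⟩
  · rw [hψt]
    refine hasLift_sum _ fun a ha => ?_
    obtain ⟨g, hg⟩ := hc1 a
    have h1 := (hasLift_modularForm h4 h6 g).mul
      (hasLift_prod Finset.univ fun i => (hgen i).pow (a i))
    rw [zero_add, hc2 a ha] at h1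
    convert h1 using 1
    · rw [hweight a ha]
      ring
    · funext τ z
      simp [hg, Finset.prod_apply]
  · rw [hψt]
    refine Finset.sum_eq_zero fun a ha => ?_
    obtain ⟨g, hg⟩ := hc1 a
    -- A coefficient of negative weight is zero. Otherwise ∑ a_i ≤ ∑ a_i (-κ_i + 12 m_i) ≤ k, hence
    -- t = ∑ a_i m_i ≤ k ∑ m_i, against the assumption on t.
    rcases lt_or_ge (k - 12 * t + ∑ i, (a i : ℤ) * κ i) 0 with hw | hw
    · refine absurd ?_ (Finsupp.mem_support_iff.mp ha)
      rw [hg, rank_zero_iff_forall_zero.mp (ModularForm.levelOne_neg_weight_rank_zero hw) g]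
      rfl
    · exfalso
      have h1 : ∑ i, (a i : ℤ) ≤ k := by
        calc ∑ i, (a i : ℤ) ≤ ∑ i, (a i : ℤ) * (-κ i + 12 * m i) :=
              Finset.sum_le_sum fun i _ => le_mul_of_one_le_right (Int.natCast_nonneg _)
                (weight_pos hr hS hW hfree hlift i)
          _ = 12 * t - ∑ i, (a i : ℤ) * κ i := hweight a ha
          _ ≤ k := by linarith
      have h2 : (t : ℤ) ≤ (∑ i, (a i : ℤ)) * ∑ i, (m i : ℤ) := by
        rw [← hat a ha, Finset.sum_mul]
        exact Finset.sum_le_sum fun i _ => mul_le_mul_of_nonneg_left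
          (Finset.single_le_sum (f := fun i => (m i : ℤ)) (fun i _ => Int.natCast_nonneg _)
            (Finset.mem_univ i)) (Int.natCast_nonneg _)
      have h3 : (∑ i, (a i : ℤ)) * ∑ i, (m i : ℤ) ≤ k * ∑ i, (m i : ℤ) :=
        mul_le_mul_of_nonneg_right h1 (Finset.sum_nonneg fun _ _ => Int.natCast_nonneg _)
      linarith

/-- Every formal Fourier-Jacobi expansion is the expansion of a modular form. -/
theorem exists_modularForm_of_formalExpansion (hr : 0 < r) (hS : IsEvenPosDef S)
    (hW : W ≤ orthogonalGroup S) (hfree : FreelyGenerate S W κ m φ)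
    (hlift : LiftsExist S W κ m φ) (hψ : ψ ∈ formalExpansions S W k) :
    ∃ F ∈ modularForms S (Gam S W) k, IsFourierJacobiExpansion S F ψ := by
  -- From index B on, the strict inequality of `hasLift_leading` holds and leading coefficients
  -- vanish. The induction is on n = B - t.
  set B : ℕ := (k * ∑ i, (m i : ℤ)).toNat + 1
  suffices H : ∀ n t : ℕ, t + n = B → ∀ ψ ∈ formalExpansions S W k, (∀ j < t, ψ j = 0) →
      ∃ F ∈ modularForms S (Gam S W) k, IsFourierJacobiExpansion S F ψ from
    H B 0 (zero_add B) ψ hψ fun j hj => by omega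
  intro n
  induction n with
  | zero =>
    intro t ht ψ hψ h0
    have hzero : ∀ j, ψ j = 0 := by
      intro j
      induction j using Nat.strong_induction_on with
      | _ j ih =>
        rcases lt_or_ge j t with hj | hj
        · exact h0 j hj
        · exact (hasLift_leading hr hS hW hfree hlift hψ ih).2 (by omega)
    rw [show ψ = 0 from funext hzero]
    exact ⟨0, zero_mem _, isFourierJacobiExpansion_zero⟩
  | succ n ih =>
    intro t ht ψ hψ h0
    -- Subtract the expansion of a modular form with the same leading coefficient; the difference is
    -- again a formal expansion and starts at t + 1 or later.
    obtain ⟨F, hF, ψ', hFψ, h0', hψt⟩ := (hasLift_leading hr hS hW hfree hlift hψ h0).1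
    obtain ⟨ψ'', hψ'', hFJ, -⟩ := exists_isFourierJacobiExpansion hr hS hW hF
    rw [← hFψ.unique hS hFJ] at hψ''
    obtain ⟨F', hF', hFψ'⟩ := ih (t + 1) (by omega) (ψ - ψ') (sub_mem hψ hψ'') fun j hj => by
      rcases Nat.lt_succ_iff_lt_or_eq.mp hj with hj | rfl
      · simp [h0 j hj, h0' j hj]
      · simp [hψt]
    refine ⟨F' + F, add_mem hF' hF, ?_⟩
    simpa using hFψ'.add hFψ

end Main

end

end OrthogonalModular
namespace OrthogonalModular

noncomputable section

/-! ### The expansion map is linear and injective. -/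

section Isomorphism

variable {r : ℕ} {S : Matrix (Fin r) (Fin r) ℤ} {W : Subgroup (GL (Fin r) ℤ)} {k : ℤ}
  {F : affineCone S → ℂ}

theorem eq_zero_of_isFourierJacobiExpansion (hS : IsEvenPosDef S)
    (hF : F ∈ modularForms S (Gam S W) k) (h : IsFourierJacobiExpansion S F 0) : F = 0 := by
  refine eq_zero_of_tubeFun hF fun Z hZ => ?_
  rw [isFourierJacobiExpansion_iff hS] at h
  rw [← kPoint_eta Z] at hZ ⊢
  have h1 := h ⟨Z (Sum.inl 1), (kPoint_mem_tubeK.mp hZ).1⟩ _ _ hZ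
  refine h1.unique ?_
  simp

/-- The Fourier-Jacobi expansion as a linear map. -/
theorem exists_linearMap (hr : 0 < r) (hS : IsEvenPosDef S) (hW : W ≤ orthogonalGroup S) (k : ℤ) :
    ∃ e : modularForms S (Gam S W) k →ₗ[ℂ] formalExpansions S W k,
      ∀ F : modularForms S (Gam S W) k, IsFourierJacobiExpansion S F (e F) := by
  choose ψ hψ hFJ _ using fun F : modularForms S (Gam S W) k =>
    exists_isFourierJacobiExpansion hr hS hW F.2
  -- Linearity follows from uniqueness of Fourier–Jacobi expansions.
  exact ⟨{ toFun := fun F => ⟨ψ F, hψ F⟩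
           map_add' := fun F F' => Subtype.ext ((hFJ (F + F')).unique hS ((hFJ F).add (hFJ F')))
           map_smul' := fun c F => Subtype.ext ((hFJ (c • F)).unique hS ((hFJ F).smul c)) }, hFJ⟩

end Isomorphism

end

end OrthogonalModular

/-- `L` is `ℤ^r` with Gram matrix `S`, and `W` is a group between the discriminant kernel of
`O(L)` and `O(L)`. -/
theorem mainTheorem7 (r : ℕ) (hr : 0 < r) (S : Matrix (Fin r) (Fin r) ℤ)
    (hS : OrthogonalModular.IsEvenPosDef S) (W : Subgroup (GL (Fin r) ℤ))
    (hW : OrthogonalModular.discriminantKernel S ≤ W)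
    (hW' : W ≤ OrthogonalModular.orthogonalGroup S)
    (κ : Fin (r + 1) → ℤ) (m : Fin (r + 1) → ℕ) (φ : Fin (r + 1) → OrthogonalModular.JFun r)
    (hfree : OrthogonalModular.FreelyGenerate S W κ m φ)
    (hlift : OrthogonalModular.LiftsExist S W κ m φ) (k : ℕ) :
    (∃ e : OrthogonalModular.modularForms S (OrthogonalModular.Gam S W) k ≃ₗ[ℂ]
        OrthogonalModular.formalExpansions S W k,
      ∀ F : OrthogonalModular.modularForms S (OrthogonalModular.Gam S W) k,
        OrthogonalModular.IsFourierJacobiExpansion S F (e F)) ∧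
    ∀ ψ ∈ OrthogonalModular.formalExpansions S W k,
      SummableLocallyUniformlyOn (OrthogonalModular.fjTerm ψ)
        (OrthogonalModular.tubeDomain S) := by
  obtain ⟨e, he⟩ := OrthogonalModular.exists_linearMap (W := W) hr hS hW' k
  have hsurj : ∀ ψ ∈ OrthogonalModular.formalExpansions S W k,
      ∃ F ∈ OrthogonalModular.modularForms S (OrthogonalModular.Gam S W) k,
        OrthogonalModular.IsFourierJacobiExpansion S F ψ := fun ψ hψ =>
    OrthogonalModular.exists_modularForm_of_formalExpansion hr hS hW' hfree hlift hψ
  refine ⟨⟨LinearEquiv.ofBijective e ⟨?_, fun ψ => ?_⟩, he⟩, fun ψ hψ => ?_⟩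
  · rw [injective_iff_map_eq_zero]
    intro F hF
    have h := he F
    rw [hF] at h
    exact Subtype.ext (OrthogonalModular.eq_zero_of_isFourierJacobiExpansion hS F.2 h)
  · obtain ⟨F, hF, h⟩ := hsurj ψ ψ.2
    exact ⟨⟨F, hF⟩, Subtype.ext ((he ⟨F, hF⟩).unique hS h)⟩
  -- The series is the expansion of a modular form, by uniqueness the one known to converge locally
  -- uniformly.
  · obtain ⟨F, hF, h⟩ := hsurj ψ hψ
    obtain ⟨ψ', -, h', hs⟩ :=
      OrthogonalModular.exists_isFourierJacobiExpansion hr hS hW' hF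
    rwa [h.unique hS h']
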